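/- Setting. Fix integers $k_1,k_2,k_v\ge 0$, $k_F=k_1+k_2$, $k=k_F+k_v$, and $\lambda=(\lambda_1',\lambda_2')'\in\mathbb R^{k_F}$ with $\lambda_1\in\mathbb R^{k_1}$, $\lambda_2\in\mathbb R^{k_2}$. For all sample sizes $(N,T)$ excess returns follow $$r_{it}=\lambda'\beta_i+(F_t-EF_t)'\beta_i+v_t'\mu_i+e_{it},\qquad i\le N,\ t\le T,$$ with observed factors $F_t\in\mathbb R^{k_F}$, unobserved factors $v_t\in\mathbb R^{k_v}$, errors $e_{it}$, and non-random loadings $\beta_i=(\beta_{1i}',\beta_{2i}')'$ and $\mu_i$. All random variables have finite second moments, $v_t$ has mean zero and is uncorrelated with $F_t$, and $e_{it}$ has mean zero and is uncorrelated with $F_t$ and $v_t$. The probability space, the variables and the loadings may depend on $(N,T)$; $\lambda$ and the matrices $\Sigma_F,\Omega_F,\Omega_{vF},\Gamma,\Sigma_{SF^2}$ below do not. All limits are for $N,T\to\infty$ without restriction on relative rates. Let $T_1,\dots,T_4\subset\{1,\dots,T\}$ be disjoint, each of size $\lfloor T/4\rfloor$. For a set $I$ of periods put $\widetilde F^{I}_t=F_t-|I|^{-1}\sum_{s\in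 I}F_s$ and $\eta_I=|I|^{-1/2}\sum_{t\in I}\Sigma_F^{-1}\widetilde F^{I}_tv_t'$; write $\widetilde F_t$, $\eta_T$ for $I=\{1,\dots,T\}$. Assumption FACTORS. $F_t$ is stationary with finite fourth moments and positive definite covariance matrix $\Sigma_F$. Jointly, $T^{-1/2}\sum_{t}(F_t-EF_t)\Rightarrow N(0,\Omega_F)$, $\eta_T\Rightarrow\eta$ and $T^{-1/2}\sum_t v_t\Rightarrow N(0,I_{k_v})$, where $\mathrm{vec}(\eta)\sim N(0,\Omega_{vF})$ and $\Omega_{vF}$ is positive definite. On the subsamples, $|T_j|^{-1}\sum_{t\in T_j}\widetilde F^{T_j}_t\widetilde F^{T_j\prime}_t\to^p\Sigma_F$ for each $j$, and $(\eta_{T_1},\dots,\eta_{T_4})\Rightarrow(\eta_1,\dots,\eta_4)$ with $\eta_1,\dots,\eta_4$ independent copies of $\eta$. Assumption LOADINGS. With $\gamma_i=(\beta_{1i}',\sqrt T\beta_{2i}',\mu_i')'$: $N^{-1}\sum_{i=1}^N\gamma_i\gamma_i'\to\Gamma$, a positive definite $k\times k$ matrix, and $\sup_{N,T}N^{-1}\sum_{i=1}^N\|\gamma_i\|^4<\infty$.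 Assumption ERRORS. (i) Conditionally on $\mathcal F=\sigma(F_1,\dots,F_T,v_1,\dots,v_T)$ the vectors $e_t=(e_{1t},\dots,e_{Nt})'$ are serially independent, and $E(e_t|\mathcal F)=0$. (ii) With $\rho(t,s)=N^{-1/2}\sum_i e_{it}e_{is}$, $E[(1+\|F_t\|^4)(\rho(s,t)^2+1)]$ is bounded uniformly in $N,T$ and $s\ne t$. (iii) With $S_t=N^{-1}\sum_i e_{it}^2$, both for $I=\{1,\dots,T\}$ and for $I=T_1,\dots,T_4$, $\frac{\sqrt N}{|I|}\sum_{t\in I}\widetilde F^{I}_tS_t\to^p0$ and $\frac1{|I|}\sum_{t\in I}\widetilde F^{I}_t\widetilde F^{I\prime}_tS_t\to^p\Sigma_{SF^2}$; if $k_v<k_F$, $\Sigma_{SF^2}$ is positive definite. (iv) With $W_t=N^{-1/2}\sum_i\gamma_ie_{it}$, $E[(1+\|F_t\|^2)\|W_t\|^2]$ is bounded uniformly in $N,T,t$. Estimator. Let $\widehat\beta_i^{(j)}=\big(\sum_{t\in T_j}\widetilde F^{T_j}_t\widetilde F^{T_j\prime}_t\big)^{-1}\sum_{t\in T_j}\widetilde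 F^{T_j}_tr_{it}$, and let $A_1,\dots,A_4$ be fixed $k_v\times k_F$ matrices of rank $k_v$ (so $k_v\le k_F$). For $j=1,\dots,4$, with indices taken cyclically modulo 4, let $\widehat\lambda^{(j)}$ be the two-stage least squares coefficient on $\widehat\beta^{(j)}_i$ in the regression of $\bar r_i=T^{-1}\sum_tr_{it}$ ($i\le N$) on $\big(\widehat\beta_i^{(j)},A_j(\widehat\beta_i^{(j)}-\widehat\beta_i^{(j+1)})\big)$ with instruments $\big(\widehat\beta_i^{(j+2)},\widehat\beta_i^{(j+2)}-\widehat\beta_i^{(j+3)}\big)$. Put $\widehat\lambda_{4S}=\frac14\sum_{j=1}^4\widehat\lambda^{(j)}$ and $\widetilde\lambda=\lambda+\frac1T\sum_{t}(F_t-EF_t)$; the subscripts 1 and 2 denote the first $k_1$ and the last $k_2$ coordinates, and $\Omega_{F,11}$ the upper left $k_1\times k_1$ block of $\Omega_F$. Theorem 2. Under these assumptions, as $N,T\to\infty$, $$\sqrt T(\widehat\lambda_{4S,1}-\lambda_1)=\sqrt T(\widetilde\lambda_1-\lambda_1)+O_p(1/\sqrt N),$$ both $\sqrt T(\widetilde\lambda_1-\lambda_1)$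 and $\sqrt T(\widehat\lambda_{4S,1}-\lambda_1)$ converge weakly to $N(0,\Omega_{F,11})$, and $$\sqrt{\min\{N,T\}}\,(\widehat\lambda_{4S,2}-\lambda_2)=O_p(1),$$ so that $\widehat\lambda_{4S,2}\to^p\lambda_2$. -/

import Mathlib

open MeasureTheory ProbabilityTheory Filter Topology

namespace FourSplit

noncomputable section

/-! Asymptotics along arrays of probability spaces indexed by `p = (N, T)`, both tending to
infinity with no restriction on the relative rate: the filter `atTop` on `ℕ × ℕ`. -/

/-- `X = O_p(a)` as `N, T → ∞`. -/
def IsBigOp {Ω : ℕ × ℕ → Type*} [∀ p, MeasurableSpace (Ω p)] (P : ∀ p, Measure (Ω p))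
    {E : Type*} [NormedAddCommGroup E] (X : ∀ p, Ω p → E) (a : ℕ × ℕ → ℝ) : Prop :=
  ∀ ε : ℝ, 0 < ε → ∃ M : ℝ, ∀ᶠ p in atTop,
    P p {ω | M * a p < ‖X p ω‖} ≤ ENNReal.ofReal ε

/-- Convergence in probability to a constant, `X →^p c` as `N, T → ∞`. -/
def TendstoInProb {Ω : ℕ × ℕ → Type*} [∀ p, MeasurableSpace (Ω p)] (P : ∀ p, Measure (Ω p))
    {E : Type*} [NormedAddCommGroup E] (X : ∀ p, Ω p → E) (c : E) : Prop :=
  ∀ ε : ℝ, 0 < ε → Tendsto (fun p => P p {ω | ε ≤ ‖X p ω - c‖}) atTop (𝓝 0)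

/-- Coordinates of the observed factors: `k₁` strong ones (`Sum.inl`), `k₂` weak ones
(`Sum.inr`). -/
abbrev FIdx (k₁ k₂ : ℕ) : Type := Fin k₁ ⊕ Fin k₂

/-- Coordinates of the stacked loadings `γ_i`. -/
abbrev GIdx (k₁ k₂ kv : ℕ) : Type := FIdx k₁ k₂ ⊕ Fin kv

/-- The primitives of the data-generating process at one sample size: observed factors `F t`,
missing factors `v t`, idiosyncratic errors `e i t` (random), and loadings `β i`, `μ i`
(non-random). Only the assets `i < N` and the periods `t < T` are ever used. -/
structure Sample (k₁ k₂ kv : ℕ) (Ω : Type*) where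
  F : ℕ → Ω → EuclideanSpace ℝ (FIdx k₁ k₂)
  v : ℕ → Ω → EuclideanSpace ℝ (Fin kv)
  e : ℕ → ℕ → Ω → ℝ
  β : ℕ → EuclideanSpace ℝ (FIdx k₁ k₂)
  μ : ℕ → EuclideanSpace ℝ (Fin kv)

namespace Sample

variable {k₁ k₂ kv : ℕ} {Ω : Type*}

/-- The excess return
`r_it = λ'β_i + (F_t - E F_t)'β_i + v_t'μ_i + e_it`. -/
def ret [MeasurableSpace Ω] (S : Sample k₁ k₂ kv Ω) (P : Measure Ω)
    (lam : EuclideanSpace ℝ (FIdx k₁ k₂)) (i t : ℕ) (ω : Ω) : ℝ :=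
  inner ℝ lam (S.β i) + inner ℝ (S.F t ω - ∫ ω', S.F t ω' ∂P) (S.β i)
    + inner ℝ (S.v t ω) (S.μ i) + S.e i t ω

/-- The sigma-algebra generated by `F_t`, `v_t`, `t = 1, …, T`. -/
@[reducible] def factorSigma (S : Sample k₁ k₂ kv Ω) (T : ℕ) : MeasurableSpace Ω :=
  ⨆ t ∈ Finset.range T,
    (MeasurableSpace.comap (S.F t) inferInstance ⊔ MeasurableSpace.comap (S.v t) inferInstance)

/-- The cross-sectional error vector `e_t = (e_1t, …, e_Nt)'`. -/
def errVec (S : Sample k₁ k₂ kv Ω) (N t : ℕ) (ω : Ω) : Fin N → ℝ := fun i => S.e i t ω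

/-- `γ_i' = (β_1i', √T β_2i', μ_i')`. -/
def gam (S : Sample k₁ k₂ kv Ω) (T i : ℕ) : EuclideanSpace ℝ (GIdx k₁ k₂ kv) :=
  WithLp.toLp 2 (Sum.elim
    (Sum.elim (fun a => S.β i (Sum.inl a)) (fun b => √(T : ℝ) * S.β i (Sum.inr b)))
    (fun c => S.μ i c))

/-- Factors demeaned over the index set `I`: `F_t - |I|⁻¹ ∑_{s ∈ I} F_s`. -/
def Fdem (S : Sample k₁ k₂ kv Ω) (I : Finset ℕ) (t : ℕ) (ω : Ω) :
    EuclideanSpace ℝ (FIdx k₁ k₂) :=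
  S.F t ω - (I.card : ℝ)⁻¹ • ∑ s ∈ I, S.F s ω

/-- `∑_{t ∈ I} F̃_t F̃_t'`, with the demeaning over `I`. -/
def gramF (S : Sample k₁ k₂ kv Ω) (I : Finset ℕ) (ω : Ω) :
    Matrix (FIdx k₁ k₂) (FIdx k₁ k₂) ℝ :=
  Matrix.of fun a b => ∑ t ∈ I, S.Fdem I t ω a * S.Fdem I t ω b

/-- `|I|^{-1/2} ∑_{t ∈ I} Σ_F⁻¹ F̃_t v_t'`, as a vector of its entries. -/
def eta (S : Sample k₁ k₂ kv Ω) (SigF : Matrix (FIdx k₁ k₂) (FIdx k₁ k₂) ℝ) (I : Finset ℕ)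
    (ω : Ω) : EuclideanSpace ℝ (FIdx k₁ k₂ × Fin kv) :=
  WithLp.toLp 2 fun ab =>
    (√(I.card : ℝ))⁻¹ * ∑ t ∈ I, (SigF⁻¹.mulVec (fun a => S.Fdem I t ω a)) ab.1 * S.v t ω ab.2

/-- `T^{-1/2} ∑_{t ≤ T} v_t`. -/
def etaV (S : Sample k₁ k₂ kv Ω) (T : ℕ) (ω : Ω) : EuclideanSpace ℝ (Fin kv) :=
  (√(T : ℝ))⁻¹ • ∑ t ∈ Finset.range T, S.v t ω

/-- `T^{-1/2} ∑_{t ≤ T} (F_t - E F_t)`. -/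
def normF [MeasurableSpace Ω] (S : Sample k₁ k₂ kv Ω) (P : Measure Ω) (T : ℕ) (ω : Ω) :
    EuclideanSpace ℝ (FIdx k₁ k₂) :=
  (√(T : ℝ))⁻¹ • ∑ t ∈ Finset.range T, (S.F t ω - ∫ ω', S.F t ω' ∂P)

/-- The ex-post risk premia `λ̃ = λ + T⁻¹ ∑_t F_t - E F_t`. -/
def lamTilde [MeasurableSpace Ω] (S : Sample k₁ k₂ kv Ω) (P : Measure Ω)
    (lam : EuclideanSpace ℝ (FIdx k₁ k₂)) (T : ℕ) (ω : Ω) : EuclideanSpace ℝ (FIdx k₁ k₂) :=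
  lam + (T : ℝ)⁻¹ • ∑ t ∈ Finset.range T, (S.F t ω - ∫ ω', S.F t ω' ∂P)

/-- `ρ(t, s) = N^{-1/2} ∑_i e_it e_is`. -/
def rho (S : Sample k₁ k₂ kv Ω) (N t s : ℕ) (ω : Ω) : ℝ :=
  (√(N : ℝ))⁻¹ * ∑ i ∈ Finset.range N, S.e i t ω * S.e i s ω

/-- `S_t = N⁻¹ ∑_i e_it²`. -/
def avgSq (S : Sample k₁ k₂ kv Ω) (N t : ℕ) (ω : Ω) : ℝ :=
  (N : ℝ)⁻¹ * ∑ i ∈ Finset.range N, S.e i t ω ^ 2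

/-- `W_t = N^{-1/2} ∑_i γ_i e_it`. -/
def wAvg (S : Sample k₁ k₂ kv Ω) (N T t : ℕ) (ω : Ω) : EuclideanSpace ℝ (GIdx k₁ k₂ kv) :=
  (√(N : ℝ))⁻¹ • ∑ i ∈ Finset.range N, S.e i t ω • S.gam T i

/-! ### The estimator -/

/-- First-pass (time-series) estimate of the exposures of asset `i` on the periods in `I`. -/
def betaHat [MeasurableSpace Ω] (S : Sample k₁ k₂ kv Ω) (P : Measure Ω)
    (lam : EuclideanSpace ℝ (FIdx k₁ k₂)) (I : Finset ℕ) (i : ℕ) (ω : Ω) : FIdx k₁ k₂ → ℝ :=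
  (S.gramF I ω)⁻¹.mulVec fun a => ∑ t ∈ I, S.Fdem I t ω a * S.ret P lam i t ω

end Sample

/-- Two-stage least squares coefficient of `Y` on regressors `X` with instruments `Z`:
`(X'P_Z X)⁻¹ X'P_Z Y`, `P_Z = Z(Z'Z)⁻¹Z'`. -/
def tsls {n m l : Type*} [Fintype n] [Fintype m] [Fintype l] [DecidableEq m] [DecidableEq l]
    (X : Matrix n m ℝ) (Z : Matrix n l ℝ) (Y : n → ℝ) : m → ℝ :=
  (X.transpose * (Z * (Z.transpose * Z)⁻¹ * Z.transpose) * X)⁻¹.mulVec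
    ((X.transpose * (Z * (Z.transpose * Z)⁻¹ * Z.transpose)).mulVec Y)

namespace Sample

variable {k₁ k₂ kv : ℕ} {Ω : Type*} [MeasurableSpace Ω]

/-- Regressors of the `j`-th IV regression: `x_i = (β̂_i^(j), A_j(β̂_i^(j) - β̂_i^(j+1)))`, the
indices of the four subsamples `I 0, …, I 3` being cyclic. -/
def regressors (S : Sample k₁ k₂ kv Ω) (P : Measure Ω) (lam : EuclideanSpace ℝ (FIdx k₁ k₂))
    (A : Fin 4 → Matrix (Fin kv) (FIdx k₁ k₂) ℝ) (I : Fin 4 → Finset ℕ) (N : ℕ) (j : Fin 4)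
    (ω : Ω) : Matrix (Fin N) (GIdx k₁ k₂ kv) ℝ :=
  Matrix.of fun i => Sum.elim (S.betaHat P lam (I j) i ω)
    ((A j).mulVec (S.betaHat P lam (I j) i ω - S.betaHat P lam (I (j + 1)) i ω))

/-- Instruments of the `j`-th IV regression:
`z_i = (β̂_i^(j+2), β̂_i^(j+2) - β̂_i^(j+3))`. -/
def instruments (S : Sample k₁ k₂ kv Ω) (P : Measure Ω) (lam : EuclideanSpace ℝ (FIdx k₁ k₂))
    (I : Fin 4 → Finset ℕ) (N : ℕ) (j : Fin 4)
    (ω : Ω) : Matrix (Fin N) (FIdx k₁ k₂ ⊕ FIdx k₁ k₂) ℝ :=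
  Matrix.of fun i => Sum.elim (S.betaHat P lam (I (j + 2)) i ω)
    (S.betaHat P lam (I (j + 2)) i ω - S.betaHat P lam (I (j + 3)) i ω)

/-- Time-averaged returns `r̄_i` over the whole sample. -/
def avgRet (S : Sample k₁ k₂ kv Ω) (P : Measure Ω) (lam : EuclideanSpace ℝ (FIdx k₁ k₂))
    (N T : ℕ) (ω : Ω) : Fin N → ℝ :=
  fun i => (T : ℝ)⁻¹ * ∑ t ∈ Finset.range T, S.ret P lam i t ω

/-- `λ̂^(j)`: the coefficient on `β̂_i^(j)` in the `j`-th IV regression. -/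
def lamHat (S : Sample k₁ k₂ kv Ω) (P : Measure Ω) (lam : EuclideanSpace ℝ (FIdx k₁ k₂))
    (A : Fin 4 → Matrix (Fin kv) (FIdx k₁ k₂) ℝ) (I : Fin 4 → Finset ℕ) (N T : ℕ) (j : Fin 4)
    (ω : Ω) : EuclideanSpace ℝ (FIdx k₁ k₂) :=
  WithLp.toLp 2 fun a =>
    tsls (S.regressors P lam A I N j ω) (S.instruments P lam I N j ω)
      (S.avgRet P lam N T ω) (Sum.inl a)

/-- The four-split estimator `λ̂_4S = (1/4) ∑_j λ̂^(j)`. -/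
def lam4S (S : Sample k₁ k₂ kv Ω) (P : Measure Ω) (lam : EuclideanSpace ℝ (FIdx k₁ k₂))
    (A : Fin 4 → Matrix (Fin kv) (FIdx k₁ k₂) ℝ) (I : Fin 4 → Finset ℕ) (N T : ℕ) (ω : Ω) :
    EuclideanSpace ℝ (FIdx k₁ k₂) :=
  (4 : ℝ)⁻¹ • ∑ j : Fin 4, S.lamHat P lam A I N T j ω

end Sample

/-- Sub-vector of the strong coordinates. -/
def strong {k₁ k₂ : ℕ} (x : EuclideanSpace ℝ (FIdx k₁ k₂)) : EuclideanSpace ℝ (Fin k₁) :=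
  WithLp.toLp 2 fun a => x (Sum.inl a)

/-- Sub-vector of the weak coordinates. -/
def weak {k₁ k₂ : ℕ} (x : EuclideanSpace ℝ (FIdx k₁ k₂)) : EuclideanSpace ℝ (Fin k₂) :=
  WithLp.toLp 2 fun b => x (Sum.inr b)

/-- For every `T`, four disjoint sets of `⌊T/4⌋` periods each, among the periods `0, …, T - 1`. -/
structure IsFourSplit (I : ℕ → Fin 4 → Finset ℕ) : Prop where
  subset : ∀ T j, I T j ⊆ Finset.range T
  card : ∀ T j, (I T j).card = T / 4
  disjoint : ∀ T, Pairwise fun j j' => Disjoint (I T j) (I T j')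

/-! ### The assumptions -/

section Assumptions

variable {k₁ k₂ kv : ℕ} {Ω : ℕ × ℕ → Type*} [∀ p, MeasurableSpace (Ω p)]
  (P : ∀ p, Measure (Ω p)) [∀ p, IsProbabilityMeasure (P p)] (S : ∀ p, Sample k₁ k₂ kv (Ω p))

/-- The unobserved factors have mean zero and are uncorrelated with the observed factors; the
idiosyncratic errors have mean zero and are uncorrelated with both. -/
structure PricingModel : Prop where
  measurable_F : ∀ p, ∀ t < p.2, Measurable ((S p).F t)
  measurable_v : ∀ p, ∀ t < p.2, Measurable ((S p).v t)
  measurable_e : ∀ p, ∀ i < p.1, ∀ t < p.2, Measurable ((S p).e i t)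
  memLp_F : ∀ p, ∀ t < p.2, MemLp ((S p).F t) 2 (P p)
  memLp_v : ∀ p, ∀ t < p.2, MemLp ((S p).v t) 2 (P p)
  memLp_e : ∀ p, ∀ i < p.1, ∀ t < p.2, MemLp ((S p).e i t) 2 (P p)
  mean_v : ∀ p, ∀ t < p.2, ∫ ω, (S p).v t ω ∂(P p) = 0
  uncorr_vF : ∀ p, ∀ t < p.2, ∀ a b,
    covariance (fun ω => (S p).v t ω b) (fun ω => (S p).F t ω a) (P p) = 0
  mean_e : ∀ p, ∀ i < p.1, ∀ t < p.2, ∫ ω, (S p).e i t ω ∂(P p) = 0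
  uncorr_eF : ∀ p, ∀ i < p.1, ∀ t < p.2, ∀ a,
    covariance ((S p).e i t) (fun ω => (S p).F t ω a) (P p) = 0
  uncorr_ev : ∀ p, ∀ i < p.1, ∀ t < p.2, ∀ b,
    covariance ((S p).e i t) (fun ω => (S p).v t ω b) (P p) = 0

/-- The assumptions on the factors over the whole sample. The joint limit of the three normalized sums is a probability measure
`ν` of which only the three marginals are prescribed. -/
structure Factors (SigF OmF : Matrix (FIdx k₁ k₂) (FIdx k₁ k₂) ℝ)
    (OmvF : Matrix (FIdx k₁ k₂ × Fin kv) (FIdx k₁ k₂ × Fin kv) ℝ) : Prop where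
  stationary : ∀ p h m, h + m ≤ p.2 →
    IdentDistrib (fun ω (s : Fin m) => (S p).F (h + s) ω) (fun ω (s : Fin m) => (S p).F s ω)
      (P p) (P p)
  fourth_moment : ∀ p, ∀ t < p.2, MemLp ((S p).F t) 4 (P p)
  cov_F : ∀ p, ∀ t < p.2, ∀ a b,
    covariance (fun ω => (S p).F t ω a) (fun ω => (S p).F t ω b) (P p) = SigF a b
  posDef_SigF : SigF.PosDef
  posSemidef_OmF : OmF.PosSemidef
  posSemidef_OmvF : OmvF.PosSemidef
  clt : ∃ ν : ProbabilityMeasure (EuclideanSpace ℝ (FIdx k₁ k₂) ×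
      EuclideanSpace ℝ (FIdx k₁ k₂ × Fin kv) × EuclideanSpace ℝ (Fin kv)),
    ν.toMeasure.map (fun x => x.1) = multivariateGaussian 0 OmF ∧
    ν.toMeasure.map (fun x => x.2.1) = multivariateGaussian 0 OmvF ∧
    ν.toMeasure.map (fun x => x.2.2) = multivariateGaussian 0 1 ∧
    TendstoInDistribution
      (fun p ω => ((S p).normF (P p) p.2 ω, (S p).eta SigF (Finset.range p.2) ω,
        (S p).etaV p.2 ω)) atTop id P ν.toMeasure

/-- The assumptions on the factors over the four subsamples: on each of them the sample
covariance matrix of the factors is consistent and `η_{j,T} ⇒ η_j`, where `η_1, …, η_4` are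
independent copies of `η`, whose variance is not degenerate. -/
structure FactorsOnSplit (SigF : Matrix (FIdx k₁ k₂) (FIdx k₁ k₂) ℝ)
    (OmvF : Matrix (FIdx k₁ k₂ × Fin kv) (FIdx k₁ k₂ × Fin kv) ℝ)
    (I : ℕ → Fin 4 → Finset ℕ) : Prop where
  posDef : OmvF.PosDef
  lln : ∀ j a b, TendstoInProb P
    (fun p ω => ((I p.2 j).card : ℝ)⁻¹ * (S p).gramF (I p.2 j) ω a b) (SigF a b)
  clt : TendstoInDistribution (fun p ω (j : Fin 4) => (S p).eta SigF (I p.2 j) ω) atTop id P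
    (Measure.pi fun _ : Fin 4 => multivariateGaussian 0 OmvF)

/-- The assumptions on the loadings. -/
structure Loadings (Γ : Matrix (GIdx k₁ k₂ kv) (GIdx k₁ k₂ kv) ℝ) : Prop where
  posDef : Γ.PosDef
  tendsto : ∀ a b, Tendsto
    (fun p : ℕ × ℕ => (p.1 : ℝ)⁻¹ * ∑ i ∈ Finset.range p.1,
      (S p).gam p.2 i a * (S p).gam p.2 i b) atTop (𝓝 (Γ a b))
  bounded : ∃ C : ℝ, ∀ p : ℕ × ℕ,
    (p.1 : ℝ)⁻¹ * ∑ i ∈ Finset.range p.1, ‖(S p).gam p.2 i‖ ^ 4 ≤ C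

/-- The limits of the averages of `F̃_t S_t` and `F̃_t F̃_t' S_t` over the periods in `I T`. -/
structure ErrorAverages (SigSF : Matrix (FIdx k₁ k₂) (FIdx k₁ k₂) ℝ) (I : ℕ → Finset ℕ) : Prop where
  first : TendstoInProb P
    (fun p ω => (√(p.1 : ℝ) / ((I p.2).card : ℝ)) •
      ∑ t ∈ I p.2, (S p).avgSq p.1 t ω • (S p).Fdem (I p.2) t ω) 0
  second : ∀ a b, TendstoInProb P
    (fun p ω => ((I p.2).card : ℝ)⁻¹ *
      ∑ t ∈ I p.2, (S p).Fdem (I p.2) t ω a * (S p).Fdem (I p.2) t ω b * (S p).avgSq p.1 t ω)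
    (SigSF a b)

/-- The assumptions on the errors over the whole sample. -/
structure Errors (SigSF : Matrix (FIdx k₁ k₂) (FIdx k₁ k₂) ℝ) : Prop where
  /-- Conditional serial independence of the vectors `e_t` given `F_1, …, F_T` and
  `v_1, …, v_T`. -/
  condIndep : ∀ p, ∀ B : ℕ → Set (Fin p.1 → ℝ), (∀ t, MeasurableSet (B t)) →
    (P p)⟦⋂ t ∈ Finset.range p.2, (S p).errVec p.1 t ⁻¹' B t | (S p).factorSigma p.2⟧
      =ᵐ[P p] fun ω => ∏ t ∈ Finset.range p.2,
        ((P p)⟦(S p).errVec p.1 t ⁻¹' B t | (S p).factorSigma p.2⟧) ω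
  /-- Conditional mean zero. -/
  condMean : ∀ p, ∀ i < p.1, ∀ t < p.2, (P p)[(S p).e i t | (S p).factorSigma p.2] =ᵐ[P p] 0
  rho_bound : ∃ C : ℝ, ∀ p, ∀ t < p.2, ∀ s < p.2, s ≠ t →
    Integrable (fun ω => (1 + ‖(S p).F t ω‖ ^ 4) * ((S p).rho p.1 s t ω ^ 2 + 1)) (P p) ∧
    ∫ ω, (1 + ‖(S p).F t ω‖ ^ 4) * ((S p).rho p.1 s t ω ^ 2 + 1) ∂(P p) ≤ C
  averages : ErrorAverages P S SigSF Finset.range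
  wAvg_bound : ∃ C : ℝ, ∀ p, ∀ t < p.2,
    Integrable (fun ω => (1 + ‖(S p).F t ω‖ ^ 2) * ‖(S p).wAvg p.1 p.2 t ω‖ ^ 2) (P p) ∧
    ∫ ω, (1 + ‖(S p).F t ω‖ ^ 2) * ‖(S p).wAvg p.1 p.2 t ω‖ ^ 2 ∂(P p) ≤ C

/-- The assumptions on the errors over the four subsamples: the limits in `ErrorAverages` also hold
for averages over each of them, and, when there are fewer missing than observed factors (so that
the IV regressions are over-identified), the limit `Σ_{SF²}` is not degenerate. -/
structure ErrorsOnSplit (SigSF : Matrix (FIdx k₁ k₂) (FIdx k₁ k₂) ℝ)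
    (I : ℕ → Fin 4 → Finset ℕ) : Prop where
  averages : ∀ j, ErrorAverages P S SigSF fun T => I T j
  posDef : kv < k₁ + k₂ → SigSF.PosDef

end Assumptions

end

end FourSplit

/-!
The `j`-th second-pass regression is analysed after multiplication of the weak coordinates of
regressors and instruments, and of their differences, by `√T`. The rescaled regressors and
instruments are then linear, with matrices `L` and `L'` given by `stack`, in the vector `y_i =
(γ_i, ξ_i^(1), …, ξ_i^(4))` that collects the loadings of an asset and the normalized
idiosyncratic errors `ξ_i^(j) = (√T / |T_j|) ∑_{t ∈ T_j} F̃_t e_it` of its four first passes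
(`Sample.rescaled_row`). The first-pass error `√T (β̂_i^(j) - β_i)` has a part `√(T / |T_j|) H_j
μ_i` due to the missing factors, where `H_j` is close to `η_j`, and a part `K_j ξ_i^(j)`, where
`K_j` is close to `Σ_F⁻¹`. The first part does not average out over assets, but the differences
`A_j (β̂_i^(j) - β̂_i^(j+1))` span `μ_i` up to idiosyncratic errors, so that they act as proxies:
`√T r̄_i` equals a linear function of the regressors, with coefficients `λ̃` on the first group,
plus an error that involves only `√T ē_i`, `ξ_i^(j)` and `ξ_i^(j+1)` (`vecMul_stack_nuisance`,
`Sample.lamHat_error`).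

The estimation error is therefore `gain C W` applied to cross moments of instruments and
structural error, where `C = L M L'ᵀ`, `W = L' M L'ᵀ` and `M` is the matrix of cross-sectional
second moments of `y_i`. Since the instruments involve `γ_i`, `ξ_i^(j+2)` and `ξ_i^(j+3)` only,
only the entries of `M` that pair `γ_i` with some `ξ_i^(j)`, or two distinct subsamples, enter.
Conditional serial independence of the errors makes these entries `O_p(1/√N)` by second moment
computations (`isBigOp_moment_inl_inr`, `isBigOp_moment_inr_inr`, `isBigOp_errMoment`), because
products of errors from different periods have conditional mean zero
(`condExp_otherSigma_eq_zero`).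

It remains to see that the gain is `O_p(1)`. It is a function of parameters of which the `η_j`
converge in distribution and the others in probability, and it is continuous on the open set where
the determinants involved do not vanish (`Params.regularSet`). The limit lies in this set almost
surely (`Params.ae_mem_regularSet`): a Gaussian vector with nondegenerate covariance matrix does
not charge the zero set of the polynomial `det (A_j (η_j - η_j'))` (`ae_det_mul_sub_ne_zero`), and
outside of it positive definiteness of `Γ`, and of `Σ_{SF²}` when `k_v < k_F`, gives full rank of
the limits of `C` and `W` (`det_stack_ne_zero`, `det_cross_stack_ne_zero`). Tightness of the limit
law then gives the bound (`isBigOp_one_of_tendstoInDistribution`). Hence `λ̂^(j) - λ̃` is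
`O_p(1/√(NT))` in the strong and `O_p(1/√N)` in the weak coordinates
(`isBigOp_lamHat_sub_lamTilde`), and the weak limits follow from the central limit theorem for
`λ̃` and Slutsky's theorem.
-/

namespace FourSplit

/-! ### Calculus of `O_p` and of events of probability tending to one -/

section Calculus

variable {Ω : ℕ × ℕ → Type*} [∀ p, MeasurableSpace (Ω p)] {P : ∀ p, Measure (Ω p)}

/-- The event `A` has probability tending to one, phrased through its complement. -/
def Whp (P : ∀ p, Measure (Ω p)) (A : ∀ p, Ω p → Prop) : Prop :=
  Tendsto (fun p => P p {ω | ¬ A p ω}) atTop (𝓝 0)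

theorem Whp.mono {A B : ∀ p, Ω p → Prop} (h : Whp P A) (hAB : ∀ᶠ p in atTop, ∀ ω, A p ω → B p ω) :
    Whp P B := by
  refine tendsto_of_tendsto_of_tendsto_of_le_of_le' tendsto_const_nhds h
    (Eventually.of_forall fun _ => zero_le) ?_
  filter_upwards [hAB] with p hp
  exact measure_mono fun ω hω hA => hω (hp ω hA)

theorem Whp.and {A B : ∀ p, Ω p → Prop} (hA : Whp P A) (hB : Whp P B) :
    Whp P fun p ω => A p ω ∧ B p ω := by
  have h := hA.add hB
  rw [add_zero] at h
  refine tendsto_of_tendsto_of_tendsto_of_le_of_le tendsto_const_nhds h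
    (fun _ => zero_le) fun p => ?_
  refine (measure_mono ?_).trans (measure_union_le _ _)
  intro ω hω
  by_cases h1 : A p ω
  · exact Or.inr fun h2 => hω ⟨h1, h2⟩
  · exact Or.inl h1

theorem whp_of_eventually {A : ∀ p, Ω p → Prop} (h : ∀ᶠ p in atTop, ∀ ω, A p ω) : Whp P A := by
  refine tendsto_const_nhds.congr' ?_
  filter_upwards [h] with p hp
  have : {ω | ¬ A p ω} = ∅ := by ext ω; simp [hp ω]
  rw [this, measure_empty]

theorem whp_forall_finset {ι : Type*} (s : Finset ι) {A : ι → ∀ p, Ω p → Prop}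
    (h : ∀ i ∈ s, Whp P (A i)) : Whp P fun p ω => ∀ i ∈ s, A i p ω := by
  classical
  induction s using Finset.induction_on with
  | empty => exact whp_of_eventually (Eventually.of_forall fun _ _ _ hi => absurd hi (by simp))
  | insert a s ha ih =>
    refine ((h a (by simp)).and (ih fun i hi => h i (by simp [hi]))).mono
      (Eventually.of_forall fun p ω hω i hi => ?_)
    rcases Finset.mem_insert.1 hi with rfl | hi
    · exact hω.1
    · exact hω.2 i hi

theorem whp_forall {ι : Type*} [Finite ι] {A : ι → ∀ p, Ω p → Prop} (h : ∀ i, Whp P (A i)) :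
    Whp P fun p ω => ∀ i, A i p ω := by
  have := Fintype.ofFinite ι
  exact (whp_forall_finset Finset.univ fun i _ => h i).mono
    (Eventually.of_forall fun p ω hω i => hω i (Finset.mem_univ i))

theorem whp_iff {A : ∀ p, Ω p → Prop} :
    Whp P A ↔ ∀ ε : ℝ, 0 < ε → ∀ᶠ p in atTop, P p {ω | ¬ A p ω} ≤ ENNReal.ofReal ε := by
  rw [Whp, ENNReal.tendsto_nhds_zero]
  constructor
  · intro h ε hε
    exact h _ (by simpa using hε)
  · intro h ε hε
    by_cases htop : ε = ⊤
    · exact Eventually.of_forall fun p => htop ▸ le_top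
    · have := h ε.toReal (ENNReal.toReal_pos hε.ne' htop)
      rwa [ENNReal.ofReal_toReal htop] at this

section Norm

variable {E F : Type*} [NormedAddCommGroup E] [NormedAddCommGroup F]

theorem IsBigOp.of_whp {X : ∀ p, Ω p → E} {Y : ∀ p, Ω p → F} {a : ℕ × ℕ → ℝ}
    (hX : IsBigOp P X a) (h : Whp P fun p ω => ‖Y p ω‖ ≤ ‖X p ω‖) : IsBigOp P Y a := by
  intro ε hε
  obtain ⟨M, hM⟩ := hX (ε / 2) (by positivity)
  refine ⟨M, ?_⟩
  filter_upwards [hM, whp_iff.1 h (ε / 2) (by positivity)] with p h1 h2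
  calc P p {ω | M * a p < ‖Y p ω‖}
      ≤ P p ({ω | M * a p < ‖X p ω‖} ∪ {ω | ¬ ‖Y p ω‖ ≤ ‖X p ω‖}) := by
        refine measure_mono fun ω hω => ?_
        by_cases hle : ‖Y p ω‖ ≤ ‖X p ω‖
        · exact Or.inl (lt_of_lt_of_le hω hle)
        · exact Or.inr hle
    _ ≤ ENNReal.ofReal (ε / 2) + ENNReal.ofReal (ε / 2) :=
        (measure_union_le _ _).trans (add_le_add h1 h2)
    _ = ENNReal.ofReal ε := by
        rw [← ENNReal.ofReal_add (by positivity) (by positivity), add_halves]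

theorem IsBigOp.of_le {X : ∀ p, Ω p → E} {Y : ∀ p, Ω p → F} {a : ℕ × ℕ → ℝ}
    (hX : IsBigOp P X a) (h : ∀ᶠ p in atTop, ∀ ω, ‖Y p ω‖ ≤ ‖X p ω‖) : IsBigOp P Y a :=
  hX.of_whp (whp_of_eventually h)

theorem isBigOp_zero {a : ℕ × ℕ → ℝ} :
    IsBigOp P (fun p (_ : Ω p) => (0 : E)) a := by
  intro ε hε
  refine ⟨0, Eventually.of_forall fun p => ?_⟩
  simp

theorem IsBigOp.add {X Y : ∀ p, Ω p → E} {a : ℕ × ℕ → ℝ} (hX : IsBigOp P X a)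
    (hY : IsBigOp P Y a) : IsBigOp P (fun p ω => X p ω + Y p ω) a := by
  intro ε hε
  obtain ⟨M, hM⟩ := hX (ε / 2) (by positivity)
  obtain ⟨M', hM'⟩ := hY (ε / 2) (by positivity)
  refine ⟨M + M', ?_⟩
  filter_upwards [hM, hM'] with p h1 h2
  calc P p {ω | (M + M') * a p < ‖X p ω + Y p ω‖}
      ≤ P p ({ω | M * a p < ‖X p ω‖} ∪ {ω | M' * a p < ‖Y p ω‖}) := by
        refine measure_mono fun ω hω => ?_
        by_contra hcon
        simp only [Set.mem_union, Set.mem_ofPred_eq, not_or, not_lt] at hcon hω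
        have := norm_add_le (X p ω) (Y p ω)
        linarith [hcon.1, hcon.2]
    _ ≤ ENNReal.ofReal (ε / 2) + ENNReal.ofReal (ε / 2) :=
        (measure_union_le _ _).trans (add_le_add h1 h2)
    _ = ENNReal.ofReal ε := by
        rw [← ENNReal.ofReal_add (by positivity) (by positivity), add_halves]

theorem IsBigOp.neg {X : ∀ p, Ω p → E} {a : ℕ × ℕ → ℝ} (hX : IsBigOp P X a) :
    IsBigOp P (fun p ω => - X p ω) a :=
  hX.of_le (Eventually.of_forall fun p ω => by rw [norm_neg])

theorem IsBigOp.sub {X Y : ∀ p, Ω p → E} {a : ℕ × ℕ → ℝ} (hX : IsBigOp P X a)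
    (hY : IsBigOp P Y a) : IsBigOp P (fun p ω => X p ω - Y p ω) a := by
  simpa only [sub_eq_add_neg] using hX.add hY.neg

theorem IsBigOp.sum {ι : Type*} (s : Finset ι) {X : ι → ∀ p, Ω p → E} {a : ℕ × ℕ → ℝ}
    (hX : ∀ i ∈ s, IsBigOp P (X i) a) :
    IsBigOp P (fun p ω => ∑ i ∈ s, X i p ω) a := by
  classical
  induction s using Finset.induction_on with
  | empty => simpa using isBigOp_zero
  | insert i s hi ih =>
    simp only [Finset.sum_insert hi]
    exact (hX i (by simp)).add (ih fun j hj => hX j (by simp [hj]))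

theorem IsBigOp.mul {X Y : ∀ p, Ω p → ℝ} {a b : ℕ × ℕ → ℝ} (hX : IsBigOp P X a)
    (hY : IsBigOp P Y b) : IsBigOp P (fun p ω => X p ω * Y p ω) (fun p => a p * b p) := by
  intro ε hε
  obtain ⟨M, hM⟩ := hX (ε / 2) (by positivity)
  obtain ⟨M', hM'⟩ := hY (ε / 2) (by positivity)
  refine ⟨M * M', ?_⟩
  filter_upwards [hM, hM'] with p h1 h2
  calc P p {ω | (M * M') * (a p * b p) < ‖X p ω * Y p ω‖}
      ≤ P p ({ω | M * a p < ‖X p ω‖} ∪ {ω | M' * b p < ‖Y p ω‖}) := by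
        refine measure_mono fun ω hω => ?_
        by_contra hcon
        simp only [Set.mem_union, Set.mem_ofPred_eq, not_or, not_lt, norm_mul] at hcon hω
        have := mul_le_mul hcon.1 hcon.2 (norm_nonneg _) ((norm_nonneg _).trans hcon.1)
        nlinarith
    _ ≤ ENNReal.ofReal (ε / 2) + ENNReal.ofReal (ε / 2) :=
        (measure_union_le _ _).trans (add_le_add h1 h2)
    _ = ENNReal.ofReal ε := by
        rw [← ENNReal.ofReal_add (by positivity) (by positivity), add_halves]

theorem IsBigOp.mul_one {X Y : ∀ p, Ω p → ℝ} {a : ℕ × ℕ → ℝ} (hX : IsBigOp P X a)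
    (hY : IsBigOp P Y fun _ => 1) : IsBigOp P (fun p ω => X p ω * Y p ω) a := by
  simpa using hX.mul hY

theorem IsBigOp.one_mul {X Y : ∀ p, Ω p → ℝ} {a : ℕ × ℕ → ℝ} (hX : IsBigOp P X fun _ => 1)
    (hY : IsBigOp P Y a) : IsBigOp P (fun p ω => X p ω * Y p ω) a := by
  simpa using hX.mul hY

/-- A deterministic rescaling changes the rate accordingly. -/
theorem IsBigOp.smul_of_le [NormedSpace ℝ E] {X : ∀ p, Ω p → E} {a b c : ℕ × ℕ → ℝ} {C : ℝ}
    (hX : IsBigOp P X a) (ha : ∀ᶠ p in atTop, 0 ≤ a p)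
    (hc : ∀ᶠ p in atTop, |c p| * a p ≤ C * b p) : IsBigOp P (fun p ω => c p • X p ω) b := by
  intro ε hε
  obtain ⟨M, hM⟩ := hX ε hε
  refine ⟨|M| * C, ?_⟩
  filter_upwards [hM, hc, ha] with p h1 h2 h3
  refine (measure_mono fun ω hω => ?_).trans h1
  simp only [Set.mem_ofPred_eq, norm_smul, Real.norm_eq_abs] at hω ⊢
  by_contra hcon
  rw [not_lt] at hcon
  have e1 : |c p| * ‖X p ω‖ ≤ |c p| * (M * a p) := by gcongr
  have e2 : |c p| * (M * a p) ≤ |M| * (|c p| * a p) := by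
    have : M * (|c p| * a p) ≤ |M| * (|c p| * a p) := by
      gcongr; exact le_abs_self M
    linarith
  have e3 : |M| * (|c p| * a p) ≤ |M| * (C * b p) := by gcongr
  nlinarith

theorem IsBigOp.tendstoInProb {X : ∀ p, Ω p → E} {a : ℕ × ℕ → ℝ} (hX : IsBigOp P X a)
    (ha : Tendsto a atTop (𝓝 0)) : TendstoInProb P X 0 := by
  intro δ hδ
  simp only [sub_zero]
  have : Whp P fun p ω => ‖X p ω‖ < δ := by
    rw [whp_iff]
    intro ε hε
    obtain ⟨M, hM⟩ := hX ε hε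
    have h0 : Tendsto (fun p => M * a p) atTop (𝓝 0) := by simpa using ha.const_mul M
    filter_upwards [hM, h0.eventually_lt_const hδ] with p h1 h2
    exact (measure_mono fun ω hω => lt_of_lt_of_le h2 (not_lt.1 hω)).trans h1
  simpa [Whp] using this

theorem tendstoInProb_iff_whp {X : ∀ p, Ω p → E} {c : E} :
    TendstoInProb P X c ↔ ∀ V ∈ 𝓝 c, Whp P fun p ω => X p ω ∈ V := by
  constructor
  · intro h V hV
    obtain ⟨ε, hε, hV⟩ := Metric.mem_nhds_iff.1 hV
    have : Whp P fun p ω => ‖X p ω - c‖ < ε := by simpa [Whp] using h ε hε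
    exact this.mono (Eventually.of_forall fun p ω hω => hV (by simpa [dist_eq_norm] using hω))
  · intro h ε hε
    simpa [Whp, dist_eq_norm] using h _ (Metric.ball_mem_nhds c hε)

theorem TendstoInProb.isBigOp_one {X : ∀ p, Ω p → E} {c : E} (h : TendstoInProb P X c) :
    IsBigOp P X fun _ => 1 := by
  intro ε hε
  refine ⟨‖c‖ + 1, ?_⟩
  have h1 := whp_iff.1 (tendstoInProb_iff_whp.1 h _ (Metric.ball_mem_nhds c one_pos)) ε hε
  filter_upwards [h1] with p hp
  refine (measure_mono fun ω hω => ?_).trans hp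
  simp only [Set.mem_ofPred_eq, Metric.mem_ball, not_lt, _root_.mul_one, dist_eq_norm] at hω ⊢
  have := norm_sub_norm_le (X p ω) c
  linarith

/-- Chebyshev's inequality in `O_p` form. -/
theorem isBigOp_of_integral_sq_le {X : ∀ p, Ω p → ℝ} {a : ℕ × ℕ → ℝ} {C : ℝ}
    (ha : ∀ᶠ p in atTop, 0 < a p)
    (h : ∀ᶠ p in atTop, Integrable (fun ω => X p ω ^ 2) (P p) ∧
      ∫ ω, X p ω ^ 2 ∂(P p) ≤ C * a p ^ 2) : IsBigOp P X a := by
  intro ε hε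
  set M : ℝ := √((|C| + 1) / ε) with hMdef
  have hM : 0 < M := Real.sqrt_pos.2 (by positivity)
  have hM2 : M ^ 2 = (|C| + 1) / ε := Real.sq_sqrt (by positivity)
  refine ⟨M, ?_⟩
  filter_upwards [ha, h] with p hap ⟨hint, hle⟩
  have hpos : 0 < (M * a p) ^ 2 := by positivity
  have hmk := mul_meas_ge_le_lintegral₀ (μ := P p)
    (f := fun ω => ENNReal.ofReal (X p ω ^ 2)) hint.aemeasurable.ennreal_ofReal
    (ENNReal.ofReal ((M * a p) ^ 2))
  rw [← ofReal_integral_eq_lintegral_ofReal hint (Eventually.of_forall fun ω => sq_nonneg _)] at hmk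
  have hsub : P p {ω | M * a p < ‖X p ω‖} ≤
      P p {ω | ENNReal.ofReal ((M * a p) ^ 2) ≤ ENNReal.ofReal (X p ω ^ 2)} := by
    refine measure_mono fun ω hω => ?_
    simp only [Set.mem_ofPred_eq] at hω ⊢
    refine ENNReal.ofReal_le_ofReal ?_
    rw [← sq_abs (X p ω), ← Real.norm_eq_abs]
    exact pow_le_pow_left₀ (by positivity) hω.le 2
  refine hsub.trans ?_
  have hne : ENNReal.ofReal ((M * a p) ^ 2) ≠ 0 := (ENNReal.ofReal_pos.2 hpos).ne'
  rw [mul_comm] at hmk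
  refine (ENNReal.le_div_iff_mul_le (Or.inl hne) (Or.inl ENNReal.ofReal_ne_top)).2 hmk |>.trans ?_
  rw [← ENNReal.ofReal_div_of_pos hpos]
  refine ENNReal.ofReal_le_ofReal ?_
  rw [div_le_iff₀ hpos]
  calc ∫ ω, X p ω ^ 2 ∂(P p) ≤ C * a p ^ 2 := hle
    _ ≤ (|C| + 1) * a p ^ 2 := by
      gcongr
      linarith [le_abs_self C]
    _ = ε * (M * a p) ^ 2 := by
      rw [mul_pow, hM2]; field_simp

/-- Markov's inequality in `O_p` form. -/
theorem isBigOp_of_integral_abs_le {X : ∀ p, Ω p → ℝ} {C : ℝ}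
    (h : ∀ᶠ p in atTop, Integrable (X p) (P p) ∧ ∫ ω, |X p ω| ∂(P p) ≤ C) :
    IsBigOp P X fun _ => 1 := by
  have key : IsBigOp P (fun p ω => √|X p ω|) fun _ => 1 := by
    refine isBigOp_of_integral_sq_le (C := C) (Eventually.of_forall fun _ => one_pos) ?_
    filter_upwards [h] with p hp
    simpa [Real.sq_sqrt (abs_nonneg _)] using ⟨hp.1.abs, hp.2⟩
  refine (key.mul_one key).of_le (Eventually.of_forall fun p ω => ?_)
  rw [Real.mul_self_sqrt (abs_nonneg _), Real.norm_eq_abs, Real.norm_eq_abs, abs_abs]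

end Norm

/-- Convergence in probability of a finite family, in terms of neighbourhoods. -/
theorem whp_mem_nhds_pi {ι : Type*} [Finite ι] {E : ι → Type*} [∀ i, TopologicalSpace (E i)]
    {X : ∀ p, Ω p → ∀ i, E i} {c : ∀ i, E i}
    (h : ∀ i, ∀ V ∈ 𝓝 (c i), Whp P fun p ω => X p ω i ∈ V) :
    ∀ V ∈ 𝓝 c, Whp P fun p ω => X p ω ∈ V := by
  intro V hV
  rw [nhds_pi, Filter.mem_pi] at hV
  obtain ⟨I, -, t, ht, hsub⟩ := hV
  exact (whp_forall fun i => h i (t i) (ht i)).mono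
    (Eventually.of_forall fun p ω hω => hsub fun i _ => hω i)

theorem whp_mem_nhds_prod {E F : Type*} [TopologicalSpace E] [TopologicalSpace F]
    {X : ∀ p, Ω p → E} {Y : ∀ p, Ω p → F} {c : E} {d : F}
    (hX : ∀ V ∈ 𝓝 c, Whp P fun p ω => X p ω ∈ V) (hY : ∀ V ∈ 𝓝 d, Whp P fun p ω => Y p ω ∈ V) :
    ∀ V ∈ 𝓝 (c, d), Whp P fun p ω => (X p ω, Y p ω) ∈ V := by
  intro V hV
  obtain ⟨s, hs, t, ht, hsub⟩ := mem_nhds_prod_iff.1 hV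
  exact ((hX s hs).and (hY t ht)).mono (Eventually.of_forall fun p ω hω => hsub hω)

theorem whp_mem_nhds_of_tendsto {E : Type*} [TopologicalSpace E] {x : ℕ × ℕ → E} {c : E}
    (h : Tendsto x atTop (𝓝 c)) : ∀ V ∈ 𝓝 c, Whp P fun p (_ : Ω p) => x p ∈ V :=
  fun _ hV => whp_of_eventually ((h.eventually_mem hV).mono fun _ hp _ => hp)

section ContinuousMapping

variable [∀ p, IsProbabilityMeasure (P p)] {E F : Type*} [TopologicalSpace E] [MeasurableSpace E]
  [OpensMeasurableSpace E] [HasOuterApproxClosed E] [TopologicalSpace F] {μ : Measure E}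
  [IsProbabilityMeasure μ] {X : ∀ p, Ω p → E} {Y : ∀ p, Ω p → F} {c : F} {U : Set (E × F)}

/-- If `X ⇒ μ`, `Y →^p c`, and `h` is continuous on an open set `U` that contains `(x, c)` for
`μ`-almost every `x`, then, up to small probability, `(X, Y)` lies in `U` and `h (X, Y)` is
bounded: by the tube lemma, around a compact set of large measure. -/
theorem exists_bound_of_tendstoInDistribution [μ.Regular]
    (hX : TendstoInDistribution X atTop id P μ)
    (hY : ∀ V ∈ 𝓝 c, Whp P fun p ω => Y p ω ∈ V) (hU : IsOpen U)
    (hUc : ∀ᵐ x ∂μ, (x, c) ∈ U) {h : E × F → ℝ} (hh : ContinuousOn h U) {ε : ℝ} (hε : 0 < ε) :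
    ∃ M : ℝ, ∀ᶠ p in atTop,
      P p {ω | ¬ ((X p ω, Y p ω) ∈ U ∧ |h (X p ω, Y p ω)| < M)} ≤ ENNReal.ofReal ε := by
  have hε2 : 0 < ε / 2 := by positivity
  have hslice : IsOpen {x | (x, c) ∈ U} := hU.preimage (by fun_prop)
  have hμ1 : μ {x | (x, c) ∈ U} = 1 := (prob_compl_eq_zero_iff hslice.measurableSet).1 hUc
  obtain ⟨K, hKU, hK, hμK⟩ : ∃ K ⊆ {x | (x, c) ∈ U}, IsCompact K ∧
      1 - ENNReal.ofReal (ε / 2) < μ K := by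
    refine hslice.exists_lt_isCompact ?_
    rw [hμ1]
    exact ENNReal.sub_lt_self ENNReal.one_ne_top one_ne_zero (by simpa using hε2)
  -- the sets `{u ∈ U | |h u| < n}` form an increasing open cover of `U`
  let W : ℕ → Set (E × F) := fun n => U ∩ h ⁻¹' {y | |y| < n}
  have hWopen : ∀ n, IsOpen (W n) := fun n =>
    hh.isOpen_inter_preimage hU (isOpen_lt continuous_abs continuous_const)
  have hWmono : Monotone W := fun m n hmn u hu =>
    ⟨hu.1, lt_of_lt_of_le (show |h u| < m from hu.2) (Nat.cast_le.2 hmn)⟩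
  have hcov : K ×ˢ {c} ⊆ ⋃ n, W n := by
    rintro ⟨x, y⟩ ⟨hx, rfl⟩
    obtain ⟨n, hn⟩ := exists_nat_gt |h (x, y)|
    exact Set.mem_iUnion.2 ⟨n, hKU hx, hn⟩
  obtain ⟨n, hn⟩ := (hK.prod isCompact_singleton).elim_directed_cover W hWopen hcov
    hWmono.directed_le
  obtain ⟨V, V', hV, hV', hKV, hcV', hsub⟩ := generalized_tube_lemma hK
    (isCompact_singleton (x := c)) (hWopen n) hn
  refine ⟨n, ?_⟩
  have hYV := whp_iff.1 (hY V' (hV'.mem_nhds (by simpa using hcV'))) (ε / 2) hε2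
  have hXV : ∀ᶠ p in atTop, 1 - ENNReal.ofReal (ε / 2) < P p {ω | X p ω ∈ V} := by
    have h1 := ProbabilityMeasure.le_liminf_measure_open_of_tendsto hX.tendsto hV
    have h2 : 1 - ENNReal.ofReal (ε / 2) < atTop.liminf fun p => (P p).map (X p) V := by
      refine lt_of_lt_of_le hμK ((measure_mono hKV).trans ?_)
      simpa using h1
    filter_upwards [eventually_lt_of_lt_liminf h2] with p hp
    rwa [Measure.map_apply_of_aemeasurable (hX.forall_aemeasurable p) hV.measurableSet] at hp
  filter_upwards [hYV, hXV] with p h1 h2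
  have h3 : P p {ω | ¬ X p ω ∈ V} ≤ ENNReal.ofReal (ε / 2) := by
    have hm : NullMeasurableSet {ω | X p ω ∈ V} (P p) :=
      (hX.forall_aemeasurable p).nullMeasurable hV.measurableSet
    have h4 := prob_compl_eq_one_sub₀ hm
    rw [show {ω | ¬ X p ω ∈ V} = {ω | X p ω ∈ V}ᶜ from rfl, h4, tsub_le_iff_right, add_comm]
    exact tsub_le_iff_right.1 h2.le
  calc P p {ω | ¬ ((X p ω, Y p ω) ∈ U ∧ |h (X p ω, Y p ω)| < n)}
      ≤ P p ({ω | ¬ X p ω ∈ V} ∪ {ω | ¬ Y p ω ∈ V'}) := by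
        refine measure_mono fun ω hω => ?_
        by_contra hcon
        simp only [Set.mem_union, Set.mem_ofPred_eq, not_or, not_not] at hcon
        exact hω (hsub (Set.mk_mem_prod hcon.1 hcon.2))
    _ ≤ ENNReal.ofReal (ε / 2) + ENNReal.ofReal (ε / 2) :=
        (measure_union_le _ _).trans (add_le_add h3 h1)
    _ = ENNReal.ofReal ε := by
        rw [← ENNReal.ofReal_add (by positivity) (by positivity), add_halves]

theorem isBigOp_one_of_tendstoInDistribution [μ.Regular]
    (hX : TendstoInDistribution X atTop id P μ)
    (hY : ∀ V ∈ 𝓝 c, Whp P fun p ω => Y p ω ∈ V) (hU : IsOpen U)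
    (hUc : ∀ᵐ x ∂μ, (x, c) ∈ U) {h : E × F → ℝ} (hh : ContinuousOn h U) :
    IsBigOp P (fun p ω => h (X p ω, Y p ω)) fun _ => 1 := by
  intro ε hε
  obtain ⟨M, hM⟩ := exists_bound_of_tendstoInDistribution hX hY hU hUc hh hε
  refine ⟨M, ?_⟩
  filter_upwards [hM] with p hp
  refine (measure_mono fun ω hω => ?_).trans hp
  simp only [Set.mem_ofPred_eq, _root_.mul_one, Real.norm_eq_abs] at hω ⊢
  exact fun hcon => absurd hcon.2 (not_lt.2 hω.le)

theorem whp_mem_of_tendstoInDistribution [μ.Regular]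
    (hX : TendstoInDistribution X atTop id P μ)
    (hY : ∀ V ∈ 𝓝 c, Whp P fun p ω => Y p ω ∈ V) (hU : IsOpen U)
    (hUc : ∀ᵐ x ∂μ, (x, c) ∈ U) : Whp P fun p ω => (X p ω, Y p ω) ∈ U := by
  rw [whp_iff]
  intro ε hε
  obtain ⟨M, hM⟩ := exists_bound_of_tendstoInDistribution hX hY hU hUc
    (h := fun _ => 0) continuousOn_const hε
  filter_upwards [hM] with p hp
  refine (measure_mono fun ω hω => ?_).trans hp
  exact fun hcon => hω hcon.1

/-- Tightness of a sequence that converges in distribution, after a continuous map. -/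
theorem TendstoInDistribution.isBigOp_comp [μ.Regular]
    (hX : TendstoInDistribution X atTop id P μ) {h : E → ℝ} (hh : Continuous h) :
    IsBigOp P (fun p ω => h (X p ω)) fun _ => 1 :=
  isBigOp_one_of_tendstoInDistribution (Y := fun _ _ => ()) (c := ()) (U := Set.univ) hX
    (fun _ hV => whp_of_eventually (Eventually.of_forall fun p ω => mem_of_mem_nhds hV))
    isOpen_univ (by simp) (h := fun u => h u.1) (by fun_prop)

end ContinuousMapping

/-- Slutsky's theorem for an array of probability spaces. The spaces are replaced by their
product, on which all the variables are defined simultaneously. -/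
theorem TendstoInDistribution.of_sub_tendstoInProb [∀ p, IsProbabilityMeasure (P p)]
    {E : Type*} [NormedAddCommGroup E] [SecondCountableTopology E] [MeasurableSpace E]
    [BorelSpace E] {μ : Measure E} [IsProbabilityMeasure μ] {X Y : ∀ p, Ω p → E}
    (hX : TendstoInDistribution X atTop id P μ) (hXm : ∀ p, Measurable (X p))
    (hYm : ∀ p, Measurable (Y p)) (hXY : TendstoInProb P (fun p ω => Y p ω - X p ω) 0) :
    TendstoInDistribution Y atTop id P μ := by
  have hmap : ∀ {Z : ∀ p, Ω p → E}, (∀ p, Measurable (Z p)) → ∀ p,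
      (Measure.infinitePi P).map (fun ω => Z p (ω p)) = (P p).map (Z p) := by
    intro Z hZ p
    rw [← Measure.infinitePi_map_eval P p, Measure.map_map (hZ p) (measurable_pi_apply p)]
    rfl
  have hX' : TendstoInDistribution (fun p (ω : ∀ p, Ω p) => X p (ω p)) atTop id
      (fun _ => Measure.infinitePi P) μ := by
    refine ⟨fun p => ((hXm p).comp (measurable_pi_apply p)).aemeasurable, aemeasurable_id, ?_⟩
    refine hX.tendsto.congr fun p => ?_
    exact Subtype.ext (hmap hXm p).symm
  have hsub : TendstoInMeasure (Measure.infinitePi P)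
      ((fun p (ω : ∀ p, Ω p) => Y p (ω p)) - fun p (ω : ∀ p, Ω p) => X p (ω p)) atTop 0 := by
    rw [tendstoInMeasure_iff_norm]
    intro ε hε
    refine (hXY ε hε).congr fun p => ?_
    have hm : MeasurableSet {ω | ε ≤ ‖Y p ω - X p ω - 0‖} :=
      measurableSet_le measurable_const (by simpa using ((hYm p).sub (hXm p)).norm)
    rw [← Measure.infinitePi_map_eval P p, Measure.map_apply (measurable_pi_apply p) hm]
    rfl
  have hY' := tendstoInDistribution_of_tendstoInMeasure_sub _ id hX' hsub
    fun p => ((hYm p).comp (measurable_pi_apply p)).aemeasurable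
  refine ⟨fun p => (hYm p).aemeasurable, aemeasurable_id, ?_⟩
  refine hY'.tendsto.congr fun p => ?_
  exact Subtype.ext (hmap hYm p)

end Calculus

/-! ### Nondegeneracy of Gaussian matrices -/

section Gaussian

theorem pi_absolutelyContinuous {ι : Type*} [Fintype ι] {E : ι → Type*}
    [∀ i, MeasurableSpace (E i)] {μ ν : ∀ i, Measure (E i)} [∀ i, SigmaFinite (ν i)]
    [∀ i, SigmaFinite (μ i)] (h : ∀ i, μ i ≪ ν i) : Measure.pi μ ≪ Measure.pi ν := by
  classical
  let := Fintype.toEncodable ι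
  have hl : ∀ l : List ι, Measure.tprod l μ ≪ Measure.tprod l ν := by
    intro l
    induction l with
    | nil => exact Measure.AbsolutelyContinuous.rfl
    | cons i l ih =>
      rw [Measure.tprod_cons, Measure.tprod_cons]
      exact (h i).prod ih
  rw [← Measure.pi'_eq_pi, ← Measure.pi'_eq_pi]
  exact (hl _).map (measurable_tProd_elim' _)

theorem stdGaussian_absolutelyContinuous (ι : Type*) [Fintype ι] :
    stdGaussian (EuclideanSpace ℝ ι) ≪ volume := by
  rw [← map_pi_eq_stdGaussian]
  have h1 : (Measure.pi fun _ : ι => gaussianReal 0 1) ≪ (volume : Measure (ι → ℝ)) :=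
    pi_absolutelyContinuous fun _ => gaussianReal_absolutelyContinuous 0 one_ne_zero
  have h2 := h1.map (f := WithLp.toLp 2) (by fun_prop)
  rwa [(PiLp.volume_preserving_toLp ι).map_eq] at h2

theorem multivariateGaussian_absolutelyContinuous {ι : Type*} [Fintype ι] [DecidableEq ι]
    {S : Matrix ι ι ℝ} (hS : S.PosDef) : multivariateGaussian 0 S ≪ volume := by
  open scoped MatrixOrder in
  have hmul : CFC.sqrt S * CFC.sqrt S = S := CFC.sqrt_mul_sqrt_self _ hS.posSemidef.nonneg
  have hdet : (CFC.sqrt S).det ≠ 0 := by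
    intro h0
    have := congrArg Matrix.det hmul
    rw [Matrix.det_mul, h0, zero_mul] at this
    exact hS.det_pos.ne this
  set L : EuclideanSpace ℝ ι →ₗ[ℝ] EuclideanSpace ℝ ι :=
    (Matrix.toEuclideanCLM (𝕜 := ℝ) (CFC.sqrt S)).toLinearMap with hL
  have hLdet : LinearMap.det L ≠ 0 := by
    have : L = Matrix.toLpLin 2 2 (CFC.sqrt S) := by
      ext x; rfl
    rw [this, LinearMap.det_toLpLin]
    exact hdet
  have h := (stdGaussian_absolutelyContinuous ι).map (f := L)
    (L.continuous_of_finiteDimensional.measurable)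
  rw [Measure.map_linearMap_addHaar_eq_smul_addHaar volume hLdet] at h
  have h' : multivariateGaussian 0 S = (stdGaussian (EuclideanSpace ℝ ι)).map L := by
    simp only [multivariateGaussian, zero_add]
    rfl
  rw [h']
  exact h.trans (Measure.smul_absolutelyContinuous)

/-- The matrix with the entries of a vector indexed by pairs. -/
def unvec {n m : Type*} (x : EuclideanSpace ℝ (n × m)) : Matrix n m ℝ :=
  Matrix.of fun a b => x (a, b)

theorem continuous_unvec {n m : Type*} [Fintype n] [Fintype m] :
    Continuous (unvec : EuclideanSpace ℝ (n × m) → Matrix n m ℝ) :=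
  continuous_matrix fun a b => by simp only [unvec, Matrix.of_apply]; fun_prop

theorem exists_mul_eq_one_of_rank {n : Type*} [Fintype n] {m : ℕ} (A : Matrix (Fin m) n ℝ)
    (hA : A.rank = m) : ∃ E : Matrix n (Fin m) ℝ, A * E = 1 := by
  classical
  rw [← Matrix.mulVec_surjective_iff_exists_right_inverse]
  have h : LinearMap.range A.mulVecLin = ⊤ := by
    refine Submodule.eq_top_of_finrank_eq ?_
    rw [← Matrix.rank, hA]; simp
  exact LinearMap.range_eq_top.1 h

/-- If `A` has full row rank, then `A (η_j - η_j')` is almost surely nonsingular: along the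
direction of a right inverse of `A`, in the `j`-th argument, its determinant is a characteristic
polynomial. -/
theorem ae_det_mul_sub_ne_zero {n : Type*} [Fintype n] [DecidableEq n] {m : ℕ}
    {Sig : Matrix (n × Fin m) (n × Fin m) ℝ} (hS : Sig.PosDef) (A : Matrix (Fin m) n ℝ)
    (hA : A.rank = m) {j j' : Fin 4} (hj : j ≠ j') :
    ∀ᵐ x ∂(Measure.pi fun _ : Fin 4 => multivariateGaussian 0 Sig),
      (A * (unvec (x j) - unvec (x j'))).det ≠ 0 := by
  have hac : (Measure.pi fun _ : Fin 4 => multivariateGaussian 0 Sig) ≪ volume :=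
    pi_absolutelyContinuous fun _ => multivariateGaussian_absolutelyContinuous hS
  refine hac.ae_le ?_
  obtain ⟨E, hE⟩ := exists_mul_eq_one_of_rank A hA
  have hcont : Continuous fun x : Fin 4 → EuclideanSpace ℝ (n × Fin m) =>
      (A * (unvec (x j) - unvec (x j'))).det := by
    refine Continuous.matrix_det (Continuous.matrix_mul continuous_const ?_)
    exact (continuous_unvec.comp (continuous_apply j)).sub
      (continuous_unvec.comp (continuous_apply j'))
  let L : ℝ →ₗ[ℝ] (Fin 4 → EuclideanSpace ℝ (n × Fin m)) :=
    LinearMap.toSpanSingleton ℝ _ (Pi.single j (WithLp.toLp 2 fun ab => E ab.1 ab.2))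
  have hHaar : (volume : Measure (Fin 4 → EuclideanSpace ℝ (n × Fin m))).IsAddHaarMeasure :=
    Measure.pi.isAddHaarMeasure _
  refine ae_mem_of_ae_add_linearMap_mem L volume volume
    (s := {x | (A * (unvec (x j) - unvec (x j'))).det ≠ 0})
    (isOpen_ne_fun hcont continuous_const).measurableSet fun y => ?_
  set N := A * (unvec (y j) - unvec (y j')) with hN
  have key : ∀ t : ℝ, A * (unvec ((y + L t) j) - unvec ((y + L t) j')) = N + t • 1 := by
    intro t
    have h1 : unvec ((y + L t) j) = unvec (y j) + t • E := by
      ext a b; simp [unvec, L]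
    have h2 : unvec ((y + L t) j') = unvec (y j') := by
      ext a b; simp [unvec, L, hj.symm]
    rw [h1, h2, add_sub_right_comm, Matrix.mul_add, Matrix.mul_smul, hE]
  have hroots : {t : ℝ | ((-N).charpoly).IsRoot t}.Finite :=
    Polynomial.finite_setOfPred_isRoot (Matrix.charpoly_monic _).ne_zero
  refine measure_mono_null ?_ (hroots.measure_zero volume)
  intro t ht
  simp only [Set.mem_compl_iff, Set.mem_ofPred_eq, not_not] at ht
  have ht' : (N + t • (1 : Matrix (Fin m) (Fin m) ℝ)).det = 0 := by
    rw [← key]; simpa using ht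
  show ((-N).charpoly).eval t = 0
  rw [Matrix.eval_charpoly, ← ht']
  congr 1
  rw [sub_neg_eq_add, add_comm, Matrix.smul_one_eq_diagonal]
  rfl

/-- The marginal law of the strong coordinates. -/
theorem map_strong_multivariateGaussian {k₁ k₂ : ℕ} {S : Matrix (FIdx k₁ k₂) (FIdx k₁ k₂) ℝ}
    (hS : S.PosSemidef) :
    (multivariateGaussian 0 S).map strong =
      multivariateGaussian 0 (S.submatrix Sum.inl Sum.inl) := by
  have hcont : Continuous (strong : EuclideanSpace ℝ (FIdx k₁ k₂) → EuclideanSpace ℝ (Fin k₁)) := by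
    unfold strong; fun_prop
  refine Measure.ext_of_charFun (funext fun t => ?_)
  rw [charFun_multivariateGaussian (hS.submatrix _), charFun_apply,
    integral_map hcont.aemeasurable (by fun_prop)]
  let t' : EuclideanSpace ℝ (FIdx k₁ k₂) := WithLp.toLp 2 (Sum.elim (fun a => t a) fun _ => 0)
  have h1 : ∀ x : EuclideanSpace ℝ (FIdx k₁ k₂), inner ℝ (strong x) t = inner ℝ x t' := by
    intro x
    simp [PiLp.inner_apply, strong, t', Fintype.sum_sum_type]
  simp_rw [h1]
  rw [← charFun_apply, charFun_multivariateGaussian hS]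
  simp [dotProduct, Matrix.mulVec, Fintype.sum_sum_type, t']

end Gaussian

/-! ### Linear algebra of two-stage least squares -/

section TwoStage

open Matrix

variable {n m l : Type*} [Fintype n] [Fintype m] [Fintype l] [DecidableEq m] [DecidableEq l]

/-- The matrix that two-stage least squares applies to the cross moments of the instruments and the
dependent variable, as a function of the cross moments `C = X'Z` and `W = Z'Z`. -/
noncomputable def gain (C : Matrix m l ℝ) (W : Matrix l l ℝ) : Matrix m l ℝ :=
  (C * W⁻¹ * Cᵀ)⁻¹ * (C * W⁻¹)

theorem tsls_eq_gain (X : Matrix n m ℝ) (Z : Matrix n l ℝ) (Y : n → ℝ) :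
    tsls X Z Y = gain (Xᵀ * Z) (Zᵀ * Z) *ᵥ (Zᵀ *ᵥ Y) := by
  simp only [tsls, gain, mulVec_mulVec, transpose_mul, transpose_transpose, Matrix.mul_assoc]

theorem gain_smul {c : ℝ} (hc : c ≠ 0) (C : Matrix m l ℝ) {W : Matrix l l ℝ} (hW : W.det ≠ 0)
    (hG : (C * W⁻¹ * Cᵀ).det ≠ 0) : gain (c • C) (c • W) = c⁻¹ • gain C W := by
  have h1 : (c • W)⁻¹ = c⁻¹ • W⁻¹ := inv_smul' W (Units.mk0 c hc) (isUnit_iff_ne_zero.2 hW)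
  have h2 : (c • (C * W⁻¹ * Cᵀ))⁻¹ = c⁻¹ • (C * W⁻¹ * Cᵀ)⁻¹ :=
    inv_smul' _ (Units.mk0 c hc) (isUnit_iff_ne_zero.2 hG)
  have h3 : (c • C) * (c⁻¹ • W⁻¹) = C * W⁻¹ := by
    rw [Matrix.smul_mul, Matrix.mul_smul, smul_smul, mul_inv_cancel₀ hc, one_smul]
  rw [gain, h1, h3, transpose_smul, Matrix.mul_smul, h2, Matrix.smul_mul, ← gain]

theorem tsls_add_mulVec (X : Matrix n m ℝ) (Z : Matrix n l ℝ) (θ : m → ℝ) (ε : n → ℝ)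
    (hdet : (Xᵀ * Z * (Zᵀ * Z)⁻¹ * (Xᵀ * Z)ᵀ).det ≠ 0) :
    tsls X Z (X *ᵥ θ + ε) = θ + tsls X Z ε := by
  have hA : gain (Xᵀ * Z) (Zᵀ * Z) * (Zᵀ * X) = 1 := by
    have : Zᵀ * X = (Xᵀ * Z)ᵀ := by rw [transpose_mul, transpose_transpose]
    rw [gain, Matrix.mul_assoc, this]
    exact nonsing_inv_mul _ (isUnit_iff_ne_zero.2 hdet)
  rw [tsls_eq_gain, tsls_eq_gain, mulVec_add, mulVec_add, mulVec_mulVec, mulVec_mulVec,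
    Matrix.mul_assoc, hA,
    one_mulVec]

theorem tsls_smul (X : Matrix n m ℝ) (Z : Matrix n l ℝ) (Y : n → ℝ) (c : ℝ) :
    tsls X Z (c • Y) = c • tsls X Z Y := by
  rw [tsls_eq_gain, tsls_eq_gain, mulVec_smul, mulVec_smul]

/-- Rescaling regressors and instruments coordinatewise rescales the coefficients inversely. -/
theorem tsls_mul_diagonal (X : Matrix n m ℝ) (Z : Matrix n l ℝ) (Y : n → ℝ) {q : m → ℝ}
    {r : l → ℝ} (hq : ∀ a, q a ≠ 0) (hr : ∀ b, r b ≠ 0) :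
    tsls (X * diagonal q) (Z * diagonal r) Y = fun a => (q a)⁻¹ * tsls X Z Y a := by
  have hQ : IsUnit (diagonal q).det := by
    rw [det_diagonal]; exact isUnit_iff_ne_zero.2 (Finset.prod_ne_zero_iff.2 fun a _ => hq a)
  have hR : IsUnit (diagonal r).det := by
    rw [det_diagonal]; exact isUnit_iff_ne_zero.2 (Finset.prod_ne_zero_iff.2 fun a _ => hr a)
  have hP : (Z * diagonal r) * ((Z * diagonal r)ᵀ * (Z * diagonal r))⁻¹ * (Z * diagonal r)ᵀ
      = Z * (Zᵀ * Z)⁻¹ * Zᵀ := by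
    rw [transpose_mul, diagonal_transpose,
      show diagonal r * Zᵀ * (Z * diagonal r) = diagonal r * (Zᵀ * Z) * diagonal r by
        simp only [Matrix.mul_assoc],
      Matrix.mul_inv_rev, Matrix.mul_inv_rev]
    calc Z * diagonal r * ((diagonal r)⁻¹ * ((Zᵀ * Z)⁻¹ * (diagonal r)⁻¹)) * (diagonal r * Zᵀ)
        = Z * (diagonal r * (diagonal r)⁻¹) * (Zᵀ * Z)⁻¹ * ((diagonal r)⁻¹ * diagonal r) * Zᵀ := by
          simp only [Matrix.mul_assoc]
      _ = Z * (Zᵀ * Z)⁻¹ * Zᵀ := by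
          rw [mul_nonsing_inv _ hR, nonsing_inv_mul _ hR, Matrix.mul_one, Matrix.mul_one]
  have hqi : (diagonal q)⁻¹ = diagonal fun a => (q a)⁻¹ := by
    refine inv_eq_right_inv ?_
    rw [diagonal_mul_diagonal, ← diagonal_one]
    congr 1
    funext a
    exact mul_inv_cancel₀ (hq a)
  rw [tsls, hP]
  set M := Z * (Zᵀ * Z)⁻¹ * Zᵀ with hM
  have e1 : (X * diagonal q)ᵀ * M * (X * diagonal q)
      = diagonal q * (Xᵀ * M * X) * diagonal q := by
    rw [transpose_mul, diagonal_transpose]; simp only [Matrix.mul_assoc]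
  have e2 : (X * diagonal q)ᵀ * M = diagonal q * (Xᵀ * M) := by
    rw [transpose_mul, diagonal_transpose, Matrix.mul_assoc]
  rw [e1, e2, Matrix.mul_inv_rev, Matrix.mul_inv_rev, mulVec_mulVec]
  have e3 : (diagonal q)⁻¹ * ((Xᵀ * M * X)⁻¹ * (diagonal q)⁻¹) * (diagonal q * (Xᵀ * M))
      = (diagonal q)⁻¹ * ((Xᵀ * M * X)⁻¹ * (Xᵀ * M)) := by
    calc _ = (diagonal q)⁻¹ * ((Xᵀ * M * X)⁻¹ * ((diagonal q)⁻¹ * diagonal q) * (Xᵀ * M)) := by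
          simp only [Matrix.mul_assoc]
      _ = _ := by rw [nonsing_inv_mul _ hQ, Matrix.mul_one]
  rw [e3, ← mulVec_mulVec, hqi]
  funext a
  rw [mulVec_diagonal, ← mulVec_mulVec]
  rfl

end TwoStage

/-! ### Regressors and instruments as linear images of loadings and first-pass errors -/

section Stack

open Matrix

variable {f v m : Type*} [Fintype f]

/-- Coordinates of `(γ_i, ξ_i^(1), …, ξ_i^(4))`, where `ξ_i^(j)` is the normalized idiosyncratic
error of the first pass on the `j`-th subsample. -/
abbrev YIdx (f v : Type*) : Type _ := (f ⊕ v) ⊕ (Fin 4 × f)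

/-- The matrix of the normalized first-pass error `q_j = s H_j μ_i + K_j ξ_i^(j)`, which has a part
due to the missing factors and an idiosyncratic part. -/
def firstPass (s : ℝ) (H : Fin 4 → Matrix f v ℝ) (K : Fin 4 → Matrix f f ℝ) (j : Fin 4) :
    Matrix f (YIdx f v) ℝ :=
  of fun a => Sum.elim (Sum.elim (fun _ => 0) fun c => s * H j a c)
    fun ib => if ib.1 = j then K j a ib.2 else 0

/-- The matrix of `(b_i + D q_j, A (q_j - q_j'))`, where `b_i` consists of those coordinates of
`γ_i` that belong to the observed factors. -/
def stack [DecidableEq f] (D : Matrix f f ℝ) (A : Matrix m f ℝ) (s : ℝ) (H : Fin 4 → Matrix f v ℝ)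
    (K : Fin 4 → Matrix f f ℝ) (j j' : Fin 4) : Matrix (f ⊕ m) (YIdx f v) ℝ :=
  fromRows (fromCols (fromCols 1 0) 0 + D * firstPass s H K j)
    (A * (firstPass s H K j - firstPass s H K j'))

/-- The limit of the second moments of `(γ_i, ξ_i^(1), …, ξ_i^(4))`. The factor `4` is the ratio
of the lengths of the full sample and of the subsamples. -/
def limitMoment (Γ : Matrix (f ⊕ v) (f ⊕ v) ℝ) (Sig : Matrix f f ℝ) :
    Matrix (YIdx f v) (YIdx f v) ℝ :=
  fromBlocks Γ 0 0 (of fun ia jb => if ia.1 = jb.1 then 4 * Sig ia.2 jb.2 else 0)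

theorem firstPass_mulVec [Fintype v] (s : ℝ) (H : Fin 4 → Matrix f v ℝ)
    (K : Fin 4 → Matrix f f ℝ) (j : Fin 4) (g : f ⊕ v → ℝ) (x : Fin 4 × f → ℝ) :
    firstPass s H K j *ᵥ Sum.elim g x
      = s • (H j *ᵥ fun c => g (Sum.inr c)) + K j *ᵥ fun b => x (j, b) := by
  funext a
  simp only [mulVec, dotProduct, firstPass, of_apply, Fintype.sum_sum_type, Sum.elim_inl,
    Sum.elim_inr, zero_mul, Finset.sum_const_zero, zero_add, Pi.add_apply, Pi.smul_apply,
    smul_eq_mul, Finset.mul_sum, Fintype.sum_prod_type, ite_mul]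
  congr 1
  · exact Finset.sum_congr rfl fun c _ => by ring
  · rw [Finset.sum_comm]
    exact Finset.sum_congr rfl fun b _ => by simp

theorem vecMul_firstPass (s : ℝ) (H : Fin 4 → Matrix f v ℝ) (K : Fin 4 → Matrix f f ℝ) (j : Fin 4)
    (w : f → ℝ) : w ᵥ* firstPass s H K j =
      Sum.elim (Sum.elim (0 : f → ℝ) (s • (w ᵥ* H j)))
        fun ib => if ib.1 = j then (w ᵥ* K j) ib.2 else 0 := by
  funext k
  rcases k with (a | c) | ⟨i, b⟩
  · simp [vecMul, dotProduct, firstPass]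
  · simp only [vecMul, dotProduct, firstPass, of_apply, Sum.elim_inl, Sum.elim_inr, Pi.smul_apply,
      smul_eq_mul, Finset.mul_sum]
    exact Finset.sum_congr rfl fun a _ => by ring
  · by_cases h : i = j <;> simp [vecMul, dotProduct, firstPass, h]

theorem stack_mulVec [Fintype v] [DecidableEq f] (D : Matrix f f ℝ) (A : Matrix m f ℝ) (s : ℝ)
    (H : Fin 4 → Matrix f v ℝ) (K : Fin 4 → Matrix f f ℝ) (j j' : Fin 4) (y : YIdx f v → ℝ) :
    stack D A s H K j j' *ᵥ y =
      Sum.elim ((fun a => y (Sum.inl (Sum.inl a))) + D *ᵥ (firstPass s H K j *ᵥ y))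
        (A *ᵥ (firstPass s H K j *ᵥ y - firstPass s H K j' *ᵥ y)) := by
  rw [stack, fromRows_mulVec, add_mulVec, mulVec_mulVec, ← mulVec_mulVec y A, sub_mulVec]
  congr 2
  conv_lhs => rw [← Sum.elim_comp_inl_inr y, fromCols_mulVec_sumElim]
  rw [zero_mulVec, add_zero, ← Sum.elim_comp_inl_inr (y ∘ Sum.inl), fromCols_mulVec_sumElim,
    zero_mulVec, add_zero, one_mulVec]
  rfl

theorem vecMul_stack [Fintype m] [DecidableEq f] (D : Matrix f f ℝ) (A : Matrix m f ℝ) (s : ℝ)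
    (H : Fin 4 → Matrix f v ℝ) (K : Fin 4 → Matrix f f ℝ) (j j' : Fin 4) (x : f → ℝ) (z : m → ℝ) :
    Sum.elim x z ᵥ* stack D A s H K j j' =
      Sum.elim (Sum.elim x 0) 0 + (x ᵥ* D) ᵥ* firstPass s H K j
        + (z ᵥ* A) ᵥ* firstPass s H K j - (z ᵥ* A) ᵥ* firstPass s H K j' := by
  rw [stack, vecMul_fromRows]
  simp only [Sum.elim_comp_inl, Sum.elim_comp_inr, vecMul_add, vecMul_vecMul, vecMul_fromCols,
    vecMul_one, vecMul_zero, Matrix.mul_sub, vecMul_sub]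
  abel

theorem dotProduct_limitMoment_mulVec [Fintype v] (Γ : Matrix (f ⊕ v) (f ⊕ v) ℝ)
    (Sig : Matrix f f ℝ) (g : f ⊕ v → ℝ) (x : Fin 4 × f → ℝ) :
    Sum.elim g x ⬝ᵥ (limitMoment Γ Sig *ᵥ Sum.elim g x) =
      g ⬝ᵥ (Γ *ᵥ g) + 4 * ∑ i, (fun b => x (i, b)) ⬝ᵥ (Sig *ᵥ fun b => x (i, b)) := by
  rw [limitMoment, fromBlocks_mulVec, sumElim_dotProduct_sumElim]
  simp only [Sum.elim_comp_inl, Sum.elim_comp_inr, zero_mulVec, add_zero, zero_add]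
  congr 1
  simp only [dotProduct, mulVec, of_apply, Fintype.sum_prod_type, Finset.mul_sum, ite_mul,
    zero_mul]
  refine Finset.sum_congr rfl fun i _ => Finset.sum_congr rfl fun a _ => ?_
  rw [Finset.sum_comm]
  refine Finset.sum_congr rfl fun b _ => ?_
  simp only [mul_ite, mul_zero, Finset.sum_ite_eq, Finset.mem_univ, if_true]
  ring

/-- The conditions on the limits of the second moments of the loadings (`Γ`) and of the first-pass
errors (`Sig`) under which the limiting regressions are well posed: `Sig` may be singular when there
are as many missing as observed factors. -/
structure Nondegenerate [Fintype v] (Γ : Matrix (f ⊕ v) (f ⊕ v) ℝ) (Sig : Matrix f f ℝ) :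
    Prop where
  posDef : Γ.PosDef
  nonneg : ∀ x : f → ℝ, 0 ≤ x ⬝ᵥ (Sig *ᵥ x)
  posDef_or : Sig.PosDef ∨ Fintype.card f = Fintype.card v

variable [Fintype v] [DecidableEq f] [DecidableEq v] {Γ : Matrix (f ⊕ v) (f ⊕ v) ℝ}
  {Sig : Matrix f f ℝ}

/-- The limit of the second moments of the instruments is definite. When there are fewer missing
than observed factors this is due to the idiosyncratic errors of the first pass, otherwise to the
loadings. -/
theorem eq_zero_of_dotProduct_stack (hnd : Nondegenerate Γ Sig) (D : Matrix f f ℝ) {s : ℝ}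
    (hs : s ≠ 0) {H : Fin 4 → Matrix f v ℝ} {K : Fin 4 → Matrix f f ℝ} {j j' : Fin 4} (hj : j ≠ j')
    (hK : (K j').det ≠ 0) {A : Matrix v f ℝ} (hA : (A * (H j - H j')).det ≠ 0) {x : f ⊕ f → ℝ}
    (hx : x ⬝ᵥ ((stack D (1 : Matrix f f ℝ) s H K j j' * limitMoment Γ Sig *
      (stack D (1 : Matrix f f ℝ) s H K j j')ᵀ) *ᵥ x) = 0) :
    x = 0 := by
  obtain ⟨xf, z, rfl⟩ : ∃ xf z, x = Sum.elim xf z := ⟨_, _, (Sum.elim_comp_inl_inr x).symm⟩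
  set y := Sum.elim xf z ᵥ* stack D (1 : Matrix f f ℝ) s H K j j' with hy
  have hq : y ⬝ᵥ (limitMoment Γ Sig *ᵥ y) = 0 := by
    rw [← hx, ← mulVec_mulVec, ← mulVec_mulVec, mulVec_transpose,
      dotProduct_mulVec _ (stack _ _ _ _ _ _ _)]
  obtain ⟨g, e, hge⟩ : ∃ g e, y = Sum.elim g e := ⟨_, _, (Sum.elim_comp_inl_inr y).symm⟩
  -- the quadratic form splits into nonnegative parts, each of which vanishes
  rw [hge, dotProduct_limitMoment_mulVec] at hq
  have h1 : 0 ≤ g ⬝ᵥ (Γ *ᵥ g) := by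
    simpa using hnd.posDef.posSemidef.dotProduct_mulVec_nonneg g
  have h2 : ∀ i, 0 ≤ (fun b => e (i, b)) ⬝ᵥ (Sig *ᵥ fun b => e (i, b)) := fun i => hnd.nonneg _
  have h3 := Finset.sum_nonneg fun i (_ : i ∈ Finset.univ) => h2 i
  have hg0 : g ⬝ᵥ (Γ *ᵥ g) = 0 := by linarith
  have he0 : ∑ i, (fun b => e (i, b)) ⬝ᵥ (Sig *ᵥ fun b => e (i, b)) = 0 := by linarith
  have hg : g = 0 := by
    by_contra hne
    have := hnd.posDef.dotProduct_mulVec_pos hne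
    simp only [star_trivial] at this
    exact this.ne' hg0
  rw [hy, vecMul_stack] at hge
  simp only [vecMul_one, vecMul_firstPass] at hge
  have hxf : xf = 0 := by
    funext a
    have := congrFun hge (Sum.inl (Sum.inl a))
    simpa [hg] using this
  subst hxf
  have hv : z ᵥ* (H j - H j') = 0 := by
    funext c
    have := congrFun hge (Sum.inl (Sum.inr c))
    simp only [hg, zero_vecMul, smul_zero, Pi.add_apply, Pi.sub_apply, Sum.elim_inl, Sum.elim_inr,
      Pi.zero_apply, add_zero, zero_add, Pi.smul_apply, smul_eq_mul] at this
    rw [vecMul_sub]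
    have h4 : s * ((z ᵥ* H j) c - (z ᵥ* H j') c) = 0 := by linarith
    exact (mul_eq_zero.1 h4).resolve_left hs
  suffices hz : z = 0 by rw [hz]; exact Sum.elim_zero_zero
  rcases hnd.posDef_or with hS | hcard
  · -- the part of `y` on the subsample `j'` is `z ᵥ* K j'` up to sign
    have hej : (fun b => e (j', b)) = 0 := by
      by_contra hne
      have h5 := hS.dotProduct_mulVec_pos hne
      simp only [star_trivial] at h5
      exact h5.ne' ((Finset.sum_eq_zero_iff_of_nonneg fun i _ => h2 i).1 he0 j' (Finset.mem_univ _))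
    have hzK : z ᵥ* K j' = 0 := by
      funext b
      have := congrFun hge (Sum.inr (j', b))
      have h6 := congrFun hej b
      simp only [Pi.zero_apply] at h6
      simpa [hj.symm, h6] using this
    exact eq_zero_of_vecMul_eq_zero hK hzK
  · -- `H j - H j'` is square, so that its left inverse is a right inverse
    have hl : ((A * (H j - H j'))⁻¹ * A) * (H j - H j') = 1 := by
      rw [Matrix.mul_assoc]; exact nonsing_inv_mul _ (isUnit_iff_ne_zero.2 hA)
    have hr := (mul_eq_one_comm_of_card_eq _ _ _ hcard.symm).1 hl
    rw [← vecMul_one z, ← hr, ← vecMul_vecMul, hv, zero_vecMul]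

theorem det_ne_zero_of_forall_mulVec {k : Type*} [Fintype k] [DecidableEq k] {M : Matrix k k ℝ}
    (h : ∀ x, M *ᵥ x = 0 → x = 0) : M.det ≠ 0 := fun h0 => by
  obtain ⟨x, hx, hMx⟩ := exists_mulVec_eq_zero_iff.2 h0
  exact hx (h x hMx)

theorem det_stack_ne_zero (hnd : Nondegenerate Γ Sig) (D : Matrix f f ℝ) {s : ℝ}
    (hs : s ≠ 0) {H : Fin 4 → Matrix f v ℝ} {K : Fin 4 → Matrix f f ℝ} {j j' : Fin 4} (hj : j ≠ j')
    (hK : (K j').det ≠ 0) {A : Matrix v f ℝ} (hA : (A * (H j - H j')).det ≠ 0) :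
    (stack D (1 : Matrix f f ℝ) s H K j j' * limitMoment Γ Sig *
      (stack D (1 : Matrix f f ℝ) s H K j j')ᵀ).det ≠ 0 :=
  det_ne_zero_of_forall_mulVec fun x hx =>
    eq_zero_of_dotProduct_stack hnd D hs hj hK hA (by rw [hx, dotProduct_zero])

/-- The limit of the cross moments of regressors and instruments has full rank. Since regressors and
instruments come from distinct subsamples, only the loadings contribute. -/
theorem eq_zero_of_cross_stack (hnd : Nondegenerate Γ Sig) (D : Matrix f f ℝ) {s : ℝ}
    (hs : s ≠ 0) {H : Fin 4 → Matrix f v ℝ} {K : Fin 4 → Matrix f f ℝ} {j₁ j₂ j₃ j₄ : Fin 4}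
    (h13 : j₁ ≠ j₃) (h14 : j₁ ≠ j₄) (h23 : j₂ ≠ j₃) (h24 : j₂ ≠ j₄) {A A' : Matrix v f ℝ}
    (hA : (A * (H j₁ - H j₂)).det ≠ 0) (hA' : (A' * (H j₃ - H j₄)).det ≠ 0) {x : f ⊕ v → ℝ}
    (hx : (stack D A s H K j₁ j₂ * limitMoment Γ Sig *
      (stack D (1 : Matrix f f ℝ) s H K j₃ j₄)ᵀ)ᵀ *ᵥ x = 0) :
    x = 0 := by
  obtain ⟨xf, z, rfl⟩ : ∃ xf z, x = Sum.elim xf z := ⟨_, _, (Sum.elim_comp_inl_inr x).symm⟩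
  rw [transpose_mul, transpose_mul, transpose_transpose, ← mulVec_mulVec, ← mulVec_mulVec,
    mulVec_transpose, mulVec_transpose, vecMul_stack] at hx
  simp only [vecMul_firstPass] at hx
  set y := Sum.elim (Sum.elim xf (0 : v → ℝ)) (0 : Fin 4 × f → ℝ)
      + Sum.elim (Sum.elim (0 : f → ℝ) (s • ((xf ᵥ* D) ᵥ* H j₁)))
        (fun ib => if ib.1 = j₁ then ((xf ᵥ* D) ᵥ* K j₁) ib.2 else 0)
      + Sum.elim (Sum.elim (0 : f → ℝ) (s • ((z ᵥ* A) ᵥ* H j₁)))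
        (fun ib => if ib.1 = j₁ then ((z ᵥ* A) ᵥ* K j₁) ib.2 else 0)
      - Sum.elim (Sum.elim (0 : f → ℝ) (s • ((z ᵥ* A) ᵥ* H j₂)))
        (fun ib => if ib.1 = j₂ then ((z ᵥ* A) ᵥ* K j₂) ib.2 else 0) with hy
  obtain ⟨g, e, hge⟩ : ∃ g e, y = Sum.elim g e := ⟨_, _, (Sum.elim_comp_inl_inr y).symm⟩
  -- `y` has no first-pass error of the subsamples `j₃` and `j₄`, so that only `Γ` matters
  have hee : ∀ i b, i ≠ j₁ → i ≠ j₂ → e (i, b) = 0 := by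
    intro i b h1 h2
    have := congrFun hge (Sum.inr (i, b))
    simpa [hy, h1, h2] using this.symm
  rw [hge, limitMoment, vecMul_fromBlocks] at hx
  simp only [Sum.elim_comp_inl, Sum.elim_comp_inr, vecMul_zero, add_zero, zero_add] at hx
  set e' := e ᵥ* (of fun ia jb : Fin 4 × f => if ia.1 = jb.1 then 4 * Sig ia.2 jb.2 else 0) with he'
  have hee' : ∀ i, i ≠ j₁ → i ≠ j₂ → (fun b => e' (i, b)) = 0 := by
    intro i h1 h2
    funext b
    simp only [he', vecMul, dotProduct, of_apply, Fintype.sum_prod_type, Pi.zero_apply]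
    refine Finset.sum_eq_zero fun i' _ => Finset.sum_eq_zero fun a _ => ?_
    by_cases hi : i' = i
    · rw [hi, hee i a h1 h2, zero_mul]
    · rw [if_neg hi, mul_zero]
  rw [stack_mulVec] at hx
  simp only [firstPass_mulVec, hee' j₃ h13.symm h23.symm, hee' j₄ h14.symm h24.symm, mulVec_zero,
    add_zero, one_mulVec, ← smul_sub, ← sub_mulVec] at hx
  set G := g ᵥ* Γ with hG
  have hGv : (fun c => G (Sum.inr c)) = 0 := by
    have h1 : (H j₃ - H j₄) *ᵥ (fun c => G (Sum.inr c)) = 0 := by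
      funext a
      have := congrFun hx (Sum.inr a)
      simpa [hs] using this
    have h2 : (A' * (H j₃ - H j₄)) *ᵥ (fun c => G (Sum.inr c)) = 0 := by
      rw [← mulVec_mulVec, h1, mulVec_zero]
    exact eq_zero_of_mulVec_eq_zero hA' h2
  have hGf : (fun a => G (Sum.inl a)) = 0 := by
    funext a
    have := congrFun hx (Sum.inl a)
    simpa [hGv] using this
  have hG0 : G = 0 := by
    funext k
    rcases k with a | c
    · exact congrFun hGf a
    · exact congrFun hGv c
  have hg : g = 0 := eq_zero_of_vecMul_eq_zero hnd.posDef.det_pos.ne' hG0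
  have hxf : xf = 0 := by
    funext a
    have := congrFun hge (Sum.inl (Sum.inl a))
    simpa [hy, hg] using this
  subst hxf
  have hz : z ᵥ* (A * (H j₁ - H j₂)) = 0 := by
    funext c
    have := congrFun hge (Sum.inl (Sum.inr c))
    simp only [hy, hg, zero_vecMul, smul_zero, Pi.add_apply, Pi.sub_apply, Sum.elim_inl,
      Sum.elim_inr, Pi.zero_apply, add_zero, zero_add, Pi.smul_apply, smul_eq_mul] at this
    rw [← vecMul_vecMul, vecMul_sub]
    have h4 : s * (((z ᵥ* A) ᵥ* H j₁) c - ((z ᵥ* A) ᵥ* H j₂) c) = 0 := by linarith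
    exact (mul_eq_zero.1 h4).resolve_left hs
  rw [eq_zero_of_vecMul_eq_zero hA hz]
  exact Sum.elim_zero_zero

theorem det_cross_stack_ne_zero (hnd : Nondegenerate Γ Sig) (D : Matrix f f ℝ) {s : ℝ}
    (hs : s ≠ 0) {H : Fin 4 → Matrix f v ℝ} {K : Fin 4 → Matrix f f ℝ} {j₁ j₂ j₃ j₄ : Fin 4}
    (h13 : j₁ ≠ j₃) (h14 : j₁ ≠ j₄) (h23 : j₂ ≠ j₃) (h24 : j₂ ≠ j₄) (h34 : j₃ ≠ j₄)
    (hK : (K j₄).det ≠ 0) {A A' : Matrix v f ℝ}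
    (hA : (A * (H j₁ - H j₂)).det ≠ 0) (hA' : (A' * (H j₃ - H j₄)).det ≠ 0) :
    ((stack D A s H K j₁ j₂ * limitMoment Γ Sig * (stack D (1 : Matrix f f ℝ) s H K j₃ j₄)ᵀ) *
      (stack D (1 : Matrix f f ℝ) s H K j₃ j₄ * limitMoment Γ Sig *
        (stack D (1 : Matrix f f ℝ) s H K j₃ j₄)ᵀ)⁻¹ *
      (stack D A s H K j₁ j₂ * limitMoment Γ Sig *
        (stack D (1 : Matrix f f ℝ) s H K j₃ j₄)ᵀ)ᵀ).det ≠ 0 := by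
  have hWdet := det_stack_ne_zero hnd D hs h34 hK hA'
  have hWdef := fun x => eq_zero_of_dotProduct_stack hnd D hs h34 hK hA' (x := x)
  have hC := fun x =>
    eq_zero_of_cross_stack (K := K) hnd D hs h13 h14 h23 h24 hA hA' (x := x)
  set W := stack D (1 : Matrix f f ℝ) s H K j₃ j₄ * limitMoment Γ Sig *
    (stack D (1 : Matrix f f ℝ) s H K j₃ j₄)ᵀ
  set C := stack D A s H K j₁ j₂ * limitMoment Γ Sig *
    (stack D (1 : Matrix f f ℝ) s H K j₃ j₄)ᵀ
  -- if `C W⁻¹ Cᵀ x = 0`, the quadratic form of `W` vanishes at `W⁻¹ Cᵀ x`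
  refine det_ne_zero_of_forall_mulVec fun x hx => hC x ?_
  have hw : W *ᵥ (W⁻¹ *ᵥ (Cᵀ *ᵥ x)) = Cᵀ *ᵥ x := by
    rw [mulVec_mulVec, mul_nonsing_inv _ (isUnit_iff_ne_zero.2 hWdet), one_mulVec]
  have h0 : W⁻¹ *ᵥ (Cᵀ *ᵥ x) = 0 := by
    refine hWdef _ ?_
    rw [hw, dotProduct_mulVec, vecMul_transpose, mulVec_mulVec, mulVec_mulVec, hx, zero_dotProduct]
  rw [← hw, h0, mulVec_zero]

end Stack

/-! ### Conditional serial independence and orthogonality -/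

section Conditional

variable {Ω : Type*} {ℱ : MeasurableSpace Ω} {mΩ : MeasurableSpace Ω} {P : Measure Ω}
  [IsProbabilityMeasure P]

theorem condExp_indicator_one_bound (C : Set Ω) (hC : MeasurableSet C) :
    ∀ᵐ ω ∂P, 0 ≤ (P⟦C | ℱ⟧) ω ∧ (P⟦C | ℱ⟧) ω ≤ 1 := by
  by_cases hℱ : ℱ ≤ mΩ
  · have hint : Integrable (C.indicator fun _ => (1 : ℝ)) P :=
      (integrable_const (1 : ℝ)).indicator hC
    have h1 : 0 ≤ᵐ[P] P⟦C | ℱ⟧ :=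
      condExp_nonneg (Eventually.of_forall fun ω => Set.indicator_nonneg (fun _ _ => zero_le_one) ω)
    have h2 : P⟦C | ℱ⟧ ≤ᵐ[P] P[fun _ => (1 : ℝ) | ℱ] :=
      condExp_mono hint (integrable_const _) (Eventually.of_forall fun ω =>
        Set.indicator_le_self' (fun _ _ => zero_le_one) ω)
    rw [condExp_const hℱ] at h2
    filter_upwards [h1, h2] with ω ha hb using ⟨ha, hb⟩
  · rw [condExp_of_not_le hℱ]
    exact Eventually.of_forall fun ω => ⟨le_rfl, zero_le_one⟩

/-- `E[f 1_C 1_G]` for `G ∈ ℱ` when the conditional expectations of `f` and `1_C` multiply. -/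
theorem setIntegral_condExp_mul (hℱ : ℱ ≤ mΩ) {f : Ω → ℝ} (hf : Integrable f P) {C : Set Ω}
    (hC : MeasurableSet C) {G : Set Ω} (hG : MeasurableSet[ℱ] G) :
    ∫ ω in G, (P⟦C | ℱ⟧) ω * (P[f | ℱ]) ω ∂P = ∫ ω in G, (P⟦C | ℱ⟧) ω * f ω ∂P := by
  have hb : ∀ᵐ ω ∂P, ‖(P⟦C | ℱ⟧) ω‖ ≤ 1 := by
    filter_upwards [condExp_indicator_one_bound (ℱ := ℱ) C hC] with ω hω
    rw [Real.norm_of_nonneg hω.1]; exact hω.2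
  have hsm : StronglyMeasurable[ℱ] (P⟦C | ℱ⟧) := stronglyMeasurable_condExp
  have h1 := condExp_stronglyMeasurable_mul_of_bound hℱ hsm hf 1 hb
  have hint : Integrable ((P⟦C | ℱ⟧) * f) P :=
    hf.bdd_mul (hsm.mono hℱ).aestronglyMeasurable hb
  have h2 := setIntegral_condExp hℱ hint hG
  rw [← setIntegral_congr_ae (hℱ _ hG) (h1.mono fun ω hω _ => hω.symm)] at h2
  exact h2

variable {ι : Type*} {e : ℕ → Ω → ι → ℝ} {T : ℕ}

/-- The information in `ℱ` and in all error vectors but the `t`-th. -/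
@[reducible] def otherSigma (ℱ : MeasurableSpace Ω) (e : ℕ → Ω → ι → ℝ) (T t : ℕ) :
    MeasurableSpace Ω :=
  ℱ ⊔ ⨆ s ∈ (Finset.range T).erase t, MeasurableSpace.comap (e s) inferInstance

theorem otherSigma_le (hℱ : ℱ ≤ mΩ) (he : ∀ t < T, Measurable (e t)) (t : ℕ) :
    otherSigma ℱ e T t ≤ mΩ :=
  sup_le hℱ (iSup₂_le fun s hs =>
    (he s (Finset.mem_range.1 (Finset.mem_of_mem_erase hs))).comap_le)

section SerialIndependence

variable (hℱ : ℱ ≤ mΩ) (he : ∀ t < T, Measurable (e t))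
  (hint : ∀ t < T, ∀ i, Integrable (fun ω => e t ω i) P)
  (hci : ∀ B : ℕ → Set (ι → ℝ), (∀ t, MeasurableSet (B t)) →
    P⟦⋂ t ∈ Finset.range T, e t ⁻¹' B t | ℱ⟧
      =ᵐ[P] fun ω => ∏ t ∈ Finset.range T, (P⟦e t ⁻¹' B t | ℱ⟧) ω)
  (hmean : ∀ t < T, ∀ i, P[fun ω => e t ω i | ℱ] =ᵐ[P] 0)

include hℱ hci in
/-- Conditional independence of one error vector from the others. -/
theorem condExp_inter_of_serial {t : ℕ} (ht : t < T) {B : ℕ → Set (ι → ℝ)}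
    (hB : ∀ s, MeasurableSet (B s)) {B₀ : Set (ι → ℝ)} (hB₀ : MeasurableSet B₀) :
    P⟦e t ⁻¹' B₀ ∩ ⋂ s ∈ (Finset.range T).erase t, e s ⁻¹' B s | ℱ⟧ =ᵐ[P]
      fun ω => (P⟦⋂ s ∈ (Finset.range T).erase t, e s ⁻¹' B s | ℱ⟧) ω
        * (P⟦e t ⁻¹' B₀ | ℱ⟧) ω := by
  have htm : t ∈ Finset.range T := Finset.mem_range.2 ht
  have key : ∀ D : Set (ι → ℝ), MeasurableSet D →
      P⟦e t ⁻¹' D ∩ ⋂ s ∈ (Finset.range T).erase t, e s ⁻¹' B s | ℱ⟧ =ᵐ[P]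
      fun ω => (P⟦e t ⁻¹' D | ℱ⟧) ω *
        ∏ s ∈ (Finset.range T).erase t, (P⟦e s ⁻¹' B s | ℱ⟧) ω := by
    intro D hD
    have h := hci (Function.update B t D) (fun s => by
      by_cases hs : s = t
      · subst hs; simpa using hD
      · simpa [hs] using hB s)
    have hset : (⋂ s ∈ Finset.range T, e s ⁻¹' Function.update B t D s)
        = e t ⁻¹' D ∩ ⋂ s ∈ (Finset.range T).erase t, e s ⁻¹' B s := by
      conv_lhs => rw [← Finset.insert_erase htm]
      rw [Finset.set_biInter_insert, Function.update_self]
      congr 1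
      refine Set.iInter₂_congr fun s hs => ?_
      rw [Function.update_of_ne (Finset.ne_of_mem_erase hs)]
    rw [hset] at h
    refine h.trans (Eventually.of_forall fun ω => ?_)
    dsimp only
    rw [← Finset.mul_prod_erase _ _ htm, Function.update_self]
    congr 1
    refine Finset.prod_congr rfl fun s hs => ?_
    rw [Function.update_of_ne (Finset.ne_of_mem_erase hs)]
  -- without a restriction on `e t` this gives the conditional probability of the other factor
  have huniv := key Set.univ MeasurableSet.univ
  simp only [Set.preimage_univ, Set.univ_inter, Set.indicator_univ] at huniv
  rw [condExp_const hℱ] at huniv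
  filter_upwards [key B₀ hB₀, huniv] with ω h1 h2
  rw [h1, h2]
  ring

include hℱ he hint hci hmean in
theorem setIntegral_rectangle_eq_zero [Fintype ι] {t : ℕ} (ht : t < T) (i : ι) {B : ℕ → Set (ι → ℝ)}
    (hB : ∀ s, MeasurableSet (B s)) {G : Set Ω} (hG : MeasurableSet[ℱ] G) :
    ∫ ω in G ∩ ⋂ s ∈ (Finset.range T).erase t, e s ⁻¹' B s, e t ω i ∂P = 0 := by
  set C := ⋂ s ∈ (Finset.range T).erase t, e s ⁻¹' B s with hCdef
  have hC : MeasurableSet C := Finset.measurableSet_biInter _ fun s hs =>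
    he s (Finset.mem_range.1 (Finset.mem_of_mem_erase hs)) (hB s)
  have hGm := hℱ _ hG
  set h : Ω → ℝ := P⟦C | ℱ⟧ with hh
  have hhm : StronglyMeasurable[ℱ] h := stronglyMeasurable_condExp
  have hhM : Measurable h := (hhm.mono hℱ).measurable
  have hb := condExp_indicator_one_bound (P := P) (ℱ := ℱ) C hC
  have hbn : ∀ᵐ ω ∂P, ‖h ω‖ ≤ 1 := by
    filter_upwards [hb] with ω hω
    rw [Real.norm_of_nonneg hω.1]; exact hω.2
  -- the laws of `e t` under `1_G 1_C P` and under `1_G P(C | ℱ) P` agree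
  have hlaw : (P.restrict (G ∩ C)).map (e t)
      = ((P.restrict G).withDensity fun ω => ENNReal.ofReal (h ω)).map (e t) := by
    refine Measure.ext fun D hD => ?_
    have hDm : MeasurableSet (e t ⁻¹' D) := he t ht hD
    rw [Measure.map_apply (he t ht) hD, Measure.map_apply (he t ht) hD,
      Measure.restrict_apply hDm, withDensity_apply _ hDm, Measure.restrict_restrict hDm]
    have hint1 : Integrable ((e t ⁻¹' D).indicator fun _ => (1 : ℝ)) P :=
      (integrable_const (1 : ℝ)).indicator hDm
    have e1 : ∫ ω in G, ((e t ⁻¹' D) ∩ C).indicator (fun _ => (1 : ℝ)) ω ∂P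
        = ∫ ω in G, h ω * (e t ⁻¹' D).indicator (fun _ => (1 : ℝ)) ω ∂P := by
      rw [← setIntegral_condExp_mul hℱ hint1 hC hG,
        ← setIntegral_condExp hℱ ((integrable_const (1 : ℝ)).indicator (hDm.inter hC)) hG]
      exact setIntegral_congr_ae hGm
        ((condExp_inter_of_serial hℱ hci ht hB hD).mono fun ω hω _ => hω)
    have e2 : ∫ ω in G, h ω * (e t ⁻¹' D).indicator (fun _ => (1 : ℝ)) ω ∂P
        = ∫ ω in e t ⁻¹' D ∩ G, h ω ∂P := by
      rw [Set.inter_comm, ← setIntegral_indicator hDm]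
      refine integral_congr_ae (Eventually.of_forall fun ω => ?_)
      by_cases hω : ω ∈ e t ⁻¹' D <;> simp [Set.indicator, hω]
    rw [← ofReal_integral_eq_lintegral_ofReal integrable_condExp.integrableOn
      (ae_restrict_of_ae (hb.mono fun ω hω => hω.1)), ← e2, ← e1,
      setIntegral_indicator (hDm.inter hC), setIntegral_const, smul_eq_mul, mul_one,
      ofReal_measureReal]
    congr 1
    ext ω; simp only [Set.mem_inter_iff]; tauto
  have hev : StronglyMeasurable fun x : ι → ℝ => x i := (measurable_pi_apply i).stronglyMeasurable
  calc ∫ ω in G ∩ C, e t ω i ∂P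
      = ∫ x, x i ∂((P.restrict (G ∩ C)).map (e t)) := by
        rw [integral_map (he t ht).aemeasurable hev.aestronglyMeasurable]
    _ = ∫ ω, e t ω i ∂((P.restrict G).withDensity fun ω => ENNReal.ofReal (h ω)) := by
        rw [hlaw, integral_map (he t ht).aemeasurable hev.aestronglyMeasurable]
    _ = ∫ ω in G, h ω * e t ω i ∂P := by
        rw [integral_withDensity_eq_integral_toReal_smul hhM.ennreal_ofReal
          (Eventually.of_forall fun _ => ENNReal.ofReal_lt_top)]
        refine integral_congr_ae (ae_restrict_of_ae (hb.mono fun ω hω => ?_))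
        simp only [smul_eq_mul]
        rw [ENNReal.toReal_ofReal hω.1]
    _ = ∫ ω in G, h ω * (P[fun ω => e t ω i | ℱ]) ω ∂P :=
        (setIntegral_condExp_mul hℱ (hint t ht i) hC hG).symm
    _ = 0 := by
        rw [setIntegral_congr_ae hGm (g := fun _ => (0 : ℝ))
          ((hmean t ht i).mono fun ω hω _ => by rw [hω]; simp)]
        simp

include hℱ he hint hci hmean in
/-- Each error has mean zero given the factors and the errors of all other periods. -/
theorem condExp_otherSigma_eq_zero [Fintype ι] {t : ℕ} (ht : t < T) (i : ι) :
    P[fun ω => e t ω i | otherSigma ℱ e T t] =ᵐ[P] 0 := by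
  have hle := otherSigma_le hℱ he t
  -- sets that restrict the factors and each error vector separately generate the sigma-algebra
  let π : Set (Set Ω) := {A | ∃ G : Set Ω, MeasurableSet[ℱ] G ∧ ∃ B : ℕ → Set (ι → ℝ),
    (∀ s, MeasurableSet (B s)) ∧ A = G ∩ ⋂ s ∈ (Finset.range T).erase t, e s ⁻¹' B s}
  have hπ : IsPiSystem π := by
    rintro _ ⟨G, hG, B, hB, rfl⟩ _ ⟨G', hG', B', hB', rfl⟩ -
    refine ⟨G ∩ G', hG.inter hG', fun s => B s ∩ B' s, fun s => (hB s).inter (hB' s), ?_⟩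
    ext ω
    simp only [Set.mem_inter_iff, Set.mem_iInter, Set.mem_preimage]
    constructor
    · rintro ⟨⟨h1, h2⟩, h3, h4⟩; exact ⟨⟨h1, h3⟩, fun s hs => ⟨h2 s hs, h4 s hs⟩⟩
    · rintro ⟨⟨h1, h3⟩, h2⟩; exact ⟨⟨h1, fun s hs => (h2 s hs).1⟩, h3, fun s hs => (h2 s hs).2⟩
  have hgen : otherSigma ℱ e T t = MeasurableSpace.generateFrom π := by
    apply le_antisymm
    · refine sup_le (fun G hG => ?_) (iSup₂_le fun s hs => ?_)
      · refine MeasurableSpace.measurableSet_generateFrom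
          ⟨G, hG, fun _ => Set.univ, fun _ => MeasurableSet.univ, by simp⟩
      · rintro _ ⟨D, hD, rfl⟩
        refine MeasurableSpace.measurableSet_generateFrom
          ⟨Set.univ, MeasurableSet.univ, Function.update (fun _ => Set.univ) s D, fun s' => ?_, ?_⟩
        · by_cases h : s' = s
          · subst h; simpa using hD
          · simp [h]
        · ext ω
          simp only [Set.mem_preimage, Set.mem_inter_iff, Set.mem_univ, true_and, Set.mem_iInter]
          constructor
          · intro hω s' _
            by_cases h : s' = s
            · subst h; simpa using hω
            · simp [h]
          · intro hω
            simpa using hω s hs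
    · refine MeasurableSpace.generateFrom_le ?_
      rintro _ ⟨G, hG, B, hB, rfl⟩
      refine MeasurableSet.inter (le_sup_left (a := ℱ) _ hG) ?_
      refine Finset.measurableSet_biInter _ fun s hs => ?_
      exact le_sup_right (a := ℱ) _ (le_iSup₂ (f := fun s (_ : s ∈ (Finset.range T).erase t) =>
        MeasurableSpace.comap (e s) inferInstance) s hs _ ⟨B s, hB s, rfl⟩)
  have huniv : ∫ ω, e t ω i ∂P = 0 := by
    have := setIntegral_rectangle_eq_zero hℱ he hint hci hmean ht i
      (B := fun _ => Set.univ) (fun _ => MeasurableSet.univ) (G := Set.univ) MeasurableSet.univ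
    simpa using this
  have hzero : ∀ A, MeasurableSet[otherSigma ℱ e T t] A → ∫ ω in A, e t ω i ∂P = 0 := by
    intro A hA
    induction A, hA using MeasurableSpace.induction_on_inter hgen hπ with
    | empty => simp
    | basic A hA =>
      obtain ⟨G, hG, B, hB, rfl⟩ := hA
      exact setIntegral_rectangle_eq_zero hℱ he hint hci hmean ht i hB hG
    | compl A hA ih =>
      have := integral_add_compl (hle _ hA) (hint t ht i)
      rw [ih, huniv] at this
      linarith
    | iUnion f hd hf ih =>
      have := hasSum_integral_iUnion (fun k => hle _ (hf k)) hd (hint t ht i).integrableOn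
      rw [← this.tsum_eq]
      simp [ih]
  refine (ae_eq_condExp_of_forall_setIntegral_eq hle (hint t ht i) (fun A _ _ => integrableOn_zero)
    (fun A hA _ => ?_) aestronglyMeasurable_zero).symm
  rw [hzero A hA]
  simp

end SerialIndependence

/-- Pulling out measurable factors from a finite sum of which only the total is known to be
integrable: the factors are bounded on an exhausting sequence of events. -/
theorem integral_sum_mul_eq_zero [Fintype ι] (hm : ℱ ≤ mΩ) {x g : ι → Ω → ℝ}
    (hx : ∀ i, Integrable (x i) P) (hx0 : ∀ i, P[x i | ℱ] =ᵐ[P] 0) (hg : ∀ i, Measurable[ℱ] (g i))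
    (hint : Integrable (fun ω => ∑ i, x i ω * g i ω) P) :
    ∫ ω, ∑ i, x i ω * g i ω ∂P = 0 := by
  let A : ℕ → Set Ω := fun M => ⋂ i, {ω | |g i ω| ≤ M}
  have hA : ∀ M, MeasurableSet[ℱ] (A M) := fun M =>
    MeasurableSet.iInter fun i => (measurable_abs.comp (hg i)) measurableSet_Iic
  have hmono : Monotone A := fun M M' h =>
    Set.iInter_mono fun i ω (hω : |g i ω| ≤ M) => hω.trans (Nat.cast_le.2 h)
  have hU : ⋃ M, A M = Set.univ := by
    refine Set.eq_univ_of_forall fun ω => ?_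
    obtain ⟨M, hM⟩ := exists_nat_ge (∑ i, |g i ω|)
    refine Set.mem_iUnion.2 ⟨M, Set.mem_iInter.2 fun i => ?_⟩
    exact (Finset.single_le_sum (f := fun i => |g i ω|) (fun i _ => abs_nonneg _)
      (Finset.mem_univ i)).trans hM
  have h0 : ∀ M, ∫ ω in A M, ∑ i, x i ω * g i ω ∂P = 0 := by
    intro M
    have hgi : ∀ i, StronglyMeasurable[ℱ] ((A M).indicator (g i)) := fun i =>
      ((hg i).indicator (hA M)).stronglyMeasurable
    have hbd : ∀ i, ∀ᵐ ω ∂P, ‖(A M).indicator (g i) ω‖ ≤ M := fun i =>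
      Eventually.of_forall fun ω => by
        by_cases hω : ω ∈ A M
        · rw [Set.indicator_of_mem hω]; exact Set.mem_iInter.1 hω i
        · rw [Set.indicator_of_notMem hω]; simp
    have hii : ∀ i, Integrable ((A M).indicator (g i) * x i) P := fun i =>
      (hx i).bdd_mul ((hgi i).mono hm).aestronglyMeasurable (hbd i)
    rw [← integral_indicator (hm _ (hA M))]
    have hrw : (A M).indicator (fun ω => ∑ i, x i ω * g i ω)
        = fun ω => ∑ i, ((A M).indicator (g i) * x i) ω := by
      funext ω
      by_cases hω : ω ∈ A M
      · simp [hω, mul_comm]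
      · simp [hω]
    rw [hrw, integral_finsetSum _ fun i _ => hii i]
    refine Finset.sum_eq_zero fun i _ => ?_
    rw [← integral_condExp hm, integral_congr_ae
      ((condExp_stronglyMeasurable_mul_of_bound hm (hgi i) (hx i) M (hbd i)).trans
        ((hx0 i).mono fun ω hω => show _ = (0 : ℝ) by simp [hω]))]
    simp
  have hlim := tendsto_setIntegral_of_monotone (f := fun ω => ∑ i, x i ω * g i ω) (μ := P)
    (fun M => hm _ (hA M)) hmono (by rw [hU]; exact hint.integrableOn)
  rw [hU, setIntegral_univ] at hlim
  refine tendsto_nhds_unique hlim ?_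
  simp [h0]

omit [IsProbabilityMeasure P] in
/-- Second moment of a sum of random variables, each of which is orthogonal to all but at most two
of them, itself included. -/
theorem integral_sq_sum_le {J : Type*} [DecidableEq J] (s : Finset J) (τ : J → J)
    {Z : J → Ω → ℝ} {K : ℝ} (hZ : ∀ α ∈ s, MemLp (Z α) 2 P)
    (hK : ∀ α ∈ s, ∫ ω, Z α ω ^ 2 ∂P ≤ K)
    (horth : ∀ α ∈ s, ∀ β ∈ s, β ≠ α → β ≠ τ α → ∫ ω, Z α ω * Z β ω ∂P = 0) :
    Integrable (fun ω => (∑ α ∈ s, Z α ω) ^ 2) P ∧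
      ∫ ω, (∑ α ∈ s, Z α ω) ^ 2 ∂P ≤ 2 * K * s.card := by
  rcases s.eq_empty_or_nonempty with rfl | ⟨α₀, hα₀⟩
  · simp
  have hK0 : 0 ≤ K := (integral_nonneg fun ω => sq_nonneg _).trans (hK α₀ hα₀)
  have hint : ∀ α ∈ s, ∀ β ∈ s, Integrable (fun ω => Z α ω * Z β ω) P := fun α hα β hβ =>
    (hZ α hα).integrable_mul (hZ β hβ)
  refine ⟨(memLp_finsetSum s hZ).integrable_sq, ?_⟩
  have hpair : ∀ α ∈ s, ∀ β ∈ s, ∫ ω, Z α ω * Z β ω ∂P ≤ K := by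
    intro α hα β hβ
    calc ∫ ω, Z α ω * Z β ω ∂P ≤ ∫ ω, (1 / 2 * Z α ω ^ 2 + 1 / 2 * Z β ω ^ 2) ∂P := by
          refine integral_mono (hint α hα β hβ)
            (((hZ α hα).integrable_sq.const_mul _).add ((hZ β hβ).integrable_sq.const_mul _))
            fun ω => ?_
          dsimp only
          nlinarith [sq_nonneg (Z α ω - Z β ω)]
      _ = 1 / 2 * ∫ ω, Z α ω ^ 2 ∂P + 1 / 2 * ∫ ω, Z β ω ^ 2 ∂P := by
          rw [integral_add ((hZ α hα).integrable_sq.const_mul _)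
            ((hZ β hβ).integrable_sq.const_mul _), integral_const_mul, integral_const_mul]
      _ ≤ K := by linarith [hK α hα, hK β hβ]
  have hexp : ∫ ω, (∑ α ∈ s, Z α ω) ^ 2 ∂P = ∑ α ∈ s, ∑ β ∈ s, ∫ ω, Z α ω * Z β ω ∂P := by
    simp_rw [sq, Finset.sum_mul_sum]
    rw [integral_finsetSum _ fun α hα => integrable_finsetSum _ fun β hβ => hint α hα β hβ]
    exact Finset.sum_congr rfl fun α hα => integral_finsetSum _ fun β hβ => hint α hα β hβ
  rw [hexp]
  have hrow : ∀ α ∈ s, ∑ β ∈ s, ∫ ω, Z α ω * Z β ω ∂P ≤ 2 * K := by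
    intro α hα
    calc ∑ β ∈ s, ∫ ω, Z α ω * Z β ω ∂P
        ≤ ∑ β ∈ s, ((if α = β then K else 0) + if τ α = β then K else 0) := by
          refine Finset.sum_le_sum fun β hβ => ?_
          by_cases h1 : α = β
          · rw [if_pos h1]
            have := hpair α hα β hβ
            split_ifs <;> linarith
          · by_cases h2 : τ α = β
            · rw [if_neg h1, if_pos h2, zero_add]; exact hpair α hα β hβ
            · rw [if_neg h1, if_neg h2, horth α hα β hβ (Ne.symm h1) (Ne.symm h2)]; simp
      _ ≤ 2 * K := by
          rw [Finset.sum_add_distrib, Finset.sum_ite_eq, Finset.sum_ite_eq, if_pos hα]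
          split_ifs <;> linarith
  calc _ ≤ ∑ α ∈ s, 2 * K := Finset.sum_le_sum hrow
    _ = 2 * K * s.card := by rw [Finset.sum_const, nsmul_eq_mul]; ring

end Conditional

/-! ### Stochastic orders of the cross-sectional sums -/

namespace Sample

variable {k₁ k₂ kv : ℕ} {Ω : Type*}

/-- The factors, extended by the constant `1`. -/
def fext (S : Sample k₁ k₂ kv Ω) (o : Option (FIdx k₁ k₂)) (t : ℕ) (ω : Ω) : ℝ :=
  o.elim 1 fun a => S.F t ω a

/-- The average of a factor over a set of periods. -/
noncomputable def fmean (S : Sample k₁ k₂ kv Ω) (I : Finset ℕ) (a : FIdx k₁ k₂) (ω : Ω) : ℝ :=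
  (I.card : ℝ)⁻¹ * ∑ s ∈ I, S.F s ω a

theorem Fdem_apply (S : Sample k₁ k₂ kv Ω) (I : Finset ℕ) (t : ℕ) (ω : Ω) (a : FIdx k₁ k₂) :
    S.Fdem I t ω a = S.fext (some a) t ω - S.fmean I a ω := by
  simp [Fdem, fext, fmean]

theorem rho_comm (S : Sample k₁ k₂ kv Ω) (N t s : ℕ) (ω : Ω) : S.rho N t s ω = S.rho N s t ω := by
  simp only [rho, mul_comm]

theorem rho_eq_sum_fin (S : Sample k₁ k₂ kv Ω) (N s t : ℕ) (ω : Ω) :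
    S.rho N s t ω = ∑ i : Fin N, S.errVec N t ω i * ((√(N : ℝ))⁻¹ * S.errVec N s ω i) := by
  rw [rho, Finset.sum_range, Finset.mul_sum]
  exact Finset.sum_congr rfl fun i _ => by simp only [errVec]; ring

theorem wAvg_apply (S : Sample k₁ k₂ kv Ω) (N T t : ℕ) (ω : Ω) (b : GIdx k₁ k₂ kv) :
    S.wAvg N T t ω b = (√(N : ℝ))⁻¹ * ∑ i ∈ Finset.range N, S.e i t ω * S.gam T i b := by
  simp [wAvg]

theorem wAvg_eq_sum_fin (S : Sample k₁ k₂ kv Ω) (N T t : ℕ) (ω : Ω) (b : GIdx k₁ k₂ kv) :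
    S.wAvg N T t ω b = ∑ i : Fin N, S.errVec N t ω i * ((√(N : ℝ))⁻¹ * S.gam T i b) := by
  rw [wAvg_apply, Finset.sum_range, Finset.mul_sum]
  exact Finset.sum_congr rfl fun i _ => by simp only [errVec]; ring

theorem fext_pow_four_le (S : Sample k₁ k₂ kv Ω) (o : Option (FIdx k₁ k₂)) (t : ℕ) (ω : Ω) :
    S.fext o t ω ^ 4 ≤ 1 + ‖S.F t ω‖ ^ 4 := by
  rcases o with _ | a
  · simp [fext]
  · have h := PiLp.norm_apply_le (S.F t ω) a
    have h2 := pow_le_pow_left₀ (norm_nonneg _) h 4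
    rw [Real.norm_eq_abs, Even.pow_abs (by decide)] at h2
    simpa [fext] using h2.trans (by linarith)

theorem fext_sq_le (S : Sample k₁ k₂ kv Ω) (o : Option (FIdx k₁ k₂)) (t : ℕ) (ω : Ω) :
    S.fext o t ω ^ 2 ≤ 1 + ‖S.F t ω‖ ^ 2 := by
  rcases o with _ | a
  · simp [fext]
  · have h := PiLp.norm_apply_le (S.F t ω) a
    have h2 := pow_le_pow_left₀ (norm_nonneg _) h 2
    rw [Real.norm_eq_abs, sq_abs] at h2
    simpa [fext] using h2.trans (by linarith)

theorem measurable_F_factorSigma (S : Sample k₁ k₂ kv Ω) {T t : ℕ} (ht : t < T) :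
    Measurable[S.factorSigma T] (S.F t) := by
  refine Measurable.of_comap_le (le_trans le_sup_left
    (le_iSup₂ (f := fun t (_ : t ∈ Finset.range T) =>
      MeasurableSpace.comap (S.F t) inferInstance ⊔ MeasurableSpace.comap (S.v t) inferInstance)
      t (Finset.mem_range.2 ht)))

theorem measurable_fext_factorSigma (S : Sample k₁ k₂ kv Ω) {T t : ℕ} (ht : t < T)
    (o : Option (FIdx k₁ k₂)) : Measurable[S.factorSigma T] (S.fext o t) := by
  rcases o with _ | a
  · exact measurable_const
  · have : Measurable fun x : EuclideanSpace ℝ (FIdx k₁ k₂) => x a := by fun_prop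
    exact this.comp (S.measurable_F_factorSigma ht)

theorem measurable_errVec_otherSigma (S : Sample k₁ k₂ kv Ω) {ℱ : MeasurableSpace Ω}
    {N T s t : ℕ} (hs : s < T) (hst : s ≠ t) (i : Fin N) :
    Measurable[otherSigma ℱ (S.errVec N) T t] fun ω => S.errVec N s ω i := by
  have h : Measurable[otherSigma ℱ (S.errVec N) T t] (S.errVec N s) :=
    Measurable.of_comap_le (le_trans (le_iSup₂ (f := fun s
      (_ : s ∈ (Finset.range T).erase t) => MeasurableSpace.comap (S.errVec N s) inferInstance)
      s (Finset.mem_erase.2 ⟨hst, Finset.mem_range.2 hs⟩)) le_sup_right)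
  exact (measurable_pi_apply i).comp h

theorem measurable_rho_otherSigma (S : Sample k₁ k₂ kv Ω) {ℱ : MeasurableSpace Ω}
    {N T s s' t : ℕ} (hs : s < T) (hst : s ≠ t) (hs' : s' < T) (hst' : s' ≠ t) :
    Measurable[otherSigma ℱ (S.errVec N) T t] (S.rho N s s') := by
  have : S.rho N s s' = fun ω =>
      ∑ i : Fin N, S.errVec N s' ω i * ((√(N : ℝ))⁻¹ * S.errVec N s ω i) :=
    funext fun ω => S.rho_eq_sum_fin N s s' ω
  rw [this]
  exact Finset.measurable_fun_sum _ fun i _ => (S.measurable_errVec_otherSigma hs' hst' i).mul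
    ((S.measurable_errVec_otherSigma hs hst i).const_mul _)

theorem measurable_wAvg_otherSigma (S : Sample k₁ k₂ kv Ω) {ℱ : MeasurableSpace Ω}
    {N T s t : ℕ} (hs : s < T) (hst : s ≠ t) (b : GIdx k₁ k₂ kv) :
    Measurable[otherSigma ℱ (S.errVec N) T t] fun ω => S.wAvg N T s ω b := by
  simp_rw [wAvg_eq_sum_fin]
  exact Finset.measurable_fun_sum _ fun i _ =>
    (S.measurable_errVec_otherSigma hs hst i).mul_const _

end Sample

section Orders

variable {k₁ k₂ kv : ℕ} {Ω : ℕ × ℕ → Type*} [∀ p, MeasurableSpace (Ω p)]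
  {P : ∀ p, Measure (Ω p)} [∀ p, IsProbabilityMeasure (P p)] {S : ∀ p, Sample k₁ k₂ kv (Ω p)}
  {SigSF : Matrix (FIdx k₁ k₂) (FIdx k₁ k₂) ℝ}

omit [∀ p, IsProbabilityMeasure (P p)] in
theorem PricingModel.factorSigma_le (hM : PricingModel P S) (p : ℕ × ℕ) :
    (S p).factorSigma p.2 ≤ ‹∀ p, MeasurableSpace (Ω p)› p :=
  iSup₂_le fun t ht => sup_le (hM.measurable_F p t (Finset.mem_range.1 ht)).comap_le
    (hM.measurable_v p t (Finset.mem_range.1 ht)).comap_le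

omit [∀ p, IsProbabilityMeasure (P p)] in
theorem PricingModel.measurable_errVec (hM : PricingModel P S) (p : ℕ × ℕ) {t : ℕ} (ht : t < p.2) :
    Measurable ((S p).errVec p.1 t) :=
  measurable_pi_lambda _ fun i => hM.measurable_e p i i.2 t ht

omit [∀ p, IsProbabilityMeasure (P p)] in
theorem PricingModel.measurable_fext (hM : PricingModel P S) (p : ℕ × ℕ) {t : ℕ} (ht : t < p.2)
    (o : Option (FIdx k₁ k₂)) : Measurable ((S p).fext o t) :=
  ((S p).measurable_fext_factorSigma ht o).mono (hM.factorSigma_le p) le_rfl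

omit [∀ p, IsProbabilityMeasure (P p)] in
theorem PricingModel.measurable_rho (hM : PricingModel P S) (p : ℕ × ℕ) {s t : ℕ} (hs : s < p.2)
    (ht : t < p.2) : Measurable ((S p).rho p.1 s t) :=
  (Finset.measurable_fun_sum _ fun i hi =>
    (hM.measurable_e p i (Finset.mem_range.1 hi) s hs).mul
      (hM.measurable_e p i (Finset.mem_range.1 hi) t ht)).const_mul _

omit [∀ p, IsProbabilityMeasure (P p)] in
theorem PricingModel.measurable_wAvg (hM : PricingModel P S) (p : ℕ × ℕ) {t : ℕ} (ht : t < p.2)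
    (b : GIdx k₁ k₂ kv) : Measurable fun ω => (S p).wAvg p.1 p.2 t ω b := by
  simp_rw [Sample.wAvg_apply]
  exact (Finset.measurable_fun_sum _ fun i hi =>
    (hM.measurable_e p i (Finset.mem_range.1 hi) t ht).mul_const _).const_mul _

variable (hM : PricingModel P S) (hE : Errors P S SigSF)

include hM hE in
/-- A sum that is linear in the errors of period `t`, with coefficients that depend on the factors
and on the errors of other periods, has mean zero. -/
theorem integral_linear_errVec_eq_zero (p : ℕ × ℕ) {t : ℕ} (ht : t < p.2) {g : Fin p.1 → Ω p → ℝ}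
    (hg : ∀ i, Measurable[otherSigma ((S p).factorSigma p.2) ((S p).errVec p.1) p.2 t] (g i))
    (hint : Integrable (fun ω => ∑ i, (S p).errVec p.1 t ω i * g i ω) (P p)) :
    ∫ ω, ∑ i, (S p).errVec p.1 t ω i * g i ω ∂(P p) = 0 := by
  have hℱ := hM.factorSigma_le p
  have he : ∀ t < p.2, Measurable ((S p).errVec p.1 t) := fun t ht => hM.measurable_errVec p ht
  have hi : ∀ t < p.2, ∀ i, Integrable (fun ω => (S p).errVec p.1 t ω i) (P p) := fun t ht i =>
    (hM.memLp_e p i i.2 t ht).integrable (by norm_num)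
  exact integral_sum_mul_eq_zero (otherSigma_le hℱ he t) (fun i => hi t ht i)
    (fun i => condExp_otherSigma_eq_zero hℱ he hi (hE.condIndep p)
      (fun t ht i => hE.condMean p i i.2 t ht) ht i) hg hint

/-- The products `f_s g_t ρ(s, t)`, where `f` and `g` are factors or the constant `1`. -/
noncomputable def rhoTerm (S : ∀ p, Sample k₁ k₂ kv (Ω p)) (o o' : Option (FIdx k₁ k₂)) (p : ℕ × ℕ)
    (st : ℕ × ℕ) (ω : Ω p) : ℝ :=
  (S p).fext o st.1 ω * (S p).fext o' st.2 ω * (S p).rho p.1 st.1 st.2 ω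

omit [∀ p, IsProbabilityMeasure (P p)] in
include hM hE in
/-- By `2 x² y² ≤ x⁴ + y⁴`, moments that pair one fourth power with `ρ(s, t)²` suffice. -/
theorem exists_memLp_rhoTerm : ∃ C : ℝ, ∀ (o o' : Option (FIdx k₁ k₂)) (p : ℕ × ℕ) (st : ℕ × ℕ),
    st.1 < p.2 → st.2 < p.2 → st.1 ≠ st.2 →
      MemLp (rhoTerm S o o' p st) 2 (P p) ∧ ∫ ω, rhoTerm S o o' p st ω ^ 2 ∂(P p) ≤ C := by
  obtain ⟨C, hC⟩ := hE.rho_bound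
  refine ⟨C, fun o o' p ⟨s, t⟩ hs ht hst => ?_⟩
  dsimp only at hs ht hst
  have h1 := hC p t ht s hs hst
  have h2 := hC p s hs t ht hst.symm
  have hmeas : Measurable (rhoTerm S o o' p (s, t)) :=
    ((hM.measurable_fext p hs o).mul (hM.measurable_fext p ht o')).mul (hM.measurable_rho p hs ht)
  have hle : ∀ ω, rhoTerm S o o' p (s, t) ω ^ 2 ≤
      1 / 2 * ((1 + ‖(S p).F t ω‖ ^ 4) * ((S p).rho p.1 s t ω ^ 2 + 1))
        + 1 / 2 * ((1 + ‖(S p).F s ω‖ ^ 4) * ((S p).rho p.1 t s ω ^ 2 + 1)) := by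
    intro ω
    rw [(S p).rho_comm p.1 t s]
    have e1 := (S p).fext_pow_four_le o s ω
    have e2 := (S p).fext_pow_four_le o' t ω
    simp only [rhoTerm]
    set x := (S p).fext o s ω
    set y := (S p).fext o' t ω
    set r := (S p).rho p.1 s t ω
    set a := ‖(S p).F s ω‖ ^ 4 with ha
    set b := ‖(S p).F t ω‖ ^ 4 with hb
    have ha0 : 0 ≤ a := by positivity
    have hb0 : 0 ≤ b := by positivity
    have h3 : x ^ 2 * y ^ 2 ≤ 1 / 2 * (x ^ 4 + y ^ 4) := by nlinarith [sq_nonneg (x ^ 2 - y ^ 2)]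
    have h4 : x ^ 2 * y ^ 2 * r ^ 2 ≤ (1 / 2 * ((1 + a) + (1 + b))) * r ^ 2 :=
      mul_le_mul_of_nonneg_right (by linarith) (sq_nonneg r)
    nlinarith
  have hint2 : Integrable (fun ω =>
      1 / 2 * ((1 + ‖(S p).F t ω‖ ^ 4) * ((S p).rho p.1 s t ω ^ 2 + 1))
        + 1 / 2 * ((1 + ‖(S p).F s ω‖ ^ 4) * ((S p).rho p.1 t s ω ^ 2 + 1))) (P p) :=
    (h1.1.const_mul _).add (h2.1.const_mul _)
  have hsq : Integrable (fun ω => rhoTerm S o o' p (s, t) ω ^ 2) (P p) :=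
    hint2.mono' (hmeas.pow_const 2).aestronglyMeasurable (Eventually.of_forall fun ω => by
      rw [Real.norm_of_nonneg (sq_nonneg _)]; exact hle ω)
  refine ⟨(memLp_two_iff_integrable_sq hmeas.aestronglyMeasurable).2 hsq, ?_⟩
  refine (integral_mono hsq hint2 hle).trans ?_
  rw [integral_add (h1.1.const_mul _) (h2.1.const_mul _), integral_const_mul, integral_const_mul]
  linarith [h1.2, h2.2]

include hM hE in
/-- The period `t` occurs only once, so that the expression is linear in the errors of that
period. -/
theorem integral_rhoTerm_mul_eq_zero_of_notMem (p : ℕ × ℕ)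
    {s t s' t' : ℕ} (hs : s < p.2) (ht : t < p.2) (hs' : s' < p.2) (ht' : t' < p.2)
    {φ φ' : Ω p → ℝ} (hφ : Measurable[(S p).factorSigma p.2] φ)
    (hφ' : Measurable[(S p).factorSigma p.2] φ')
    (h1 : s ≠ t) (h2 : s' ≠ t) (h3 : t' ≠ t)
    (hint : Integrable (fun ω => (φ ω * (S p).rho p.1 s t ω) * (φ' ω * (S p).rho p.1 s' t' ω))
      (P p)) :
    ∫ ω, (φ ω * (S p).rho p.1 s t ω) * (φ' ω * (S p).rho p.1 s' t' ω) ∂(P p) = 0 := by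
  let g : Fin p.1 → Ω p → ℝ := fun i ω =>
    (√(p.1 : ℝ))⁻¹ * (S p).errVec p.1 s ω i * φ ω * (φ' ω * (S p).rho p.1 s' t' ω)
  have hrw : (fun ω => (φ ω * (S p).rho p.1 s t ω) * (φ' ω * (S p).rho p.1 s' t' ω))
      = fun ω => ∑ i, (S p).errVec p.1 t ω i * g i ω := by
    funext ω
    rw [(S p).rho_eq_sum_fin p.1 s t, Finset.mul_sum, Finset.sum_mul]
    exact Finset.sum_congr rfl fun i _ => by simp only [g]; ring
  rw [hrw] at hint ⊢
  refine integral_linear_errVec_eq_zero hM hE p ht (fun i => ?_) hint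
  have hle : (S p).factorSigma p.2 ≤
      otherSigma ((S p).factorSigma p.2) ((S p).errVec p.1) p.2 t := le_sup_left
  exact ((((S p).measurable_errVec_otherSigma hs h1 i).const_mul _).mul
    (hφ.mono hle le_rfl)).mul ((hφ'.mono hle le_rfl).mul
      ((S p).measurable_rho_otherSigma hs' h2 ht' h3))

include hM hE in
/-- Terms `f_s g_t ρ(s, t)` for different unordered pairs of periods are orthogonal. -/
theorem integral_rhoTerm_mul_rhoTerm (o o' : Option (FIdx k₁ k₂)) (p : ℕ × ℕ) {st uv : ℕ × ℕ}
    (hst : st.1 < p.2 ∧ st.2 < p.2 ∧ st.1 ≠ st.2) (huv : uv.1 < p.2 ∧ uv.2 < p.2 ∧ uv.1 ≠ uv.2)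
    (hne : uv ≠ st) (hswap : uv ≠ st.swap) :
    ∫ ω, rhoTerm S o o' p st ω * rhoTerm S o o' p uv ω ∂(P p) = 0 := by
  obtain ⟨s, t⟩ := st
  obtain ⟨u, v⟩ := uv
  obtain ⟨C, hC⟩ := exists_memLp_rhoTerm hM hE
  have hint : Integrable (fun ω => rhoTerm S o o' p (s, t) ω * rhoTerm S o o' p (u, v) ω) (P p) :=
    (hC o o' p (s, t) hst.1 hst.2.1 hst.2.2).1.integrable_mul
      (hC o o' p (u, v) huv.1 huv.2.1 huv.2.2).1
  obtain ⟨hs, ht, hst⟩ := hst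
  obtain ⟨hu, hv, huv⟩ := huv
  dsimp only at *
  have hφ : ∀ {a b : ℕ}, a < p.2 → b < p.2 →
      Measurable[(S p).factorSigma p.2] fun ω => (S p).fext o a ω * (S p).fext o' b ω :=
    fun ha hb => ((S p).measurable_fext_factorSigma ha o).mul
      ((S p).measurable_fext_factorSigma hb o')
  -- one of the periods `s`, `t` does not occur among `u`, `v`
  by_cases h : u ≠ t ∧ v ≠ t
  · exact integral_rhoTerm_mul_eq_zero_of_notMem hM hE p hs ht hu hv
      (hφ hs ht) (hφ hu hv) hst h.1 h.2 hint
  · have h' : u ≠ s ∧ v ≠ s := by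
      constructor
      · rintro rfl
        by_cases hvt : v = t
        · subst hvt; exact hne rfl
        · exact h ⟨hst, hvt⟩
      · rintro rfl
        by_cases hut : u = t
        · subst hut; exact hswap rfl
        · exact h ⟨hut, hst⟩
    simp only [rhoTerm, (S p).rho_comm p.1 s t] at hint ⊢
    exact integral_rhoTerm_mul_eq_zero_of_notMem hM hE p ht hs hu hv
      (hφ hs ht) (hφ hu hv) hst.symm h'.1 h'.2 hint

include hM hE in
theorem isBigOp_sum_rhoTerm (o o' : Option (FIdx k₁ k₂)) {R : ℕ × ℕ → Finset (ℕ × ℕ)}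
    (hR : ∀ p, ∀ st ∈ R p, st.1 < p.2 ∧ st.2 < p.2 ∧ st.1 ≠ st.2) :
    IsBigOp P (fun p ω => ∑ st ∈ R p, rhoTerm S o o' p st ω) fun p => (p.2 : ℝ) := by
  obtain ⟨C, hC⟩ := exists_memLp_rhoTerm hM hE
  have hpos : ∀ᶠ p : ℕ × ℕ in atTop, 0 < (p.2 : ℝ) := by
    filter_upwards [eventually_ge_atTop ((1, 1) : ℕ × ℕ)] with p hp
    exact Nat.cast_pos.2 hp.2
  refine isBigOp_of_integral_sq_le (C := 2 * |C|) hpos (Eventually.of_forall fun p => ?_)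
  have hmem := fun st hst => hC o o' p st (hR p st hst).1 (hR p st hst).2.1 (hR p st hst).2.2
  have h := integral_sq_sum_le (P := P p) (R p) Prod.swap (Z := rhoTerm S o o' p) (K := |C|)
    (fun st hst => (hmem st hst).1) (fun st hst => (hmem st hst).2.trans (le_abs_self C))
    (fun st hst uv huv hne hsw =>
      integral_rhoTerm_mul_rhoTerm hM hE o o' p (hR p st hst) (hR p uv huv) hne hsw)
  refine ⟨h.1, h.2.trans ?_⟩
  have hsub : R p ⊆ Finset.range p.2 ×ˢ Finset.range p.2 := fun st hst =>
    Finset.mem_product.2 ⟨Finset.mem_range.2 (hR p st hst).1, Finset.mem_range.2 (hR p st hst).2.1⟩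
  have hcard : ((R p).card : ℝ) ≤ (p.2 : ℝ) ^ 2 := by
    have := Finset.card_le_card hsub
    rw [Finset.card_product, Finset.card_range, ← sq] at this
    exact_mod_cast this
  gcongr

/-- The products `f_t W_t`, where `f` is a factor or the constant `1`. -/
noncomputable def wTerm (S : ∀ p, Sample k₁ k₂ kv (Ω p)) (o : Option (FIdx k₁ k₂))
    (b : GIdx k₁ k₂ kv) (p : ℕ × ℕ) (t : ℕ) (ω : Ω p) : ℝ :=
  (S p).fext o t ω * (S p).wAvg p.1 p.2 t ω b

omit [∀ p, IsProbabilityMeasure (P p)] in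
include hM hE in
theorem exists_memLp_wTerm : ∃ C : ℝ, ∀ (o : Option (FIdx k₁ k₂)) (b : GIdx k₁ k₂ kv) (p : ℕ × ℕ),
    ∀ t < p.2, MemLp (wTerm S o b p t) 2 (P p) ∧ ∫ ω, wTerm S o b p t ω ^ 2 ∂(P p) ≤ C := by
  obtain ⟨C, hC⟩ := hE.wAvg_bound
  refine ⟨C, fun o b p t ht => ?_⟩
  have hmeas : Measurable (wTerm S o b p t) :=
    (hM.measurable_fext p ht o).mul (hM.measurable_wAvg p ht b)
  have hle : ∀ ω, wTerm S o b p t ω ^ 2 ≤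
      (1 + ‖(S p).F t ω‖ ^ 2) * ‖(S p).wAvg p.1 p.2 t ω‖ ^ 2 := by
    intro ω
    rw [wTerm, mul_pow]
    have h := PiLp.norm_apply_le ((S p).wAvg p.1 p.2 t ω) b
    have h2 := pow_le_pow_left₀ (norm_nonneg _) h 2
    rw [Real.norm_eq_abs, sq_abs] at h2
    exact mul_le_mul ((S p).fext_sq_le o t ω) h2 (sq_nonneg _) (by positivity)
  have hsq : Integrable (fun ω => wTerm S o b p t ω ^ 2) (P p) :=
    (hC p t ht).1.mono' (hmeas.pow_const 2).aestronglyMeasurable (Eventually.of_forall fun ω => by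
      rw [Real.norm_of_nonneg (sq_nonneg _)]; exact hle ω)
  exact ⟨(memLp_two_iff_integrable_sq hmeas.aestronglyMeasurable).2 hsq,
    (integral_mono hsq (hC p t ht).1 hle).trans (hC p t ht).2⟩

include hM hE in
theorem integral_wTerm_mul_wTerm (o : Option (FIdx k₁ k₂)) (b : GIdx k₁ k₂ kv) (p : ℕ × ℕ)
    {t s : ℕ} (ht : t < p.2) (hs : s < p.2) (hne : s ≠ t) :
    ∫ ω, wTerm S o b p t ω * wTerm S o b p s ω ∂(P p) = 0 := by
  obtain ⟨C, hC⟩ := exists_memLp_wTerm hM hE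
  have hint := (hC o b p t ht).1.integrable_mul (hC o b p s hs).1
  let g : Fin p.1 → Ω p → ℝ := fun i ω =>
    (√(p.1 : ℝ))⁻¹ * (S p).gam p.2 i b * (S p).fext o t ω * wTerm S o b p s ω
  have hrw : (fun ω => wTerm S o b p t ω * wTerm S o b p s ω)
      = fun ω => ∑ i, (S p).errVec p.1 t ω i * g i ω := by
    funext ω
    rw [wTerm, (S p).wAvg_eq_sum_fin, Finset.mul_sum, Finset.sum_mul]
    exact Finset.sum_congr rfl fun i _ => by simp only [g]; ring
  have hint' : Integrable (fun ω => wTerm S o b p t ω * wTerm S o b p s ω) (P p) := hint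
  rw [hrw] at hint' ⊢
  refine integral_linear_errVec_eq_zero hM hE p ht (fun i => ?_) hint'
  have hle : (S p).factorSigma p.2 ≤
      otherSigma ((S p).factorSigma p.2) ((S p).errVec p.1) p.2 t := le_sup_left
  exact ((((S p).measurable_fext_factorSigma ht o).mono hle le_rfl).const_mul _).mul
    ((((S p).measurable_fext_factorSigma hs o).mono hle le_rfl).mul
      ((S p).measurable_wAvg_otherSigma hs hne b))

include hM hE in
theorem isBigOp_sum_wTerm (o : Option (FIdx k₁ k₂)) (b : GIdx k₁ k₂ kv) {R : ℕ × ℕ → Finset ℕ}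
    (hR : ∀ p, R p ⊆ Finset.range p.2) :
    IsBigOp P (fun p ω => ∑ t ∈ R p, wTerm S o b p t ω) fun p => √(p.2 : ℝ) := by
  obtain ⟨C, hC⟩ := exists_memLp_wTerm hM hE
  have hpos : ∀ᶠ p : ℕ × ℕ in atTop, 0 < √(p.2 : ℝ) := by
    filter_upwards [eventually_ge_atTop ((1, 1) : ℕ × ℕ)] with p hp
    exact Real.sqrt_pos.2 (Nat.cast_pos.2 hp.2)
  refine isBigOp_of_integral_sq_le (C := 2 * |C|) hpos (Eventually.of_forall fun p => ?_)
  have hlt : ∀ t ∈ R p, t < p.2 := fun t ht => Finset.mem_range.1 (hR p ht)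
  have h := integral_sq_sum_le (P := P p) (R p) id (Z := wTerm S o b p) (K := |C|)
    (fun t ht => (hC o b p t (hlt t ht)).1)
    (fun t ht => (hC o b p t (hlt t ht)).2.trans (le_abs_self C))
    (fun t ht s hs hne _ => integral_wTerm_mul_wTerm hM hE o b p (hlt t ht) (hlt s hs) hne)
  refine ⟨h.1, h.2.trans ?_⟩
  have hcard : ((R p).card : ℝ) ≤ p.2 := by
    have := Finset.card_le_card (hR p)
    rw [Finset.card_range] at this
    exact_mod_cast this
  rw [Real.sq_sqrt (Nat.cast_nonneg _)]
  gcongr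

include hM hE in
/-- Sample means of the factors are bounded in probability: their fourth moments are bounded as
part of the bound on `E[(1 + ‖F_t‖⁴)(ρ(s, t)² + 1)]`. -/
theorem isBigOp_fmean (a : FIdx k₁ k₂) {J : ℕ × ℕ → Finset ℕ} (hJ : ∀ p, J p ⊆ Finset.range p.2) :
    IsBigOp P (fun p ω => (S p).fmean (J p) a ω) fun _ => 1 := by
  obtain ⟨C, hC⟩ := hE.rho_bound
  refine isBigOp_of_integral_abs_le (C := |C|) ?_
  filter_upwards [eventually_ge_atTop ((2, 2) : ℕ × ℕ)] with p hp
  have hT : 2 ≤ p.2 := hp.2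
  have hF : ∀ t < p.2, Integrable (fun ω => (S p).F t ω a) (P p) := fun t ht =>
    ((hM.memLp_F p t ht).eval_piLp a).integrable (by norm_num)
  have hFb : ∀ t < p.2, ∫ ω, |(S p).F t ω a| ∂(P p) ≤ |C| := by
    intro t ht
    obtain ⟨s, hs, hst⟩ : ∃ s < p.2, s ≠ t := by
      by_cases h : t = 0
      · exact ⟨1, by omega, by omega⟩
      · exact ⟨0, by omega, fun h' => h h'.symm⟩
    have h := hC p t ht s hs hst
    refine (integral_mono (hF t ht).abs h.1 fun ω => ?_).trans (h.2.trans (le_abs_self C))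
    have h1 : |(S p).F t ω a| ≤ ‖(S p).F t ω‖ := by
      rw [← Real.norm_eq_abs]; exact PiLp.norm_apply_le _ a
    set x := ‖(S p).F t ω‖
    have hx : 0 ≤ x := norm_nonneg _
    have h2 : x ≤ 1 + x ^ 4 := by
      nlinarith [sq_nonneg (x ^ 2 - 1), sq_nonneg (x - 1), sq_nonneg x]
    have h3 : 0 ≤ (1 + x ^ 4) * (S p).rho p.1 s t ω ^ 2 := by positivity
    dsimp only
    nlinarith
  have hJlt : ∀ t ∈ J p, t < p.2 := fun t ht => Finset.mem_range.1 (hJ p ht)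
  have hint : Integrable (fun ω => (S p).fmean (J p) a ω) (P p) :=
    (integrable_finsetSum _ fun t ht => hF t (hJlt t ht)).const_mul _
  refine ⟨hint, ?_⟩
  calc ∫ ω, |(S p).fmean (J p) a ω| ∂(P p)
      ≤ ∫ ω, ((J p).card : ℝ)⁻¹ * ∑ t ∈ J p, |(S p).F t ω a| ∂(P p) := by
        refine integral_mono hint.abs ((integrable_finsetSum _ fun t ht =>
          (hF t (hJlt t ht)).abs).const_mul _) fun ω => ?_
        dsimp only [Sample.fmean]
        rw [abs_mul, abs_of_nonneg (by positivity : (0 : ℝ) ≤ ((J p).card : ℝ)⁻¹)]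
        gcongr
        exact Finset.abs_sum_le_sum_abs _ _
    _ = ((J p).card : ℝ)⁻¹ * ∑ t ∈ J p, ∫ ω, |(S p).F t ω a| ∂(P p) := by
        rw [integral_const_mul, integral_finsetSum _ fun t ht => (hF t (hJlt t ht)).abs]
    _ ≤ ((J p).card : ℝ)⁻¹ * ((J p).card * |C|) := by
        gcongr
        rw [← nsmul_eq_mul]
        exact Finset.sum_le_card_nsmul _ _ _ fun t ht => hFb t (hJlt t ht)
    _ ≤ |C| := by
        rcases Nat.eq_zero_or_pos (J p).card with h0 | h0
        · rw [h0]; simp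
        · rw [← mul_assoc, inv_mul_cancel₀ (by positivity), one_mul]

include hM hE in
theorem isBigOp_sum_Fdem_wAvg (a : FIdx k₁ k₂) (b : GIdx k₁ k₂ kv) {J : ℕ × ℕ → Finset ℕ}
    (hJ : ∀ p, J p ⊆ Finset.range p.2) :
    IsBigOp P (fun p ω => ∑ t ∈ J p, (S p).Fdem (J p) t ω a * (S p).wAvg p.1 p.2 t ω b)
      fun p => √(p.2 : ℝ) := by
  have h := (isBigOp_sum_wTerm hM hE (some a) b hJ).sub
    ((isBigOp_fmean hM hE a hJ).one_mul (isBigOp_sum_wTerm hM hE none b hJ))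
  refine h.of_le (Eventually.of_forall fun p ω => le_of_eq (congrArg _ ?_))
  rw [Finset.mul_sum, ← Finset.sum_sub_distrib]
  refine Finset.sum_congr rfl fun t _ => ?_
  rw [Sample.Fdem_apply, wTerm, wTerm]
  simp only [Sample.fext, Option.elim]
  ring

include hM hE in
theorem isBigOp_sum_Fdem_rho (a : FIdx k₁ k₂) {J : ℕ × ℕ → Finset ℕ}
    (hJ : ∀ p, J p ⊆ Finset.range p.2) {R : ℕ × ℕ → Finset (ℕ × ℕ)}
    (hR : ∀ p, ∀ st ∈ R p, st.1 < p.2 ∧ st.2 < p.2 ∧ st.1 ≠ st.2) :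
    IsBigOp P (fun p ω => ∑ st ∈ R p, (S p).Fdem (J p) st.1 ω a * (S p).rho p.1 st.1 st.2 ω)
      fun p => (p.2 : ℝ) := by
  have h := (isBigOp_sum_rhoTerm hM hE (some a) none hR).sub
    ((isBigOp_fmean hM hE a hJ).one_mul (isBigOp_sum_rhoTerm hM hE none none hR))
  refine h.of_le (Eventually.of_forall fun p ω => le_of_eq (congrArg _ ?_))
  rw [Finset.mul_sum, ← Finset.sum_sub_distrib]
  refine Finset.sum_congr rfl fun t _ => ?_
  rw [Sample.Fdem_apply, rhoTerm, rhoTerm]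
  simp only [Sample.fext, Option.elim]
  ring

include hM hE in
theorem isBigOp_sum_Fdem_Fdem_rho (a b : FIdx k₁ k₂) {J J' : ℕ × ℕ → Finset ℕ}
    (hJ : ∀ p, J p ⊆ Finset.range p.2) (hJ' : ∀ p, J' p ⊆ Finset.range p.2)
    {R : ℕ × ℕ → Finset (ℕ × ℕ)}
    (hR : ∀ p, ∀ st ∈ R p, st.1 < p.2 ∧ st.2 < p.2 ∧ st.1 ≠ st.2) :
    IsBigOp P (fun p ω => ∑ st ∈ R p, (S p).Fdem (J p) st.1 ω a * (S p).Fdem (J' p) st.2 ω b *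
      (S p).rho p.1 st.1 st.2 ω) fun p => (p.2 : ℝ) := by
  have hJm := isBigOp_fmean hM hE a hJ
  have hJm' := isBigOp_fmean hM hE b hJ'
  -- expand `(F_s - F̄)(F_t - F̄')`
  have h := ((isBigOp_sum_rhoTerm hM hE (some a) (some b) hR).sub
    (hJm.one_mul (isBigOp_sum_rhoTerm hM hE none (some b) hR))).sub
    ((hJm'.one_mul (isBigOp_sum_rhoTerm hM hE (some a) none hR)).sub
      ((hJm.mul_one hJm').one_mul (isBigOp_sum_rhoTerm hM hE none none hR)))
  refine h.of_le (Eventually.of_forall fun p ω => le_of_eq (congrArg _ ?_))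
  simp only [Finset.mul_sum, ← Finset.sum_sub_distrib]
  refine Finset.sum_congr rfl fun t _ => ?_
  rw [Sample.Fdem_apply, Sample.Fdem_apply]
  simp only [rhoTerm, Sample.fext, Option.elim]
  ring

end Orders

/-! ### Second moments of loadings and first-pass errors -/

namespace Sample

variable {k₁ k₂ kv : ℕ} {Ω : Type*}

/-- The normalized idiosyncratic error `ξ_i = (√T / |I|) ∑_{t ∈ I} F̃_t e_it` of the first pass on
the periods in `I`. -/
noncomputable def xi (S : Sample k₁ k₂ kv Ω) (I : Finset ℕ) (T i : ℕ) (a : FIdx k₁ k₂) (ω : Ω) :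
    ℝ :=
  √(T : ℝ) / (I.card : ℝ) * ∑ t ∈ I, S.Fdem I t ω a * S.e i t ω

/-- The vector `(γ_i, ξ_i^(1), …, ξ_i^(4))`. -/
noncomputable def yvec (S : Sample k₁ k₂ kv Ω) (I : Fin 4 → Finset ℕ) (T i : ℕ) (ω : Ω) :
    YIdx (FIdx k₁ k₂) (Fin kv) → ℝ :=
  Sum.elim (fun g => S.gam T i g) fun ja => S.xi (I ja.1) T i ja.2 ω

/-- The cross-sectional second moments of `(γ_i, ξ_i^(1), …, ξ_i^(4))`. -/
noncomputable def moment (S : Sample k₁ k₂ kv Ω) (I : Fin 4 → Finset ℕ) (N T : ℕ) (ω : Ω) :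
    Matrix (YIdx (FIdx k₁ k₂) (Fin kv)) (YIdx (FIdx k₁ k₂) (Fin kv)) ℝ :=
  Matrix.of fun k l => (N : ℝ)⁻¹ * ∑ i ∈ Finset.range N, S.yvec I T i ω k * S.yvec I T i ω l

/-- The normalized average error `√T ē_i` of an asset over the whole sample. -/
noncomputable def errBar (S : Sample k₁ k₂ kv Ω) (T i : ℕ) (ω : Ω) : ℝ :=
  (√(T : ℝ))⁻¹ * ∑ t ∈ Finset.range T, S.e i t ω

/-- The cross-sectional moments of `(γ_i, ξ_i^(1), …, ξ_i^(4))` with `√T ē_i`. -/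
noncomputable def errMoment (S : Sample k₁ k₂ kv Ω) (I : Fin 4 → Finset ℕ) (N T : ℕ) (ω : Ω)
    (k : YIdx (FIdx k₁ k₂) (Fin kv)) : ℝ :=
  (N : ℝ)⁻¹ * ∑ i ∈ Finset.range N, S.yvec I T i ω k * S.errBar T i ω

theorem moment_symm (S : Sample k₁ k₂ kv Ω) (I : Fin 4 → Finset ℕ) (N T : ℕ) (ω : Ω)
    (k l : YIdx (FIdx k₁ k₂) (Fin kv)) : S.moment I N T ω k l = S.moment I N T ω l k := by
  simp only [moment, Matrix.of_apply, mul_comm]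

/-- The periods in `I × J` off the diagonal. -/
def offDiagPairs (I J : Finset ℕ) : Finset (ℕ × ℕ) := (I ×ˢ J).filter fun st => st.1 ≠ st.2

/-- A cross-sectional average of products of time-series sums of errors, split into distinct and
equal periods. -/
theorem avg_sum_mul_sum (S : Sample k₁ k₂ kv Ω) (N : ℕ) (I J : Finset ℕ) (c d : ℕ → ℝ) (ω : Ω) :
    (N : ℝ)⁻¹ * ∑ i ∈ Finset.range N, (∑ s ∈ I, c s * S.e i s ω) * (∑ t ∈ J, d t * S.e i t ω) =
      (√(N : ℝ))⁻¹ * (∑ st ∈ offDiagPairs I J, c st.1 * d st.2 * S.rho N st.1 st.2 ω)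
        + ∑ s ∈ I ∩ J, c s * d s * S.avgSq N s ω := by
  have hN : (N : ℝ)⁻¹ = (√(N : ℝ))⁻¹ * (√(N : ℝ))⁻¹ := by
    rw [← mul_inv, Real.mul_self_sqrt (Nat.cast_nonneg N)]
  have h1 : (N : ℝ)⁻¹ * ∑ i ∈ Finset.range N,
      (∑ s ∈ I, c s * S.e i s ω) * (∑ t ∈ J, d t * S.e i t ω)
      = ∑ st ∈ I ×ˢ J, c st.1 * d st.2 *
        ((N : ℝ)⁻¹ * ∑ i ∈ Finset.range N, S.e i st.1 ω * S.e i st.2 ω) := by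
    simp only [Finset.sum_mul_sum, Finset.sum_product]
    simp only [Finset.mul_sum]
    rw [Finset.sum_comm]
    refine Finset.sum_congr rfl fun s _ => ?_
    rw [Finset.sum_comm]
    exact Finset.sum_congr rfl fun t _ => Finset.sum_congr rfl fun i _ => by ring
  rw [h1, ← Finset.sum_filter_add_sum_filter_not (I ×ˢ J) fun st : ℕ × ℕ => st.1 ≠ st.2]
  congr 1
  · rw [offDiagPairs, Finset.mul_sum]
    refine Finset.sum_congr rfl fun st _ => ?_
    rw [rho, hN]; ring
  · refine Finset.sum_nbij' (fun st => st.1) (fun s => (s, s)) ?_ ?_ ?_ ?_ ?_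
    · rintro ⟨s, t⟩ h
      simp only [Finset.mem_filter, Finset.mem_product, not_not] at h
      obtain ⟨⟨h1, h2⟩, rfl⟩ := h
      exact Finset.mem_inter.2 ⟨h1, h2⟩
    · intro s h
      simpa using Finset.mem_inter.1 h
    · rintro ⟨s, t⟩ h
      simp only [Finset.mem_filter, not_not] at h
      simp [h.2]
    · intro s _; rfl
    · rintro ⟨s, t⟩ h
      simp only [Finset.mem_filter, not_not] at h
      obtain ⟨-, rfl⟩ := h
      simp only [avgSq, sq]

theorem moment_inl_inr (S : Sample k₁ k₂ kv Ω) (I : Fin 4 → Finset ℕ) (N T : ℕ) (ω : Ω)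
    (b : GIdx k₁ k₂ kv) (j : Fin 4) (a : FIdx k₁ k₂) :
    S.moment I N T ω (Sum.inl b) (Sum.inr (j, a)) =
      (√(N : ℝ))⁻¹ * (√(T : ℝ) / ((I j).card : ℝ)) *
        ∑ t ∈ I j, S.Fdem (I j) t ω a * S.wAvg N T t ω b := by
  have hN : (N : ℝ)⁻¹ = (√(N : ℝ))⁻¹ * (√(N : ℝ))⁻¹ := by
    rw [← mul_inv, Real.mul_self_sqrt (Nat.cast_nonneg N)]
  simp only [moment, Matrix.of_apply, yvec, Sum.elim_inl, Sum.elim_inr, xi, wAvg_apply, hN,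
    Finset.mul_sum]
  rw [Finset.sum_comm]
  exact Finset.sum_congr rfl fun t _ => Finset.sum_congr rfl fun i _ => by ring

theorem moment_inr_inr (S : Sample k₁ k₂ kv Ω) (I : Fin 4 → Finset ℕ) (N T : ℕ) (ω : Ω)
    (j j' : Fin 4) (a b : FIdx k₁ k₂) :
    S.moment I N T ω (Sum.inr (j, a)) (Sum.inr (j', b)) =
      ((√(N : ℝ))⁻¹ * ((√(T : ℝ) / ((I j).card : ℝ)) * (√(T : ℝ) / ((I j').card : ℝ)))) *
        (∑ st ∈ offDiagPairs (I j) (I j'), S.Fdem (I j) st.1 ω a * S.Fdem (I j') st.2 ω b *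
          S.rho N st.1 st.2 ω)
      + (√(T : ℝ) / ((I j).card : ℝ)) * (√(T : ℝ) / ((I j').card : ℝ)) *
        ∑ s ∈ I j ∩ I j', S.Fdem (I j) s ω a * S.Fdem (I j') s ω b * S.avgSq N s ω := by
  have h := S.avg_sum_mul_sum N (I j) (I j') (fun s => S.Fdem (I j) s ω a)
    (fun t => S.Fdem (I j') t ω b) ω
  have h2 : S.moment I N T ω (Sum.inr (j, a)) (Sum.inr (j', b)) =
      (√(T : ℝ) / ((I j).card : ℝ)) * (√(T : ℝ) / ((I j').card : ℝ)) * ((N : ℝ)⁻¹ *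
        ∑ i ∈ Finset.range N, (∑ s ∈ I j, S.Fdem (I j) s ω a * S.e i s ω) *
          (∑ t ∈ I j', S.Fdem (I j') t ω b * S.e i t ω)) := by
    simp only [moment, Matrix.of_apply, yvec, Sum.elim_inr, xi, Finset.mul_sum (Finset.range N)]
    exact Finset.sum_congr rfl fun i _ => by ring
  rw [h2, h]
  ring

theorem errMoment_inl (S : Sample k₁ k₂ kv Ω) (I : Fin 4 → Finset ℕ) (N T : ℕ) (ω : Ω)
    (b : GIdx k₁ k₂ kv) : S.errMoment I N T ω (Sum.inl b) =
      (√(N : ℝ))⁻¹ * (√(T : ℝ))⁻¹ * ∑ t ∈ Finset.range T, S.wAvg N T t ω b := by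
  have hN : (N : ℝ)⁻¹ = (√(N : ℝ))⁻¹ * (√(N : ℝ))⁻¹ := by
    rw [← mul_inv, Real.mul_self_sqrt (Nat.cast_nonneg N)]
  simp only [errMoment, yvec, Sum.elim_inl, errBar, wAvg_apply, hN, Finset.mul_sum]
  rw [Finset.sum_comm]
  exact Finset.sum_congr rfl fun t _ => Finset.sum_congr rfl fun i _ => by ring

theorem errMoment_inr (S : Sample k₁ k₂ kv Ω) (I : Fin 4 → Finset ℕ) (N T : ℕ) (ω : Ω)
    {j : Fin 4} (hI : I j ⊆ Finset.range T) (a : FIdx k₁ k₂) (hT : T ≠ 0) :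
    S.errMoment I N T ω (Sum.inr (j, a)) =
      ((√(N : ℝ))⁻¹ * ((I j).card : ℝ)⁻¹) *
        (∑ st ∈ offDiagPairs (I j) (Finset.range T), S.Fdem (I j) st.1 ω a *
          S.rho N st.1 st.2 ω)
      + ((I j).card : ℝ)⁻¹ * ∑ s ∈ I j, S.avgSq N s ω * S.Fdem (I j) s ω a := by
  have h := S.avg_sum_mul_sum N (I j) (Finset.range T) (fun s => S.Fdem (I j) s ω a)
    (fun _ => 1) ω
  rw [Finset.inter_eq_left.2 hI] at h
  have hT' : √(T : ℝ) * (√(T : ℝ))⁻¹ = 1 :=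
    mul_inv_cancel₀ (Real.sqrt_ne_zero'.2 (Nat.cast_pos.2 (Nat.pos_of_ne_zero hT)))
  have h2 : S.errMoment I N T ω (Sum.inr (j, a)) =
      (√(T : ℝ) * (√(T : ℝ))⁻¹) * ((I j).card : ℝ)⁻¹ * ((N : ℝ)⁻¹ *
        ∑ i ∈ Finset.range N, (∑ s ∈ I j, S.Fdem (I j) s ω a * S.e i s ω) *
          (∑ t ∈ Finset.range T, 1 * S.e i t ω)) := by
    simp only [errMoment, yvec, Sum.elim_inr, xi, errBar, Finset.mul_sum (Finset.range N), one_mul]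
    exact Finset.sum_congr rfl fun i _ => by ring
  rw [h2, h, hT']
  simp only [mul_one, one_mul]
  rw [mul_add]
  congr 1
  · ring
  · simp only [mul_comm (S.avgSq N _ ω)]

end Sample

section Limits

theorem norm_apply_le_norm {ι : Type*} [Fintype ι] (x : EuclideanSpace ℝ ι) (a : ι) :
    ‖x a‖ ≤ ‖x‖ :=
  PiLp.norm_apply_le x a

variable {k₁ k₂ kv : ℕ} {Ω : ℕ × ℕ → Type*} [∀ p, MeasurableSpace (Ω p)]
  {P : ∀ p, Measure (Ω p)} [∀ p, IsProbabilityMeasure (P p)] {S : ∀ p, Sample k₁ k₂ kv (Ω p)}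
  {SigSF : Matrix (FIdx k₁ k₂) (FIdx k₁ k₂) ℝ} {I : ℕ → Fin 4 → Finset ℕ}

theorem tendsto_fst_atTop_real : Tendsto (fun p : ℕ × ℕ => (p.1 : ℝ)) atTop atTop :=
  tendsto_natCast_atTop_atTop.comp (by rw [← prod_atTop_atTop_eq]; exact tendsto_fst)

theorem tendsto_snd_atTop : Tendsto (fun p : ℕ × ℕ => p.2) atTop atTop := by
  rw [← prod_atTop_atTop_eq]; exact tendsto_snd

theorem tendsto_one_div_sqrt_fst :
    Tendsto (fun p : ℕ × ℕ => 1 / √(p.1 : ℝ)) atTop (𝓝 0) := by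
  simp only [one_div]
  exact tendsto_inv_atTop_zero.comp (Real.tendsto_sqrt_atTop.comp tendsto_fst_atTop_real)

theorem eventually_split_size :
    ∀ᶠ p : ℕ × ℕ in atTop, 0 < (p.1 : ℝ) ∧ 0 < (p.2 : ℝ) ∧ 0 < ((p.2 / 4 : ℕ) : ℝ) ∧
      (p.2 : ℝ) ≤ 8 * ((p.2 / 4 : ℕ) : ℝ) := by
  filter_upwards [eventually_ge_atTop ((1, 4) : ℕ × ℕ)] with p hp
  have h1 : 1 ≤ p.1 := hp.1
  have h2 : 4 ≤ p.2 := hp.2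
  refine ⟨by exact_mod_cast h1, by exact_mod_cast (show 0 < p.2 by omega),
    by exact_mod_cast (show 0 < p.2 / 4 by omega), ?_⟩
  exact_mod_cast (show p.2 ≤ 8 * (p.2 / 4) by omega)

/-- The ratio of the lengths of the full sample and of the subsamples. -/
theorem tendsto_div_split_size :
    Tendsto (fun p : ℕ × ℕ => (p.2 : ℝ) / ((p.2 / 4 : ℕ) : ℝ)) atTop (𝓝 4) := by
  have h4 : Tendsto (fun T : ℕ => ((T / 4 : ℕ) : ℝ)) atTop atTop :=
    tendsto_natCast_atTop_atTop.comp (Nat.tendsto_div_const_atTop (by norm_num))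
  have hup : Tendsto (fun T : ℕ => 4 + 3 * (((T / 4 : ℕ) : ℝ))⁻¹) atTop (𝓝 4) := by
    simpa using ((tendsto_inv_atTop_zero.comp h4).const_mul 3).const_add 4
  have : Tendsto (fun T : ℕ => (T : ℝ) / ((T / 4 : ℕ) : ℝ)) atTop (𝓝 4) := by
    refine tendsto_of_tendsto_of_tendsto_of_le_of_le' tendsto_const_nhds hup ?_ ?_
    · filter_upwards [eventually_ge_atTop 4] with T hT
      have hpos : 0 < ((T / 4 : ℕ) : ℝ) := by exact_mod_cast (show 0 < T / 4 by omega)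
      rw [le_div_iff₀ hpos]
      exact_mod_cast (show 4 * (T / 4) ≤ T by omega)
    · filter_upwards [eventually_ge_atTop 4] with T hT
      have hpos : 0 < ((T / 4 : ℕ) : ℝ) := by exact_mod_cast (show 0 < T / 4 by omega)
      rw [div_le_iff₀ hpos, add_mul, mul_assoc, inv_mul_cancel₀ hpos.ne']
      exact_mod_cast (show T ≤ 4 * (T / 4) + 3 * 1 by omega)
  exact this.comp tendsto_snd_atTop

variable (hI : IsFourSplit I) (hM : PricingModel P S) (hE : Errors P S SigSF)

theorem offDiagPairs_spec {J J' : Finset ℕ} {T : ℕ} (hJ : J ⊆ Finset.range T)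
    (hJ' : J' ⊆ Finset.range T) :
    ∀ st ∈ Sample.offDiagPairs J J', st.1 < T ∧ st.2 < T ∧ st.1 ≠ st.2 := by
  intro st hst
  obtain ⟨h1, h2⟩ := Finset.mem_filter.1 hst
  obtain ⟨h3, h4⟩ := Finset.mem_product.1 h1
  exact ⟨Finset.mem_range.1 (hJ h3), Finset.mem_range.1 (hJ' h4), h2⟩

include hI hM hE in
theorem isBigOp_moment_inl_inr (b : GIdx k₁ k₂ kv) (j : Fin 4) (a : FIdx k₁ k₂) :
    IsBigOp P (fun p ω => (S p).moment (I p.2) p.1 p.2 ω (Sum.inl b) (Sum.inr (j, a)))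
      fun p => 1 / √(p.1 : ℝ) := by
  simp_rw [Sample.moment_inl_inr]
  refine (isBigOp_sum_Fdem_wAvg hM hE a b (J := fun p => I p.2 j)
    fun p => hI.subset p.2 j).smul_of_le (C := 8)
      (Eventually.of_forall fun p => Real.sqrt_nonneg _) ?_
  filter_upwards [eventually_split_size] with p ⟨hN, hT, hτ, hle⟩
  rw [hI.card, abs_of_nonneg (by positivity), one_div]
  have h : √(p.2 : ℝ) / ((p.2 / 4 : ℕ) : ℝ) * √(p.2 : ℝ) ≤ 8 := by
    rw [div_mul_eq_mul_div, Real.mul_self_sqrt hT.le, div_le_iff₀ hτ]; exact hle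
  calc (√(p.1 : ℝ))⁻¹ * (√(p.2 : ℝ) / ((p.2 / 4 : ℕ) : ℝ)) * √(p.2 : ℝ)
      = (√(p.2 : ℝ) / ((p.2 / 4 : ℕ) : ℝ) * √(p.2 : ℝ)) * (√(p.1 : ℝ))⁻¹ := by ring
    _ ≤ 8 * (√(p.1 : ℝ))⁻¹ := by gcongr

include hI hM hE in
theorem isBigOp_moment_offDiag (j j' : Fin 4) (a b : FIdx k₁ k₂) :
    IsBigOp P (fun p ω => ((√(p.1 : ℝ))⁻¹ * ((√(p.2 : ℝ) / ((I p.2 j).card : ℝ)) *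
        (√(p.2 : ℝ) / ((I p.2 j').card : ℝ)))) *
        (∑ st ∈ Sample.offDiagPairs (I p.2 j) (I p.2 j'), (S p).Fdem (I p.2 j) st.1 ω a *
          (S p).Fdem (I p.2 j') st.2 ω b * (S p).rho p.1 st.1 st.2 ω))
      fun p => 1 / √(p.1 : ℝ) := by
  refine (isBigOp_sum_Fdem_Fdem_rho hM hE a b (J := fun p => I p.2 j) (J' := fun p => I p.2 j')
    (fun p => hI.subset p.2 j) (fun p => hI.subset p.2 j') (fun p => offDiagPairs_spec
      (hI.subset p.2 j) (hI.subset p.2 j'))).smul_of_le (C := 64)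
      (Eventually.of_forall fun p => Nat.cast_nonneg _) ?_
  filter_upwards [eventually_split_size] with p ⟨hN, hT, hτ, hle⟩
  rw [hI.card, hI.card, abs_of_nonneg (by positivity), one_div]
  set τ := ((p.2 / 4 : ℕ) : ℝ)
  have h : √(p.2 : ℝ) / τ * (√(p.2 : ℝ) / τ) * (p.2 : ℝ) ≤ 64 := by
    rw [div_mul_div_comm, Real.mul_self_sqrt hT.le, div_mul_eq_mul_div, div_le_iff₀ (by positivity)]
    nlinarith
  calc (√(p.1 : ℝ))⁻¹ * (√(p.2 : ℝ) / τ * (√(p.2 : ℝ) / τ)) * (p.2 : ℝ)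
      = (√(p.2 : ℝ) / τ * (√(p.2 : ℝ) / τ) * (p.2 : ℝ)) * (√(p.1 : ℝ))⁻¹ := by ring
    _ ≤ 64 * (√(p.1 : ℝ))⁻¹ := by gcongr

include hI hM hE in
/-- First-pass errors of different subsamples are nearly orthogonal in the cross section. -/
theorem isBigOp_moment_inr_inr {j j' : Fin 4} (hj : j ≠ j') (a b : FIdx k₁ k₂) :
    IsBigOp P (fun p ω => (S p).moment (I p.2) p.1 p.2 ω (Sum.inr (j, a)) (Sum.inr (j', b)))
      fun p => 1 / √(p.1 : ℝ) := by
  refine (isBigOp_moment_offDiag hI hM hE j j' a b).of_le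
    (Eventually.of_forall fun p ω => le_of_eq (congrArg _ ?_))
  rw [Sample.moment_inr_inr, Finset.disjoint_iff_inter_eq_empty.1 (hI.disjoint p.2 hj)]
  simp

include hI hM hE in
theorem isBigOp_errMoment (hES : ∀ j, ErrorAverages P S SigSF fun T => I T j)
    (k : YIdx (FIdx k₁ k₂) (Fin kv)) :
    IsBigOp P (fun p ω => (S p).errMoment (I p.2) p.1 p.2 ω k) fun p => 1 / √(p.1 : ℝ) := by
  rcases k with b | ⟨j, a⟩
  · simp_rw [Sample.errMoment_inl]
    have h := isBigOp_sum_wTerm hM hE none b (R := fun p => Finset.range p.2) fun p => subset_rfl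
    simp only [wTerm, Sample.fext, Option.elim, one_mul] at h
    refine h.smul_of_le (C := 1) (Eventually.of_forall fun p => Real.sqrt_nonneg _) ?_
    filter_upwards [eventually_split_size] with p ⟨hN, hT, hτ, hle⟩
    rw [abs_of_nonneg (by positivity), one_div, mul_assoc,
      inv_mul_cancel₀ (Real.sqrt_pos.2 hT).ne', one_mul, mul_one]
  · have h1 := (isBigOp_sum_Fdem_rho hM hE a (J := fun p => I p.2 j) (fun p => hI.subset p.2 j)
      (R := fun p => Sample.offDiagPairs (I p.2 j) (Finset.range p.2))
      fun p => offDiagPairs_spec (hI.subset p.2 j) subset_rfl).smul_of_le (C := 8)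
      (c := fun p => (√(p.1 : ℝ))⁻¹ * ((I p.2 j).card : ℝ)⁻¹) (b := fun p => 1 / √(p.1 : ℝ))
      (Eventually.of_forall fun p => Nat.cast_nonneg _) (by
        filter_upwards [eventually_split_size] with p ⟨hN, hT, hτ, hle⟩
        rw [hI.card, abs_of_nonneg (by positivity), one_div]
        have h : ((p.2 / 4 : ℕ) : ℝ)⁻¹ * (p.2 : ℝ) ≤ 8 := by
          rw [inv_mul_le_iff₀ hτ]; linarith
        calc (√(p.1 : ℝ))⁻¹ * ((p.2 / 4 : ℕ) : ℝ)⁻¹ * (p.2 : ℝ)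
            = (((p.2 / 4 : ℕ) : ℝ)⁻¹ * (p.2 : ℝ)) * (√(p.1 : ℝ))⁻¹ := by ring
          _ ≤ 8 * (√(p.1 : ℝ))⁻¹ := by gcongr)
    have h2 := ((hES j).first.isBigOp_one).smul_of_le (C := 1) (c := fun p => (√(p.1 : ℝ))⁻¹)
      (b := fun p => 1 / √(p.1 : ℝ)) (Eventually.of_forall fun p => zero_le_one) (by
        refine Eventually.of_forall fun p => ?_
        rw [abs_of_nonneg (by positivity), one_div, mul_one, one_mul])
    have h3 : IsBigOp P (fun p ω => ((I p.2 j).card : ℝ)⁻¹ *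
        ∑ s ∈ I p.2 j, (S p).avgSq p.1 s ω * (S p).Fdem (I p.2 j) s ω a)
        fun p => 1 / √(p.1 : ℝ) := by
      refine h2.of_le ?_
      filter_upwards [eventually_split_size] with p ⟨hN, hT, hτ, hle⟩ ω
      refine le_trans (le_of_eq (congrArg _ ?_)) (norm_apply_le_norm _ a)
      simp only [PiLp.smul_apply, WithLp.ofLp_sum, Finset.sum_apply, smul_eq_mul, WithLp.ofLp_smul,
        Pi.smul_apply]
      rw [← mul_assoc, mul_div_assoc', inv_mul_cancel₀ (Real.sqrt_pos.2 hN).ne', one_div]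
    refine (h1.add h3).of_le ?_
    filter_upwards [eventually_split_size] with p ⟨hN, hT, hτ, hle⟩ ω
    rw [Sample.errMoment_inr _ _ _ _ _ (hI.subset p.2 j) a (by rintro h; simp [h] at hT)]
    simp only [smul_eq_mul]
    exact le_rfl

include hI hM hE in
/-- The second moments of loadings and first-pass errors converge to a block-diagonal matrix. -/
theorem whp_moment (hES : ∀ j, ErrorAverages P S SigSF fun T => I T j)
    {Γ : Matrix (GIdx k₁ k₂ kv) (GIdx k₁ k₂ kv) ℝ} (hL : Loadings S Γ) :
    ∀ V ∈ 𝓝 (limitMoment Γ SigSF),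
      Whp P fun p ω => (S p).moment (I p.2) p.1 p.2 ω ∈ V := by
  have hzero : ∀ {X : ∀ p, Ω p → ℝ}, IsBigOp P X (fun p => 1 / √(p.1 : ℝ)) →
      ∀ V ∈ 𝓝 (0 : ℝ), Whp P fun p ω => X p ω ∈ V := fun h =>
    tendstoInProb_iff_whp.1 (h.tendstoInProb tendsto_one_div_sqrt_fst)
  refine whp_mem_nhds_pi fun k => whp_mem_nhds_pi fun l => ?_
  rcases k with b | ⟨j, a⟩ <;> rcases l with b' | ⟨j', a'⟩
  · exact whp_mem_nhds_of_tendsto (hL.tendsto b b')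
  · exact hzero (isBigOp_moment_inl_inr hI hM hE b j' a')
  · simp_rw [Sample.moment_symm _ _ _ _ _ (Sum.inr (j, a))]
    exact hzero (isBigOp_moment_inl_inr hI hM hE b' j a)
  · by_cases hj : j = j'
    · subst hj
      have hlim : limitMoment Γ SigSF (Sum.inr (j, a)) (Sum.inr (j, a')) = 0 + 4 * SigSF a a' := by
        simp [limitMoment]
      rw [hlim]
      have h1 := hzero (isBigOp_moment_offDiag hI hM hE j j a a')
      have h2 := tendstoInProb_iff_whp.1 ((hES j).second a a')
      have h3 := whp_mem_nhds_prod h1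
        (whp_mem_nhds_prod (whp_mem_nhds_of_tendsto (P := P) tendsto_div_split_size) h2)
      have hc : ContinuousAt (fun u : ℝ × ℝ × ℝ => u.1 + u.2.1 * u.2.2) (0, 4, SigSF a a') := by
        fun_prop
      intro V hV
      refine (h3 _ (hc hV)).mono ?_
      filter_upwards [eventually_split_size] with p ⟨hN, hT, hτ, hle⟩ ω hω
      simp only [Set.mem_preimage] at hω
      rw [Sample.moment_inr_inr, Finset.inter_self]
      convert hω using 2
      rw [hI.card, div_mul_div_comm, Real.mul_self_sqrt hT.le, ← mul_assoc]
      congr 1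
      field_simp
    · have hlim : limitMoment Γ SigSF (Sum.inr (j, a)) (Sum.inr (j', a')) = 0 := by
        simp [limitMoment, hj]
      rw [hlim]
      exact hzero (isBigOp_moment_inr_inr hI hM hE hj a a')

end Limits

/-! ### The two-stage least squares error in terms of moments -/

section MomentAlgebra

open Matrix

theorem transpose_mul_of_rows {N : ℕ} {k m l : Type*} [Fintype k] {X : Matrix (Fin N) m ℝ}
    {Z : Matrix (Fin N) l ℝ} {L : Matrix m k ℝ} {L' : Matrix l k ℝ} {y : ℕ → k → ℝ}
    (hX : ∀ i : Fin N, X i = L *ᵥ y i) (hZ : ∀ i : Fin N, Z i = L' *ᵥ y i) {M : Matrix k k ℝ}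
    (hN : N ≠ 0) (hM : ∀ a b, M a b = (N : ℝ)⁻¹ * ∑ i ∈ Finset.range N, y i a * y i b) :
    Xᵀ * Z = (N : ℝ) • (L * M * L'ᵀ) := by
  let Y : Matrix (Fin N) k ℝ := of fun i => y i
  have hX' : X = Y * Lᵀ := by
    ext i a
    rw [hX, mul_apply, mulVec, dotProduct]
    exact Finset.sum_congr rfl fun b _ => mul_comm _ _
  have hZ' : Z = Y * L'ᵀ := by
    ext i a
    rw [hZ, mul_apply, mulVec, dotProduct]
    exact Finset.sum_congr rfl fun b _ => mul_comm _ _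
  have hY : Yᵀ * Y = (N : ℝ) • M := by
    ext a b
    rw [Matrix.smul_apply, hM, smul_eq_mul, ← mul_assoc, mul_inv_cancel₀ (Nat.cast_ne_zero.2 hN),
      one_mul, mul_apply, Finset.sum_range]
    rfl
  rw [hX', hZ', transpose_mul, transpose_transpose, Matrix.mul_assoc, ← Matrix.mul_assoc Yᵀ, hY,
    Matrix.smul_mul, Matrix.mul_smul, Matrix.mul_assoc]

theorem transpose_mulVec_of_rows {N : ℕ} {k l : Type*} [Fintype k]
    {Z : Matrix (Fin N) l ℝ} {L' : Matrix l k ℝ} {y : ℕ → k → ℝ}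
    (hZ : ∀ i : Fin N, Z i = L' *ᵥ y i) {ε : ℕ → ℝ} :
    Zᵀ *ᵥ (fun i : Fin N => ε i) = L' *ᵥ fun a => ∑ i ∈ Finset.range N, y i a * ε i := by
  funext c
  simp only [mulVec, dotProduct, transpose_apply, hZ, Finset.sum_mul, Finset.mul_sum]
  rw [Finset.sum_comm]
  refine Finset.sum_congr rfl fun a _ => ?_
  rw [Finset.sum_range]
  exact Finset.sum_congr rfl fun i _ => by ring

/-- The estimation error of two-stage least squares, when regressors, instruments and the
structural error are linear in a vector `y i` and in one further variable `ε i`. -/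
theorem tsls_error {N : ℕ} {k m l : Type*} [Fintype k] [Fintype m] [Fintype l] [DecidableEq m]
    [DecidableEq l] {X : Matrix (Fin N) m ℝ} {Z : Matrix (Fin N) l ℝ} {L : Matrix m k ℝ}
    {L' : Matrix l k ℝ} {y : ℕ → k → ℝ} (hN : N ≠ 0)
    (hX : ∀ i : Fin N, X i = L *ᵥ y i) (hZ : ∀ i : Fin N, Z i = L' *ᵥ y i)
    {M : Matrix k k ℝ} (hM : ∀ a b, M a b = (N : ℝ)⁻¹ * ∑ i ∈ Finset.range N, y i a * y i b)
    {r : k → ℝ} {ε : ℕ → ℝ} (hr : ∀ a, r a = (N : ℝ)⁻¹ * ∑ i ∈ Finset.range N, y i a * ε i)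
    {θ : m → ℝ} {ℓ : k → ℝ} {Y : Fin N → ℝ} (hY : ∀ i : Fin N, Y i = X i ⬝ᵥ θ + (ε i - y i ⬝ᵥ ℓ))
    (hW : (L' * M * L'ᵀ).det ≠ 0)
    (hG : ((L * M * L'ᵀ) * (L' * M * L'ᵀ)⁻¹ * (L * M * L'ᵀ)ᵀ).det ≠ 0) :
    tsls X Z Y = θ + gain (L * M * L'ᵀ) (L' * M * L'ᵀ) *ᵥ (L' *ᵥ (r - M *ᵥ ℓ)) := by
  have hN' : (N : ℝ) ≠ 0 := Nat.cast_ne_zero.2 hN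
  have hXZ := transpose_mul_of_rows hX hZ hN hM
  have hZZ := transpose_mul_of_rows hZ hZ hN hM
  have hYeq : Y = X *ᵥ θ + fun i : Fin N => ε i - y i ⬝ᵥ ℓ := funext hY
  have hdet : (Xᵀ * Z * (Zᵀ * Z)⁻¹ * (Xᵀ * Z)ᵀ).det ≠ 0 := by
    have h1 : ((N : ℝ) • (L' * M * L'ᵀ))⁻¹ = (N : ℝ)⁻¹ • (L' * M * L'ᵀ)⁻¹ :=
      inv_smul' _ (Units.mk0 (N : ℝ) hN') (isUnit_iff_ne_zero.2 hW)
    rw [hXZ, hZZ, h1, transpose_smul, Matrix.mul_smul, Matrix.mul_smul, Matrix.smul_mul, smul_smul,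
      mul_inv_cancel₀ hN', one_smul, Matrix.smul_mul, Matrix.smul_mul, det_smul]
    exact mul_ne_zero (pow_ne_zero _ hN') hG
  rw [hYeq, tsls_add_mulVec X Z θ _ hdet, tsls_eq_gain, hXZ, hZZ, gain_smul hN' _ hW hG,
    transpose_mulVec_of_rows (ε := fun i => ε i - y i ⬝ᵥ ℓ) hZ]
  congr 1
  rw [smul_mulVec, ← mulVec_smul, ← mulVec_smul]
  congr 2
  funext a
  have hM' : (M *ᵥ ℓ) a = (N : ℝ)⁻¹ * ∑ i ∈ Finset.range N, y i a * (y i ⬝ᵥ ℓ) := by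
    simp only [mulVec, dotProduct, hM, Finset.mul_sum, Finset.sum_mul]
    rw [Finset.sum_comm]
    exact Finset.sum_congr rfl fun i _ => Finset.sum_congr rfl fun b _ => by ring
  rw [Pi.smul_apply, Pi.sub_apply, hr, hM', smul_eq_mul, ← mul_sub, ← Finset.sum_sub_distrib]
  congr 1
  exact Finset.sum_congr rfl fun i _ => by ring

end MomentAlgebra

namespace Sample

open Matrix

variable {k₁ k₂ kv : ℕ} {Ω : Type*} [MeasurableSpace Ω]

/-- The inverse of the sample covariance matrix of the factors on the `j`-th subsample. -/
noncomputable def covInv (S : Sample k₁ k₂ kv Ω) (I : Fin 4 → Finset ℕ) (ω : Ω) (j : Fin 4) :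
    Matrix (FIdx k₁ k₂) (FIdx k₁ k₂) ℝ :=
  (((I j).card : ℝ)⁻¹ • S.gramF (I j) ω)⁻¹

/-- The contributions of the missing factors to the first pass, as functions of the `η_j` and of the
inverse covariance matrices. -/
noncomputable def missing (SigF : Matrix (FIdx k₁ k₂) (FIdx k₁ k₂) ℝ)
    (x : Fin 4 → EuclideanSpace ℝ (FIdx k₁ k₂ × Fin kv))
    (K : Fin 4 → Matrix (FIdx k₁ k₂) (FIdx k₁ k₂) ℝ) (j : Fin 4) :
    Matrix (FIdx k₁ k₂) (Fin kv) ℝ :=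
  K j * (SigF * unvec (x j))

/-- The diagonal matrix that multiplies strong coordinates by `d` and fixes weak ones. -/
def shrink (k₁ k₂ : ℕ) (d : ℝ) : Matrix (FIdx k₁ k₂) (FIdx k₁ k₂) ℝ :=
  diagonal (Sum.elim (fun _ => d) fun _ => 1)

omit [MeasurableSpace Ω] in
theorem sum_Fdem (S : Sample k₁ k₂ kv Ω) {I : Finset ℕ} (hI : I.card ≠ 0) (ω : Ω)
    (a : FIdx k₁ k₂) : ∑ t ∈ I, S.Fdem I t ω a = 0 := by
  have h : (I.card : ℝ) ≠ 0 := Nat.cast_ne_zero.2 hI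
  simp only [Fdem_apply, Finset.sum_sub_distrib, Finset.sum_const, nsmul_eq_mul, fmean, fext,
    Option.elim]
  rw [← mul_assoc, mul_inv_cancel₀ h, one_mul, sub_self]

/-- The first-pass estimate is the true exposure, plus a term due to the missing factors, plus an
idiosyncratic term. -/
theorem sqrt_smul_betaHat (S : Sample k₁ k₂ kv Ω) (P : Measure Ω)
    (lam : EuclideanSpace ℝ (FIdx k₁ k₂)) {SigF : Matrix (FIdx k₁ k₂) (FIdx k₁ k₂) ℝ}
    (hSig : SigF.det ≠ 0) {I : Fin 4 → Finset ℕ} {T τ : ℕ} {j : Fin 4} (hτ : (I j).card = τ)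
    (hτ0 : τ ≠ 0) {m : EuclideanSpace ℝ (FIdx k₁ k₂)} (hm : ∀ t ∈ I j, ∫ ω', S.F t ω' ∂P = m)
    {ω : Ω} (hG : (((I j).card : ℝ)⁻¹ • S.gramF (I j) ω).det ≠ 0) (i : ℕ) :
    √(T : ℝ) • S.betaHat P lam (I j) i ω = √(T : ℝ) • (S.β i : FIdx k₁ k₂ → ℝ) +
      firstPass (√(T : ℝ) / √(τ : ℝ)) (missing SigF (fun j => S.eta SigF (I j) ω) (S.covInv I ω))
        (S.covInv I ω) j *ᵥ S.yvec I T i ω := by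
  have hτr : (τ : ℝ) ≠ 0 := Nat.cast_ne_zero.2 hτ0
  have hτs : √(τ : ℝ) * √(τ : ℝ) = τ := Real.mul_self_sqrt (Nat.cast_nonneg τ)
  have hτs0 : √(τ : ℝ) ≠ 0 := fun h => hτr (by rw [← hτs, h, mul_zero])
  set G := S.gramF (I j) ω with hGdef
  have hGunit : IsUnit G.det := by
    refine isUnit_iff_ne_zero.2 fun h0 => hG ?_
    rw [det_smul, h0, mul_zero]
  have hK : S.covInv I ω j = (τ : ℝ) • G⁻¹ := by
    rw [covInv, hτ, ← hGdef]
    have := inv_smul' G (Units.mk0 ((τ : ℝ)⁻¹) (inv_ne_zero hτr)) hGunit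
    refine this.trans ?_
    rw [Units.smul_def, Units.val_inv_eq_inv_val, Units.val_mk0, inv_inv]
  have heta : ∀ a c, (SigF * unvec (S.eta SigF (I j) ω)) a c
      = (√(τ : ℝ))⁻¹ * ∑ t ∈ I j, S.Fdem (I j) t ω a * S.v t ω c := by
    intro a c
    have h1 : unvec (S.eta SigF (I j) ω) = SigF⁻¹ * of fun a c =>
        (√(τ : ℝ))⁻¹ * ∑ t ∈ I j, S.Fdem (I j) t ω a * S.v t ω c := by
      ext a c
      simp only [unvec, eta, of_apply, hτ, mul_apply, mulVec, dotProduct, Finset.sum_mul,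
        Finset.mul_sum]
      rw [Finset.sum_comm]
      exact Finset.sum_congr rfl fun b _ => Finset.sum_congr rfl fun t _ => by ring
    rw [h1, ← Matrix.mul_assoc, mul_nonsing_inv _ (isUnit_iff_ne_zero.2 hSig), Matrix.one_mul,
      of_apply]
  -- the normal equations of the first pass
  have hb : (fun a => ∑ t ∈ I j, S.Fdem (I j) t ω a * S.ret P lam i t ω)
      = G *ᵥ (S.β i : FIdx k₁ k₂ → ℝ)
        + √(τ : ℝ) • ((SigF * unvec (S.eta SigF (I j) ω)) *ᵥ (S.μ i : Fin kv → ℝ))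
        + fun a => ∑ t ∈ I j, S.Fdem (I j) t ω a * S.e i t ω := by
    funext a
    have hret : ∀ t ∈ I j, S.ret P lam i t ω =
        (inner ℝ lam (S.β i) + ∑ b, (S.fmean (I j) b ω - m b) * S.β i b)
        + ∑ b, S.Fdem (I j) t ω b * S.β i b + ∑ c, S.v t ω c * S.μ i c + S.e i t ω := by
      intro t ht
      rw [ret, hm t ht, EuclideanSpace.inner_eq_star_dotProduct (S.F t ω - m),
        EuclideanSpace.inner_eq_star_dotProduct (S.v t ω)]
      simp only [dotProduct, star_trivial, Fdem_apply, fext, Option.elim, WithLp.ofLp_sub,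
        Pi.sub_apply]
      have h1 : ∑ b, S.β i b * (S.F t ω b - m b) = ∑ b, (S.fmean (I j) b ω - m b) * S.β i b
          + ∑ b, (S.F t ω b - S.fmean (I j) b ω) * S.β i b := by
        rw [← Finset.sum_add_distrib]
        exact Finset.sum_congr rfl fun b _ => by ring
      have h2 : ∑ c, S.μ i c * S.v t ω c = ∑ c, S.v t ω c * S.μ i c :=
        Finset.sum_congr rfl fun c _ => mul_comm _ _
      rw [h1, h2]; ring
    rw [Finset.sum_congr rfl fun t ht => by rw [hret t ht]]
    simp only [mul_add, Finset.sum_add_distrib, Pi.add_apply, Pi.smul_apply, smul_eq_mul]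
    rw [← Finset.sum_mul, ← Finset.sum_mul, S.sum_Fdem (by rw [hτ]; exact hτ0), zero_mul, zero_mul,
      zero_add, zero_add]
    congr 2
    · simp only [hGdef, gramF, mulVec, dotProduct, of_apply, Finset.sum_mul, Finset.mul_sum]
      rw [Finset.sum_comm]
      exact Finset.sum_congr rfl fun b _ => Finset.sum_congr rfl fun t _ => by ring
    · simp only [mulVec, dotProduct, heta, Finset.mul_sum, Finset.sum_mul]
      rw [Finset.sum_comm]
      refine Finset.sum_congr rfl fun c _ => Finset.sum_congr rfl fun t _ => ?_
      field_simp
  rw [betaHat, hb, ← hGdef, mulVec_add, mulVec_add, mulVec_mulVec, nonsing_inv_mul _ hGunit,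
    one_mulVec, smul_add, smul_add, add_assoc]
  congr 1
  rw [yvec, firstPass_mulVec]
  congr 1
  · rw [missing, hK, mulVec_smul, mulVec_mulVec, Matrix.smul_mul, smul_mulVec, smul_smul, smul_smul]
    congr 1
    rw [div_mul_eq_mul_div, eq_div_iff hτs0, mul_assoc, hτs]
  · rw [hK, smul_mulVec, ← mulVec_smul, ← mulVec_smul]
    congr 1
    funext a
    simp only [xi, hτ, Pi.smul_apply, smul_eq_mul]
    field_simp

/-- The scale of the coordinates of regressors and instruments. -/
noncomputable def scale (k₁ k₂ : ℕ) (m : Type*) (T : ℕ) : FIdx k₁ k₂ ⊕ m → ℝ :=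
  Sum.elim (Sum.elim (fun _ => 1) fun _ => √(T : ℝ)) fun _ => √(T : ℝ)

theorem scale_ne_zero {m : Type*} {T : ℕ} (hT : T ≠ 0) (c : FIdx k₁ k₂ ⊕ m) :
    scale k₁ k₂ m T c ≠ 0 := by
  have : √(T : ℝ) ≠ 0 := Real.sqrt_ne_zero'.2 (Nat.cast_pos.2 (Nat.pos_of_ne_zero hT))
  rcases c with (c | c) | c <;> simp [scale, this]

/-- Rescaled regressors and instruments are linear in `(γ_i, ξ_i^(1), …, ξ_i^(4))`. -/
theorem rescaled_row {m : Type*} (S : Sample k₁ k₂ kv Ω) (P : Measure Ω)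
    (lam : EuclideanSpace ℝ (FIdx k₁ k₂)) {SigF : Matrix (FIdx k₁ k₂) (FIdx k₁ k₂) ℝ}
    (hSig : SigF.det ≠ 0) {I : Fin 4 → Finset ℕ} {T τ : ℕ} (hT : T ≠ 0)
    (hτ : ∀ j, (I j).card = τ)
    (hτ0 : τ ≠ 0) {M : EuclideanSpace ℝ (FIdx k₁ k₂)}
    (hm : ∀ j, ∀ t ∈ I j, ∫ ω', S.F t ω' ∂P = M)
    {ω : Ω} (hG : ∀ j, (((I j).card : ℝ)⁻¹ • S.gramF (I j) ω).det ≠ 0) (i : ℕ)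
    (A : Matrix m (FIdx k₁ k₂) ℝ) (j j' : Fin 4) :
    (fun c => Sum.elim (S.betaHat P lam (I j) i ω)
      (A *ᵥ (S.betaHat P lam (I j) i ω - S.betaHat P lam (I j') i ω)) c * scale k₁ k₂ m T c) =
    stack (shrink k₁ k₂ (√(T : ℝ))⁻¹) A (√(T : ℝ) / √(τ : ℝ))
      (missing SigF (fun j => S.eta SigF (I j) ω) (S.covInv I ω)) (S.covInv I ω) j j' *ᵥ
        S.yvec I T i ω := by
  have hTs : √(T : ℝ) ≠ 0 := Real.sqrt_ne_zero'.2 (Nat.cast_pos.2 (Nat.pos_of_ne_zero hT))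
  have h1 := S.sqrt_smul_betaHat P lam hSig (T := T) (hτ j) hτ0 (hm j) (hG j) i
  have h2 := S.sqrt_smul_betaHat P lam hSig (T := T) (hτ j') hτ0 (hm j') (hG j') i
  rw [stack_mulVec]
  set q := firstPass (√(T : ℝ) / √(τ : ℝ)) (missing SigF (fun j => S.eta SigF (I j) ω)
    (S.covInv I ω)) (S.covInv I ω) j *ᵥ S.yvec I T i ω
  set q' := firstPass (√(T : ℝ) / √(τ : ℝ)) (missing SigF (fun j => S.eta SigF (I j) ω)
    (S.covInv I ω)) (S.covInv I ω) j' *ᵥ S.yvec I T i ω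
  have hdiff : √(T : ℝ) • (S.betaHat P lam (I j) i ω - S.betaHat P lam (I j') i ω) = q - q' := by
    rw [smul_sub, h1, h2]; abel
  funext c
  rcases c with (a | b) | c
  · have := congrFun h1 (Sum.inl a)
    simp only [Pi.smul_apply, Pi.add_apply, smul_eq_mul] at this
    simp only [scale, shrink, Sum.elim_inl, mul_one, Pi.add_apply, mulVec_diagonal, yvec, gam]
    field_simp
    linarith
  · have := congrFun h1 (Sum.inr b)
    simp only [Pi.smul_apply, Pi.add_apply, smul_eq_mul] at this
    simp only [scale, shrink, Sum.elim_inl, Sum.elim_inr, Pi.add_apply, mulVec_diagonal, yvec, gam,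
      one_mul]
    linarith
  · simp only [scale, Sum.elim_inr]
    rw [← hdiff, mulVec_smul, Pi.smul_apply, smul_eq_mul, mul_comm]

/-- The coefficients of the second group of regressors that make up for the missing factors. -/
noncomputable def nuisance {f : Type*} [Fintype f] {kv : ℕ} (lt : f → ℝ) (ev : Fin kv → ℝ) (s : ℝ)
    (H : Matrix f (Fin kv) ℝ) (Binv : Matrix (Fin kv) (Fin kv) ℝ) : Fin kv → ℝ :=
  (ev - s • (lt ᵥ* H)) ᵥ* Binv

/-- The coefficients of the first-pass errors in the structural error of the second pass. -/
noncomputable def errCoef {f : Type*} [Fintype f] {kv : ℕ} (lt : f → ℝ) (z : Fin kv → ℝ)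
    (A : Matrix (Fin kv) f ℝ) (K : Fin 4 → Matrix f f ℝ) (j j' : Fin 4) : YIdx f (Fin kv) → ℝ :=
  Sum.elim 0 fun ib => (if ib.1 = j then ((lt + z ᵥ* A) ᵥ* K j) ib.2 else 0)
    - if ib.1 = j' then ((z ᵥ* A) ᵥ* K j') ib.2 else 0

theorem vecMul_stack_nuisance {f : Type*} [Fintype f] [DecidableEq f] {kv : ℕ} {D : Matrix f f ℝ}
    {A : Matrix (Fin kv) f ℝ} {s : ℝ} {H : Fin 4 → Matrix f (Fin kv) ℝ} {K : Fin 4 → Matrix f f ℝ}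
    {j j' : Fin 4} {x lt : f → ℝ} (hx : x ᵥ* D = lt) (ev : Fin kv → ℝ)
    (hB : (s • (A * (H j - H j'))).det ≠ 0) :
    Sum.elim x (nuisance lt ev s (H j) (s • (A * (H j - H j')))⁻¹) ᵥ* stack D A s H K j j' =
      Sum.elim (Sum.elim x ev) 0 +
        errCoef lt (nuisance lt ev s (H j) (s • (A * (H j - H j')))⁻¹) A K j j' := by
  set z := nuisance lt ev s (H j) (s • (A * (H j - H j')))⁻¹ with hz
  have hzB : z ᵥ* (s • (A * (H j - H j'))) = ev - s • (lt ᵥ* H j) := by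
    rw [hz, nuisance, vecMul_vecMul, nonsing_inv_mul _ (isUnit_iff_ne_zero.2 hB), vecMul_one]
  rw [vecMul_stack, hx]
  simp only [vecMul_firstPass]
  funext k
  rcases k with (a | c) | ⟨i, b⟩
  · simp [errCoef]
  · have h := congrFun hzB c
    simp only [vecMul_smul, ← vecMul_vecMul, vecMul_sub, Pi.smul_apply, Pi.sub_apply,
      smul_eq_mul] at h
    simp only [errCoef, Pi.add_apply, Pi.sub_apply, Sum.elim_inl, Sum.elim_inr, Pi.zero_apply,
      Pi.smul_apply, smul_eq_mul, zero_add, add_zero]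
    linarith
  · simp only [errCoef, Pi.add_apply, Pi.sub_apply, Sum.elim_inr, Pi.zero_apply, zero_add,
      add_vecMul]
    split_ifs <;> ring

theorem sqrt_mul_avgRet (S : Sample k₁ k₂ kv Ω) (P : Measure Ω)
    (lam : EuclideanSpace ℝ (FIdx k₁ k₂)) {N T : ℕ} (hT : T ≠ 0) (ω : Ω) (i : Fin N) :
    √(T : ℝ) * S.avgRet P lam N T ω i = √(T : ℝ) * ∑ a, S.lamTilde P lam T ω a * S.β i a
      + ∑ c, S.etaV T ω c * S.μ i c + S.errBar T i ω := by
  have hTr : (T : ℝ) ≠ 0 := Nat.cast_ne_zero.2 hT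
  have hTT : √(T : ℝ) * √(T : ℝ) = T := Real.mul_self_sqrt (Nat.cast_nonneg T)
  have hTs : √(T : ℝ) ≠ 0 := fun h => hTr (by rw [← hTT, h, mul_zero])
  have hinv : √(T : ℝ) * (T : ℝ)⁻¹ = (√(T : ℝ))⁻¹ := by
    rw [eq_comm, inv_eq_iff_eq_inv, mul_inv, inv_inv, eq_comm, inv_mul_eq_iff_eq_mul₀ hTs, hTT]
  have h1 : ∀ t, S.ret P lam i t ω = ∑ a, lam a * S.β i a
      + ∑ a, (S.F t ω - ∫ ω', S.F t ω' ∂P) a * S.β i a + ∑ c, S.v t ω c * S.μ i c + S.e i t ω := by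
    intro t
    rw [ret]
    simp only [EuclideanSpace.inner_eq_star_dotProduct, dotProduct, star_trivial]
    congr 2
    · congr 1 <;> exact Finset.sum_congr rfl fun b _ => mul_comm _ _
    · exact Finset.sum_congr rfl fun b _ => mul_comm _ _
  have h2 : ∑ a, S.lamTilde P lam T ω a * S.β i a = ∑ a, lam a * S.β i a
      + (T : ℝ)⁻¹ * ∑ t ∈ Finset.range T,
        ∑ a, (S.F t ω - ∫ ω', S.F t ω' ∂P) a * S.β i a := by
    rw [Finset.sum_comm, Finset.mul_sum, ← Finset.sum_add_distrib]
    refine Finset.sum_congr rfl fun a _ => ?_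
    simp only [lamTilde, PiLp.add_apply, PiLp.smul_apply, WithLp.ofLp_sum, Finset.sum_apply,
      smul_eq_mul, add_mul, Finset.sum_mul, mul_assoc]
  have h3 : ∑ c, S.etaV T ω c * S.μ i c
      = (√(T : ℝ))⁻¹ * ∑ t ∈ Finset.range T, ∑ c, S.v t ω c * S.μ i c := by
    rw [Finset.sum_comm, Finset.mul_sum]
    refine Finset.sum_congr rfl fun c _ => ?_
    simp only [etaV, PiLp.smul_apply, WithLp.ofLp_sum, Finset.sum_apply, smul_eq_mul,
      Finset.sum_mul, mul_assoc]
  rw [avgRet, h2, h3, errBar]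
  simp only [h1, Finset.sum_add_distrib, Finset.sum_const, Finset.card_range, nsmul_eq_mul]
  rw [← hinv]
  field_simp

/-- The error of the `j`-th instrumental variables estimator relative to the ex-post risk
premia. -/
theorem lamHat_error (S : Sample k₁ k₂ kv Ω) (P : Measure Ω)
    (lam : EuclideanSpace ℝ (FIdx k₁ k₂)) {SigF : Matrix (FIdx k₁ k₂) (FIdx k₁ k₂) ℝ}
    (hSig : SigF.det ≠ 0) (A : Fin 4 → Matrix (Fin kv) (FIdx k₁ k₂) ℝ) {I : Fin 4 → Finset ℕ}
    {N T τ : ℕ} (hN : N ≠ 0) (hT : T ≠ 0) (hτ : ∀ j, (I j).card = τ)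
    (hτ0 : τ ≠ 0) {m : EuclideanSpace ℝ (FIdx k₁ k₂)}
    (hm : ∀ j, ∀ t ∈ I j, ∫ ω', S.F t ω' ∂P = m)
    {ω : Ω} (hG : ∀ j, (((I j).card : ℝ)⁻¹ • S.gramF (I j) ω).det ≠ 0) (j : Fin 4)
    {D : Matrix (FIdx k₁ k₂) (FIdx k₁ k₂) ℝ} (hD : D = shrink k₁ k₂ (√(T : ℝ))⁻¹)
    {s : ℝ} (hs : s = √(T : ℝ) / √(τ : ℝ)) {K : Fin 4 → Matrix (FIdx k₁ k₂) (FIdx k₁ k₂) ℝ}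
    (hK : K = S.covInv I ω) {H : Fin 4 → Matrix (FIdx k₁ k₂) (Fin kv) ℝ}
    (hH : H = missing SigF (fun j => S.eta SigF (I j) ω) K)
    {L : Matrix (GIdx k₁ k₂ kv) (YIdx (FIdx k₁ k₂) (Fin kv)) ℝ}
    (hL : L = stack D (A j) s H K j (j + 1))
    {L' : Matrix (FIdx k₁ k₂ ⊕ FIdx k₁ k₂) (YIdx (FIdx k₁ k₂) (Fin kv)) ℝ}
    (hL' : L' = stack D 1 s H K (j + 2) (j + 3))
    {M : Matrix (YIdx (FIdx k₁ k₂) (Fin kv)) (YIdx (FIdx k₁ k₂) (Fin kv)) ℝ}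
    (hM : M = S.moment I N T ω)
    (hB : (s • (A j * (H j - H (j + 1)))).det ≠ 0)
    (hW : (L' * M * L'ᵀ).det ≠ 0)
    (hC : ((L * M * L'ᵀ) * (L' * M * L'ᵀ)⁻¹ * (L * M * L'ᵀ)ᵀ).det ≠ 0) (c : FIdx k₁ k₂) :
    (scale k₁ k₂ (Fin kv) T (Sum.inl c))⁻¹ * √(T : ℝ) *
      (S.lamHat P lam A I N T j ω c - S.lamTilde P lam T ω c) =
    (gain (L * M * L'ᵀ) (L' * M * L'ᵀ) *ᵥ (L' *ᵥ (S.errMoment I N T ω -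
      M *ᵥ errCoef (S.lamTilde P lam T ω).ofLp (nuisance (S.lamTilde P lam T ω).ofLp
        (S.etaV T ω).ofLp s (H j)
        (s • (A j * (H j - H (j + 1))))⁻¹) (A j) K j (j + 1)))) (Sum.inl c) := by
  have hTs : √(T : ℝ) ≠ 0 := Real.sqrt_ne_zero'.2 (Nat.cast_pos.2 (Nat.pos_of_ne_zero hT))
  set lt : FIdx k₁ k₂ → ℝ := (S.lamTilde P lam T ω).ofLp with hlt
  set ev : Fin kv → ℝ := (S.etaV T ω).ofLp with hev
  set z := nuisance lt ev s (H j) (s • (A j * (H j - H (j + 1))))⁻¹ with hz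
  set x : FIdx k₁ k₂ → ℝ := Sum.elim (fun a => √(T : ℝ) * lt (Sum.inl a)) fun b => lt (Sum.inr b)
    with hxdef
  have hxD : x ᵥ* D = lt := by
    funext a
    rw [hD, shrink, vecMul_diagonal]
    rcases a with a | b
    · simp only [hxdef, Sum.elim_inl]; field_simp
    · simp [hxdef]
  have hvec := vecMul_stack_nuisance (K := K) hxD ev hB
  rw [← hz, ← hL] at hvec
  set X := S.regressors P lam A I N j ω * diagonal (scale k₁ k₂ (Fin kv) T) with hX
  set Z := S.instruments P lam I N j ω * diagonal (scale k₁ k₂ (FIdx k₁ k₂) T) with hZ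
  have hXrow : ∀ i : Fin N, X i = L *ᵥ S.yvec I T i ω := by
    intro i
    rw [hL, hD, hs, hH, hK, ← S.rescaled_row P lam hSig hT hτ hτ0 hm hG i (A j) j (j + 1)]
    funext c
    rw [hX, mul_diagonal]
    rfl
  have hZrow : ∀ i : Fin N, Z i = L' *ᵥ S.yvec I T i ω := by
    intro i
    rw [hL', hD, hs, hH, hK, ← S.rescaled_row P lam hSig hT hτ hτ0 hm hG i 1 (j + 2) (j + 3)]
    funext c
    rw [hZ, mul_diagonal, one_mulVec]
    rfl
  have hYrow : ∀ i : Fin N, (√(T : ℝ) • S.avgRet P lam N T ω) i = X i ⬝ᵥ Sum.elim x z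
      + (S.errBar T i ω - S.yvec I T i ω ⬝ᵥ errCoef lt z (A j) K j (j + 1)) := by
    intro i
    rw [hXrow, dotProduct_comm (L *ᵥ _), dotProduct_mulVec, hvec, add_dotProduct,
      dotProduct_comm _ (errCoef _ _ _ _ _ _), Pi.smul_apply, smul_eq_mul,
      S.sqrt_mul_avgRet P lam hT]
    have h1 : Sum.elim (Sum.elim x ev) 0 ⬝ᵥ S.yvec I T i ω
        = √(T : ℝ) * ∑ a, lt a * S.β i a + ∑ c, ev c * S.μ i c := by
      rw [yvec, sumElim_dotProduct_sumElim, zero_dotProduct, add_zero]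
      simp only [dotProduct, Fintype.sum_sum_type, gam, Sum.elim_inl, Sum.elim_inr, hxdef, mul_add,
        Finset.mul_sum]
      congr 2
      · exact Finset.sum_congr rfl fun a _ => by ring
      · exact Finset.sum_congr rfl fun a _ => by ring
    rw [h1]
    ring
  have key := tsls_error hN hXrow hZrow (M := M) (r := S.errMoment I N T ω)
    (ε := fun i => S.errBar T i ω) (by rw [hM]; intro a b; rfl) (fun a => rfl) hYrow hW hC
  rw [tsls_smul, hX, hZ, tsls_mul_diagonal _ _ _ (scale_ne_zero hT) (scale_ne_zero hT)] at key
  have hc := congrFun key (Sum.inl c)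
  simp only [Pi.smul_apply, Pi.add_apply, smul_eq_mul, Sum.elim_inl] at hc
  have hxc : x c = (scale k₁ k₂ (Fin kv) T (Sum.inl c))⁻¹ * √(T : ℝ) * lt c := by
    rcases c with a | b
    · simp [hxdef, scale]
    · simp only [hxdef, scale, Sum.elim_inl, Sum.elim_inr]; field_simp
  rw [hxc] at hc
  have hlam : S.lamHat P lam A I N T j ω c = tsls (S.regressors P lam A I N j ω)
      (S.instruments P lam I N j ω) (S.avgRet P lam N T ω) (Sum.inl c) := rfl
  rw [hlam]
  linarith

end Sample

/-! ### Continuity and nonsingularity at the limit -/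

section RegularSet

open Matrix

theorem continuousOn_matrix_inv {α n : Type*} [TopologicalSpace α] [Fintype n] [DecidableEq n]
    {f : α → Matrix n n ℝ} {s : Set α} (hf : ContinuousOn f s) (hs : ∀ x ∈ s, (f x).det ≠ 0) :
    ContinuousOn (fun x => (f x)⁻¹) s := by
  have hdet : ContinuousOn (fun x => (f x).det) s :=
    (continuous_id.matrix_det (A := fun M : Matrix n n ℝ => M)).comp_continuousOn hf
  have hadj : ContinuousOn (fun x => (f x).adjugate) s :=
    (continuous_id.matrix_adjugate (A := fun M : Matrix n n ℝ => M)).comp_continuousOn hf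
  simp only [inv_def, Ring.inverse_eq_inv']
  exact (hdet.inv₀ hs).smul hadj

theorem continuousOn_matrix_mul {α l m n : Type*} [TopologicalSpace α] [Fintype m] {s : Set α}
    {f : α → Matrix l m ℝ} {g : α → Matrix m n ℝ} (hf : ContinuousOn f s) (hg : ContinuousOn g s) :
    ContinuousOn (fun x => f x * g x) s := by
  rw [continuousOn_iff_continuous_domRestrict] at hf hg ⊢
  exact hf.matrix_mul hg

theorem continuousOn_matrix_elem {α m n : Type*} [TopologicalSpace α] {s : Set α}
    {f : α → Matrix m n ℝ} (hf : ContinuousOn f s) (i : m) (k : n) :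
    ContinuousOn (fun x => f x i k) s := by
  rw [continuousOn_iff_continuous_domRestrict] at hf ⊢
  exact hf.matrix_elem i k

/-- The subsamples that enter the regressors are distinct from those that enter the instruments. -/
theorem cyclic_ne : ∀ j : Fin 4, j ≠ j + 1 ∧ j + 2 ≠ j + 3 ∧ j ≠ j + 2 ∧ j ≠ j + 3 ∧
    j + 1 ≠ j + 2 ∧ j + 1 ≠ j + 3 := by
  decide

variable {k₁ k₂ kv : ℕ}

/-- The random quantities on which regressors and instruments depend, up to normalizations: the
`η_j`, the second moments of `(γ_i, ξ_i^(1), …, ξ_i^(4))`, the inverse covariance matrices of the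
factors on the four subsamples, `1 / √T`, and the square root of the ratio of `T` to the size of the
subsamples. -/
abbrev Params (k₁ k₂ kv : ℕ) : Type :=
  (Fin 4 → EuclideanSpace ℝ (FIdx k₁ k₂ × Fin kv)) ×
    Matrix (YIdx (FIdx k₁ k₂) (Fin kv)) (YIdx (FIdx k₁ k₂) (Fin kv)) ℝ ×
      (Fin 4 → Matrix (FIdx k₁ k₂) (FIdx k₁ k₂) ℝ) × ℝ × ℝ

namespace Params

variable (SigF : Matrix (FIdx k₁ k₂) (FIdx k₁ k₂) ℝ) {m : Type*}

/-- The contributions of the missing factors to the first pass. -/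
noncomputable def hMat (u : Params k₁ k₂ kv) : Fin 4 → Matrix (FIdx k₁ k₂) (Fin kv) ℝ :=
  Sample.missing SigF u.1 u.2.2.1

/-- The matrix of rescaled regressors or instruments with respect to
`(γ_i, ξ_i^(1), …, ξ_i^(4))`. -/
noncomputable def rowMat (A : Matrix m (FIdx k₁ k₂) ℝ) (j j' : Fin 4) (u : Params k₁ k₂ kv) :
    Matrix (FIdx k₁ k₂ ⊕ m) (YIdx (FIdx k₁ k₂) (Fin kv)) ℝ :=
  stack (Sample.shrink k₁ k₂ u.2.2.2.1) A u.2.2.2.2 (hMat SigF u) u.2.2.1 j j'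

theorem continuous_hMat (j : Fin 4) :
    Continuous fun u : Params k₁ k₂ kv => hMat SigF u j := by
  have h1 : Continuous fun u : Params k₁ k₂ kv => unvec (u.1 j) :=
    continuous_unvec.comp ((continuous_apply j).comp continuous_fst)
  have h2 : Continuous fun u : Params k₁ k₂ kv => u.2.2.1 j := by fun_prop
  exact h2.matrix_mul (continuous_const.matrix_mul h1)

theorem continuous_rowMat (A : Matrix m (FIdx k₁ k₂) ℝ) (j j' : Fin 4) :
    Continuous fun u : Params k₁ k₂ kv => rowMat SigF A j j' u := by
  have hfp : ∀ j, Continuous fun u : Params k₁ k₂ kv =>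
      firstPass u.2.2.2.2 (hMat SigF u) u.2.2.1 j := by
    intro j
    refine continuous_matrix fun a k => ?_
    rcases k with (b | c) | ⟨i, b⟩
    · exact continuous_const
    · have h2 : Continuous fun u : Params k₁ k₂ kv => hMat SigF u j a c :=
        (continuous_hMat SigF j).matrix_elem a c
      have h3 : Continuous fun u : Params k₁ k₂ kv => u.2.2.2.2 := by fun_prop
      exact h3.mul h2
    · have h2 : Continuous fun u : Params k₁ k₂ kv => u.2.2.1 j a b :=
        Continuous.matrix_elem (A := fun u : Params k₁ k₂ kv => u.2.2.1 j) (by fun_prop) a b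
      by_cases hij : i = j
      · simpa [firstPass, hij] using h2
      · simpa [firstPass, hij] using continuous_const
  have hD : Continuous fun u : Params k₁ k₂ kv => Sample.shrink k₁ k₂ u.2.2.2.1 := by
    refine Continuous.matrix_diagonal (continuous_pi fun a => ?_)
    rcases a with a | b
    · simp only [Sum.elim_inl]; fun_prop
    · exact continuous_const
  have h1 : Continuous fun u : Params k₁ k₂ kv =>
      (fromCols (fromCols 1 0) 0 : Matrix (FIdx k₁ k₂) (YIdx (FIdx k₁ k₂) (Fin kv)) ℝ)
        + Sample.shrink k₁ k₂ u.2.2.2.1 * firstPass u.2.2.2.2 (hMat SigF u) u.2.2.1 j :=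
    continuous_const.add (hD.matrix_mul (hfp j))
  have h2 : Continuous fun u : Params k₁ k₂ kv => A * (firstPass u.2.2.2.2 (hMat SigF u) u.2.2.1 j
      - firstPass u.2.2.2.2 (hMat SigF u) u.2.2.1 j') :=
    continuous_const.matrix_mul ((hfp j).sub (hfp j'))
  refine continuous_matrix fun a k => ?_
  rcases a with a | a
  · exact h1.matrix_elem a k
  · exact h2.matrix_elem a k

variable (A : Fin 4 → Matrix (Fin kv) (FIdx k₁ k₂) ℝ) (j : Fin 4)

/-- The rescaled cross moments of regressors and instruments. -/
noncomputable def crossMat (u : Params k₁ k₂ kv) :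
    Matrix (GIdx k₁ k₂ kv) (FIdx k₁ k₂ ⊕ FIdx k₁ k₂) ℝ :=
  rowMat SigF (A j) j (j + 1) u * u.2.1 *
    (rowMat SigF (1 : Matrix (FIdx k₁ k₂) (FIdx k₁ k₂) ℝ) (j + 2) (j + 3) u)ᵀ

/-- The rescaled second moments of the instruments. -/
noncomputable def instrMat (u : Params k₁ k₂ kv) :
    Matrix (FIdx k₁ k₂ ⊕ FIdx k₁ k₂) (FIdx k₁ k₂ ⊕ FIdx k₁ k₂) ℝ :=
  rowMat SigF (1 : Matrix (FIdx k₁ k₂) (FIdx k₁ k₂) ℝ) (j + 2) (j + 3) u * u.2.1 *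
    (rowMat SigF (1 : Matrix (FIdx k₁ k₂) (FIdx k₁ k₂) ℝ) (j + 2) (j + 3) u)ᵀ

/-- The coefficients of the missing factors in the second group of regressors. -/
noncomputable def diffMat (u : Params k₁ k₂ kv) : Matrix (Fin kv) (Fin kv) ℝ :=
  u.2.2.2.2 • (A j * (hMat SigF u j - hMat SigF u (j + 1)))

/-- The parameters at which the `j`-th regression is well posed. -/
def regularSet : Set (Params k₁ k₂ kv) :=
  {u | (instrMat SigF j u).det ≠ 0 ∧
    (crossMat SigF A j u * (instrMat SigF j u)⁻¹ * (crossMat SigF A j u)ᵀ).det ≠ 0 ∧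
    (diffMat SigF A j u).det ≠ 0}

theorem continuous_crossMat : Continuous (crossMat SigF A j) := by
  have hM : Continuous fun u : Params k₁ k₂ kv => u.2.1 := by fun_prop
  exact ((continuous_rowMat SigF _ _ _).matrix_mul hM).matrix_mul
    (continuous_rowMat SigF _ _ _).matrix_transpose

theorem continuous_instrMat : Continuous (instrMat SigF (kv := kv) j) := by
  have hM : Continuous fun u : Params k₁ k₂ kv => u.2.1 := by fun_prop
  exact ((continuous_rowMat SigF _ _ _).matrix_mul hM).matrix_mul
    (continuous_rowMat SigF _ _ _).matrix_transpose

theorem continuous_diffMat : Continuous (diffMat SigF A j) := by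
  have hs : Continuous fun u : Params k₁ k₂ kv => u.2.2.2.2 := by fun_prop
  exact hs.smul (continuous_const.matrix_mul
    ((continuous_hMat SigF _).sub (continuous_hMat SigF _)))

theorem continuousOn_instrMat_inv : ContinuousOn (fun u => (instrMat SigF (kv := kv) j u)⁻¹)
    {u | (instrMat SigF j u).det ≠ 0} :=
  continuousOn_matrix_inv (continuous_instrMat SigF j).continuousOn fun _ hu => hu

theorem continuousOn_projMat : ContinuousOn (fun u => crossMat SigF A j u * (instrMat SigF j u)⁻¹)
    {u | (instrMat SigF j u).det ≠ 0} :=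
  continuousOn_matrix_mul (continuous_crossMat SigF A j).continuousOn
    (continuousOn_instrMat_inv SigF j)

theorem continuousOn_schurMat : ContinuousOn
    (fun u => crossMat SigF A j u * (instrMat SigF j u)⁻¹ * (crossMat SigF A j u)ᵀ)
    {u | (instrMat SigF j u).det ≠ 0} :=
  continuousOn_matrix_mul (continuousOn_projMat SigF A j)
    (continuous_crossMat SigF A j).matrix_transpose.continuousOn

theorem isOpen_regularSet : IsOpen (regularSet SigF A j) := by
  have h1 : IsOpen {u : Params k₁ k₂ kv | (instrMat SigF j u).det ≠ 0} :=
    isOpen_ne.preimage (continuous_instrMat SigF j).matrix_det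
  have hdet : Continuous fun M : Matrix (GIdx k₁ k₂ kv) (GIdx k₁ k₂ kv) ℝ => M.det :=
    continuous_id.matrix_det
  have h2 := (hdet.comp_continuousOn (continuousOn_schurMat SigF A j)).isOpen_inter_preimage h1
    isOpen_ne (s := _) (t := {x : ℝ | x ≠ 0})
  have h3 : IsOpen {u : Params k₁ k₂ kv | (diffMat SigF A j u).det ≠ 0} :=
    isOpen_ne.preimage (continuous_diffMat SigF A j).matrix_det
  have : regularSet SigF A j = _ ∩ {u : Params k₁ k₂ kv | (diffMat SigF A j u).det ≠ 0} :=
    Set.ext fun u => (and_assoc (a := u ∈ {u | (instrMat SigF j u).det ≠ 0})).symm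
  rw [this]
  exact h2.inter h3

theorem continuousOn_gain : ContinuousOn
    (fun u => gain (crossMat SigF A j u) (instrMat SigF j u)) (regularSet SigF A j) := by
  have hsub : regularSet SigF A j ⊆ {u | (instrMat SigF j u).det ≠ 0} := fun u hu => hu.1
  have h1 := continuousOn_matrix_inv ((continuousOn_schurMat SigF A j).mono hsub)
    fun u hu => hu.2.1
  exact continuousOn_matrix_mul h1 ((continuousOn_projMat SigF A j).mono hsub)

theorem continuousOn_diffMat_inv :
    ContinuousOn (fun u => (diffMat SigF A j u)⁻¹) (regularSet SigF A j) :=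
  continuousOn_matrix_inv (continuous_diffMat SigF A j).continuousOn fun _ hu => hu.2.2

/-- The regressions are well posed at almost every limit point. -/
theorem ae_mem_regularSet {Γ : Matrix (GIdx k₁ k₂ kv) (GIdx k₁ k₂ kv) ℝ}
    {SigSF : Matrix (FIdx k₁ k₂) (FIdx k₁ k₂) ℝ} (hnd : Nondegenerate Γ SigSF)
    (hA : (A j).rank = kv) (hSig : SigF.det ≠ 0)
    {OmvF : Matrix (FIdx k₁ k₂ × Fin kv) (FIdx k₁ k₂ × Fin kv) ℝ} (hOm : OmvF.PosDef) :
    ∀ᵐ x ∂(Measure.pi fun _ : Fin 4 => multivariateGaussian 0 OmvF),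
      ((x, limitMoment Γ SigSF, (fun _ => SigF⁻¹), 0, 2) : Params k₁ k₂ kv) ∈
        regularSet SigF A j := by
  obtain ⟨h01, h23, h02, h03, h12, h13⟩ := cyclic_ne j
  filter_upwards [ae_det_mul_sub_ne_zero hOm (A j) hA h01, ae_det_mul_sub_ne_zero hOm (A j) hA h23]
    with x h1 h2
  set u : Params k₁ k₂ kv := (x, limitMoment Γ SigSF, (fun _ => SigF⁻¹), 0, 2) with hu
  have hH : ∀ i, hMat SigF u i = unvec (x i) := fun i => by
    rw [hMat, Sample.missing, hu, ← Matrix.mul_assoc,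
      nonsing_inv_mul _ (isUnit_iff_ne_zero.2 hSig), Matrix.one_mul]
  have hK : (u.2.2.1 (j + 3)).det ≠ 0 := by
    change (SigF⁻¹).det ≠ 0
    rw [det_nonsing_inv, Ring.inverse_eq_inv']
    exact inv_ne_zero hSig
  have hs : u.2.2.2.2 ≠ 0 := two_ne_zero
  rw [← hH, ← hH] at h1 h2
  refine ⟨det_stack_ne_zero hnd _ hs h23 hK h2, ?_, ?_⟩
  · exact det_cross_stack_ne_zero hnd _ hs h02 h03 h12 h13 h23 hK h1 h2
  · rw [diffMat, det_smul]
    exact mul_ne_zero (pow_ne_zero _ hs) h1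

end Params

end RegularSet

/-! ### The rate of the instrumental variables estimators -/

/-- The parameters of the regressions in a sample. -/
noncomputable def Sample.params {k₁ k₂ kv : ℕ} {Ω : Type*} (S : Sample k₁ k₂ kv Ω)
    (SigF : Matrix (FIdx k₁ k₂) (FIdx k₁ k₂) ℝ) (I : Fin 4 → Finset ℕ) (N T : ℕ) (ω : Ω) :
    Params k₁ k₂ kv :=
  (fun j => S.eta SigF (I j) ω, S.moment I N T ω, S.covInv I ω, (√(T : ℝ))⁻¹,
    √(T : ℝ) / √((T / 4 : ℕ) : ℝ))

/-- The coefficients of the first-pass errors in the structural error of the `j`-th second-pass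
regression. -/
noncomputable def Sample.errCoefHat {k₁ k₂ kv : ℕ} {Ω : Type*} [MeasurableSpace Ω]
    (S : Sample k₁ k₂ kv Ω) (P : Measure Ω) (lam : EuclideanSpace ℝ (FIdx k₁ k₂))
    (SigF : Matrix (FIdx k₁ k₂) (FIdx k₁ k₂) ℝ) (A : Fin 4 → Matrix (Fin kv) (FIdx k₁ k₂) ℝ)
    (I : Fin 4 → Finset ℕ) (N T : ℕ) (j : Fin 4) (ω : Ω) : YIdx (FIdx k₁ k₂) (Fin kv) → ℝ :=
  errCoef (S.lamTilde P lam T ω).ofLp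
    (nuisance (S.lamTilde P lam T ω).ofLp (S.etaV T ω).ofLp (√(T : ℝ) / √((T / 4 : ℕ) : ℝ))
      (Params.hMat SigF (S.params SigF I N T ω) j)
      (Params.diffMat SigF A j (S.params SigF I N T ω))⁻¹)
    (A j) (S.covInv I ω) j (j + 1)

theorem stack_apply_inr_of_ne {f v m : Type*} [Fintype f] [DecidableEq f] {D : Matrix f f ℝ}
    {A : Matrix m f ℝ} {s : ℝ} {H : Fin 4 → Matrix f v ℝ} {K : Fin 4 → Matrix f f ℝ}
    {i j j' : Fin 4} (hj : i ≠ j) (hj' : i ≠ j') (a : f ⊕ m) (b : f) :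
    stack D A s H K j j' a (Sum.inr (i, b)) = 0 := by
  rcases a with a | a <;> simp [stack, Matrix.mul_apply, firstPass, hj, hj']

theorem errCoef_apply_inr_of_ne {f : Type*} [Fintype f] {kv : ℕ} {lt : f → ℝ} {z : Fin kv → ℝ}
    {A : Matrix (Fin kv) f ℝ} {K : Fin 4 → Matrix f f ℝ} {i j j' : Fin 4} (hj : i ≠ j)
    (hj' : i ≠ j') (b : f) : Sample.errCoef lt z A K j j' (Sum.inr (i, b)) = 0 := by
  simp [Sample.errCoef, hj, hj']

theorem Sample.lamTilde_eq {k₁ k₂ kv : ℕ} {Ω : Type*} [MeasurableSpace Ω] (S : Sample k₁ k₂ kv Ω)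
    (P : Measure Ω) (lam : EuclideanSpace ℝ (FIdx k₁ k₂)) (T : ℕ) (ω : Ω) :
    S.lamTilde P lam T ω = lam + (√(T : ℝ))⁻¹ • S.normF P T ω := by
  rw [lamTilde, normF, smul_smul, ← mul_inv, Real.mul_self_sqrt (Nat.cast_nonneg T)]

variable {k₁ k₂ kv : ℕ} {Ω : ℕ × ℕ → Type*} [∀ p, MeasurableSpace (Ω p)]
  {P : ∀ p, Measure (Ω p)} [∀ p, IsProbabilityMeasure (P p)] {S : ∀ p, Sample k₁ k₂ kv (Ω p)}
  {lam : EuclideanSpace ℝ (FIdx k₁ k₂)} {SigF OmF SigSF : Matrix (FIdx k₁ k₂) (FIdx k₁ k₂) ℝ}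
  {OmvF : Matrix (FIdx k₁ k₂ × Fin kv) (FIdx k₁ k₂ × Fin kv) ℝ}
  {Γ : Matrix (GIdx k₁ k₂ kv) (GIdx k₁ k₂ kv) ℝ}
  {A : Fin 4 → Matrix (Fin kv) (FIdx k₁ k₂) ℝ} {I : ℕ → Fin 4 → Finset ℕ}

/-- Under stationarity the factor means are constant over time. -/
theorem Factors.integral_F_eq (hF : Factors P S SigF OmF OmvF) (p : ℕ × ℕ) {t : ℕ}
    (ht : t < p.2) : ∫ ω, (S p).F t ω ∂(P p) = ∫ ω, (S p).F 0 ω ∂(P p) := by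
  have h := hF.stationary p t 1 ht
  have h' := h.comp (u := fun x : Fin 1 → EuclideanSpace ℝ (FIdx k₁ k₂) => x 0)
    (measurable_pi_apply 0)
  exact h'.integral_eq

/-- The limit of a quadratic form in weighted second moments is nonnegative. -/
theorem ErrorAverages.nonneg {J : ℕ → Finset ℕ} (h : ErrorAverages P S SigSF J)
    (x : FIdx k₁ k₂ → ℝ) : 0 ≤ x ⬝ᵥ (SigSF.mulVec x) := by
  by_contra hneg
  rw [not_le] at hneg
  have hopen : IsOpen {M : Matrix (FIdx k₁ k₂) (FIdx k₁ k₂) ℝ | x ⬝ᵥ (M.mulVec x) < 0} :=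
    isOpen_lt (continuous_const.dotProduct (continuous_id.matrix_mulVec continuous_const))
      continuous_const
  have hw : Whp P fun p ω => (Matrix.of fun a b => ((J p.2).card : ℝ)⁻¹ * ∑ t ∈ J p.2,
      (S p).Fdem (J p.2) t ω a * (S p).Fdem (J p.2) t ω b * (S p).avgSq p.1 t ω) ∈
        {M : Matrix (FIdx k₁ k₂) (FIdx k₁ k₂) ℝ | x ⬝ᵥ (M.mulVec x) < 0} :=
    whp_mem_nhds_pi (fun a => whp_mem_nhds_pi fun b => tendstoInProb_iff_whp.1 (h.second a b)) _
      (hopen.mem_nhds hneg)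
  have hfalse : Whp P fun _ _ => False := by
    refine hw.mono (Eventually.of_forall fun p ω hω => ?_)
    have : x ⬝ᵥ ((Matrix.of fun a b => ((J p.2).card : ℝ)⁻¹ * ∑ t ∈ J p.2,
        (S p).Fdem (J p.2) t ω a * (S p).Fdem (J p.2) t ω b * (S p).avgSq p.1 t ω).mulVec x)
        = ((J p.2).card : ℝ)⁻¹ * ∑ t ∈ J p.2,
          (∑ a, x a * (S p).Fdem (J p.2) t ω a) ^ 2 * (S p).avgSq p.1 t ω := by
      simp only [dotProduct, Matrix.mulVec, Matrix.of_apply, sq, Finset.mul_sum, Finset.sum_mul]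
      conv_rhs => rw [Finset.sum_comm]
      refine Finset.sum_congr rfl fun a _ => ?_
      conv_rhs => rw [Finset.sum_comm]
      exact Finset.sum_congr rfl fun b _ => Finset.sum_congr rfl fun t _ => by ring
    refine not_lt.2 ?_ (this.symm.trans_lt hω)
    refine mul_nonneg (by positivity) (Finset.sum_nonneg fun t _ => mul_nonneg (sq_nonneg _) ?_)
    exact mul_nonneg (by positivity) (Finset.sum_nonneg fun i _ => sq_nonneg _)
  have h1 := hfalse
  simp only [Whp, not_false_eq_true, Set.ofPred_true, measure_univ] at h1
  exact one_ne_zero (tendsto_nhds_unique tendsto_const_nhds h1)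

theorem nondegenerate (hL : Loadings S Γ) (hES : ErrorsOnSplit P S SigSF I)
    (hA : (A 0).rank = kv) : Nondegenerate Γ SigSF := by
  refine ⟨hL.posDef, (hES.averages 0).nonneg, ?_⟩
  have hle : kv ≤ k₁ + k₂ := by
    simpa [hA] using (A 0).rank_le_card_width
  rcases hle.lt_or_eq with h | h
  · exact Or.inl (hES.posDef h)
  · exact Or.inr (by simp [h])

theorem whp_mem_cov (hFS : FactorsOnSplit P S SigF OmvF I) (j : Fin 4) :
    ∀ V ∈ 𝓝 SigF, Whp P fun p ω =>
      ((I p.2 j).card : ℝ)⁻¹ • (S p).gramF (I p.2 j) ω ∈ V :=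
  whp_mem_nhds_pi fun a => whp_mem_nhds_pi fun b => tendstoInProb_iff_whp.1 (hFS.lln j a b)

theorem whp_det_cov_ne_zero (hSig : SigF.det ≠ 0) (hFS : FactorsOnSplit P S SigF OmvF I) :
    Whp P fun p ω => ∀ j, (((I p.2 j).card : ℝ)⁻¹ • (S p).gramF (I p.2 j) ω).det ≠ 0 :=
  whp_forall fun j => whp_mem_cov hFS j _
    ((isOpen_ne.preimage continuous_id.matrix_det).mem_nhds hSig)

theorem whp_mem_covInv (hSig : SigF.det ≠ 0) (hFS : FactorsOnSplit P S SigF OmvF I) :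
    ∀ V ∈ 𝓝 (fun _ : Fin 4 => SigF⁻¹), Whp P fun p ω => (S p).covInv (I p.2) ω ∈ V := by
  refine whp_mem_nhds_pi fun j V hV => ?_
  have hopen : IsOpen {M : Matrix (FIdx k₁ k₂) (FIdx k₁ k₂) ℝ | M.det ≠ 0} :=
    isOpen_ne.preimage continuous_id.matrix_det
  have hcont : ContinuousAt (fun M : Matrix (FIdx k₁ k₂) (FIdx k₁ k₂) ℝ => M⁻¹) SigF :=
    (continuousOn_matrix_inv continuousOn_id fun M hM => hM).continuousAt (hopen.mem_nhds hSig)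
  exact whp_mem_cov hFS j _ (hcont hV)

theorem tendsto_sqrt_div_sqrt_split_size :
    Tendsto (fun p : ℕ × ℕ => √(p.2 : ℝ) / √((p.2 / 4 : ℕ) : ℝ)) atTop (𝓝 2) := by
  have h := (Real.continuous_sqrt.tendsto 4).comp tendsto_div_split_size
  have h4 : √(4 : ℝ) = 2 := by
    rw [show (4 : ℝ) = 2 ^ 2 by norm_num, Real.sqrt_sq (by norm_num)]
  rw [h4] at h
  exact h.congr fun p => Real.sqrt_div (Nat.cast_nonneg _) _

theorem tendsto_inv_sqrt_snd : Tendsto (fun p : ℕ × ℕ => (√(p.2 : ℝ))⁻¹) atTop (𝓝 0) :=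
  tendsto_inv_atTop_zero.comp (Real.tendsto_sqrt_atTop.comp
    (tendsto_natCast_atTop_atTop.comp tendsto_snd_atTop))

section Rate

variable (hA : ∀ j, (A j).rank = kv) (hI : IsFourSplit I) (hM : PricingModel P S)
  (hF : Factors P S SigF OmF OmvF) (hFS : FactorsOnSplit P S SigF OmvF I) (hL : Loadings S Γ)
  (hE : Errors P S SigSF) (hES : ErrorsOnSplit P S SigSF I)

include hI hM hF hFS hL hE hES in
theorem whp_mem_params : ∀ V ∈ 𝓝 ((limitMoment Γ SigSF, (fun _ => SigF⁻¹), 0, 2) :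
    Matrix (YIdx (FIdx k₁ k₂) (Fin kv)) (YIdx (FIdx k₁ k₂) (Fin kv)) ℝ ×
      (Fin 4 → Matrix (FIdx k₁ k₂) (FIdx k₁ k₂) ℝ) × ℝ × ℝ),
    Whp P fun p ω => ((S p).params SigF (I p.2) p.1 p.2 ω).2 ∈ V :=
  whp_mem_nhds_prod (whp_moment hI hM hE hES.averages hL)
    (whp_mem_nhds_prod (whp_mem_covInv hF.posDef_SigF.det_pos.ne' hFS)
      (whp_mem_nhds_prod (whp_mem_nhds_of_tendsto tendsto_inv_sqrt_snd)
        (whp_mem_nhds_of_tendsto tendsto_sqrt_div_sqrt_split_size)))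

include hA hI hM hF hFS hL hE hES in
theorem isBigOp_params {j : Fin 4} {h : Params k₁ k₂ kv → ℝ}
    (hh : ContinuousOn h (Params.regularSet SigF A j)) :
    IsBigOp P (fun p ω => h ((S p).params SigF (I p.2) p.1 p.2 ω)) fun _ => 1 :=
  have := Measure.Regular.of_sigmaCompactSpace_of_isLocallyFiniteMeasure
    (Measure.pi fun _ : Fin 4 => multivariateGaussian 0 OmvF)
  isBigOp_one_of_tendstoInDistribution hFS.clt (whp_mem_params hI hM hF hFS hL hE hES)
    (Params.isOpen_regularSet SigF A j)
    (Params.ae_mem_regularSet SigF A j (nondegenerate hL hES (hA 0)) (hA j)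
      hF.posDef_SigF.det_pos.ne' hFS.posDef) hh

include hA hI hM hF hFS hL hE hES in
theorem whp_params_mem_regularSet (j : Fin 4) : Whp P fun p ω =>
    (S p).params SigF (I p.2) p.1 p.2 ω ∈ Params.regularSet SigF A j :=
  have := Measure.Regular.of_sigmaCompactSpace_of_isLocallyFiniteMeasure
    (Measure.pi fun _ : Fin 4 => multivariateGaussian 0 OmvF)
  whp_mem_of_tendstoInDistribution hFS.clt (whp_mem_params hI hM hF hFS hL hE hES)
    (Params.isOpen_regularSet SigF A j)
    (Params.ae_mem_regularSet SigF A j (nondegenerate hL hES (hA 0)) (hA j)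
      hF.posDef_SigF.det_pos.ne' hFS.posDef)

include hF in
theorem isBigOp_normF (a : FIdx k₁ k₂) :
    IsBigOp P (fun p ω => (S p).normF (P p) p.2 ω a) fun _ => 1 := by
  obtain ⟨ν, -, -, -, hν⟩ := hF.clt
  have := Measure.Regular.of_sigmaCompactSpace_of_isLocallyFiniteMeasure ν.toMeasure
  exact TendstoInDistribution.isBigOp_comp hν (h := fun x => x.1 a) (by fun_prop)

include hF in
theorem isBigOp_etaV (c : Fin kv) :
    IsBigOp P (fun p ω => (S p).etaV p.2 ω c) fun _ => 1 := by
  obtain ⟨ν, -, -, -, hν⟩ := hF.clt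
  have := Measure.Regular.of_sigmaCompactSpace_of_isLocallyFiniteMeasure ν.toMeasure
  exact TendstoInDistribution.isBigOp_comp hν (h := fun x => x.2.2 c) (by fun_prop)

omit [∀ p, IsProbabilityMeasure (P p)] in
theorem isBigOp_const (x : ℝ) : IsBigOp P (fun _ _ => x) fun _ => 1 := by
  intro ε hε
  refine ⟨‖x‖, Eventually.of_forall fun p => ?_⟩
  simp

include hF in
theorem isBigOp_lamTilde_sub (a : FIdx k₁ k₂) :
    IsBigOp P (fun p ω => (S p).lamTilde (P p) lam p.2 ω a - lam a) fun p => 1 / √(p.2 : ℝ) := by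
  refine ((isBigOp_normF hF a).smul_of_le (c := fun p => (√(p.2 : ℝ))⁻¹)
    (b := fun p => 1 / √(p.2 : ℝ)) (C := 1) (Eventually.of_forall fun p => zero_le_one) ?_).of_le ?_
  · refine Eventually.of_forall fun p => ?_
    rw [abs_of_nonneg (by positivity)]
    simp
  · refine Eventually.of_forall fun p ω => ?_
    simp [Sample.lamTilde_eq]

include hF in
theorem isBigOp_lamTilde (a : FIdx k₁ k₂) :
    IsBigOp P (fun p ω => (S p).lamTilde (P p) lam p.2 ω a) fun _ => 1 := by
  have h := ((isBigOp_lamTilde_sub (lam := lam) hF a).tendstoInProb (by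
    simpa only [one_div] using tendsto_inv_sqrt_snd)).isBigOp_one
  refine (h.add (isBigOp_const (lam a))).of_le (Eventually.of_forall fun p ω => ?_)
  simp

omit [∀ p, IsProbabilityMeasure (P p)] in
open Matrix in
theorem isBigOp_vecMul {m n : Type*} [Fintype m] {x : ∀ p, Ω p → m → ℝ}
    {M : ∀ p, Ω p → Matrix m n ℝ} {a : ℕ × ℕ → ℝ} (hx : ∀ i, IsBigOp P (fun p ω => x p ω i) a)
    (hM : ∀ i k, IsBigOp P (fun p ω => M p ω i k) fun _ => 1) (k : n) :
    IsBigOp P (fun p ω => (x p ω ᵥ* M p ω) k) a :=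
  IsBigOp.sum _ fun i _ => (hx i).mul_one (hM i k)

include hA hI hM hF hFS hL hE hES in
theorem isBigOp_rowMat {m : Type*} (B : Matrix m (FIdx k₁ k₂) ℝ) (j j' : Fin 4)
    (a : FIdx k₁ k₂ ⊕ m) (k : YIdx (FIdx k₁ k₂) (Fin kv)) :
    IsBigOp P (fun p ω => Params.rowMat SigF B j j' ((S p).params SigF (I p.2) p.1 p.2 ω) a k)
      fun _ => 1 :=
  isBigOp_params hA hI hM hF hFS hL hE hES (j := 0)
    ((Params.continuous_rowMat SigF B j j').matrix_elem a k).continuousOn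

include hA hI hM hF hFS hL hE hES in
theorem isBigOp_nuisance (j : Fin 4) (c : Fin kv) :
    IsBigOp P (fun p ω => Sample.nuisance ((S p).lamTilde (P p) lam p.2 ω).ofLp
      ((S p).etaV p.2 ω).ofLp (√(p.2 : ℝ) / √((p.2 / 4 : ℕ) : ℝ))
      (Params.hMat SigF ((S p).params SigF (I p.2) p.1 p.2 ω) j)
      (Params.diffMat SigF A j ((S p).params SigF (I p.2) p.1 p.2 ω))⁻¹ c) fun _ => 1 := by
  have hinv : ∀ i k, IsBigOp P (fun p ω =>
      (Params.diffMat SigF A j ((S p).params SigF (I p.2) p.1 p.2 ω))⁻¹ i k) fun _ => 1 :=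
    fun i k => isBigOp_params hA hI hM hF hFS hL hE hES (j := j)
      (h := fun u => (Params.diffMat SigF A j u)⁻¹ i k)
      (continuousOn_matrix_elem (Params.continuousOn_diffMat_inv SigF A j) i k)
  have hH : ∀ i k, IsBigOp P (fun p ω =>
      Params.hMat SigF ((S p).params SigF (I p.2) p.1 p.2 ω) j i k) fun _ => 1 :=
    fun i k => isBigOp_params hA hI hM hF hFS hL hE hES (j := j)
      ((Params.continuous_hMat SigF j).matrix_elem i k).continuousOn
  have hs : IsBigOp P (fun p _ => √(p.2 : ℝ) / √((p.2 / 4 : ℕ) : ℝ)) fun _ => 1 :=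
    isBigOp_params hA hI hM hF hFS hL hE hES (j := j) (h := fun u => u.2.2.2.2)
      (by fun_prop)
  exact isBigOp_vecMul (fun i => (isBigOp_etaV hF i).sub
    (hs.mul_one (isBigOp_vecMul (isBigOp_lamTilde hF) hH i))) hinv c

include hA hI hM hF hFS hL hE hES in
theorem isBigOp_errCoef (j : Fin 4) (k : YIdx (FIdx k₁ k₂) (Fin kv)) :
    IsBigOp P (fun p ω => (S p).errCoefHat (P p) lam SigF A (I p.2) p.1 p.2 j ω k) fun _ => 1 := by
  rcases k with b | ⟨i, b⟩
  · exact isBigOp_zero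
  have hK : ∀ j a b, IsBigOp P (fun p ω => (S p).covInv (I p.2) ω j a b) fun _ => 1 :=
    fun j' a b => isBigOp_params hA hI hM hF hFS hL hE hES (j := j)
      (h := fun u => u.2.2.1 j' a b)
      (Continuous.matrix_elem (A := fun u : Params k₁ k₂ kv => u.2.2.1 j')
        (by fun_prop) a b).continuousOn
  have hzA := isBigOp_vecMul (M := fun _ _ => A j)
    (isBigOp_nuisance hA hI hM hF hFS hL hE hES (lam := lam) j) fun i k => isBigOp_const _
  simp only [Sample.errCoefHat, Sample.errCoef, Sum.elim_inr]
  refine IsBigOp.sub ?_ ?_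
  · split_ifs
    · exact isBigOp_vecMul (fun a => (isBigOp_lamTilde hF a).add (hzA a)) (hK j) b
    · exact isBigOp_zero
  · split_ifs
    · exact isBigOp_vecMul hzA (hK (j + 1)) b
    · exact isBigOp_zero

omit [∀ p, IsProbabilityMeasure (P p)] in
theorem isBigOp_mulVec_sub_mulVec {m n : Type*} [Fintype n] {L : ∀ p, Ω p → Matrix m n ℝ}
    {M : ∀ p, Ω p → Matrix n n ℝ} {r x : ∀ p, Ω p → n → ℝ} {a : ℕ × ℕ → ℝ} {i : m}
    (hL : ∀ k, IsBigOp P (fun p ω => L p ω i k) fun _ => 1)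
    (hr : ∀ k, IsBigOp P (fun p ω => r p ω k) a)
    (hM : ∀ k k', IsBigOp P (fun p ω => L p ω i k * (M p ω k k' * x p ω k')) a) :
    IsBigOp P (fun p ω => ((L p ω).mulVec (r p ω - (M p ω).mulVec (x p ω))) i) a := by
  refine (IsBigOp.sum Finset.univ fun k _ => ((hL k).one_mul (hr k)).sub
    (IsBigOp.sum Finset.univ fun k' _ => hM k k')).of_le (Eventually.of_forall fun p ω => ?_)
  simp only [Matrix.mulVec, dotProduct, Pi.sub_apply, mul_sub, Finset.mul_sum, le_refl]

include hA hI hM hF hFS hL hE hES in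
/-- The structural error of the second pass is nearly orthogonal to the instruments, since the
first-pass errors that it contains come from other subsamples. -/
theorem isBigOp_instruments_error (j : Fin 4) (l : FIdx k₁ k₂ ⊕ FIdx k₁ k₂) :
    IsBigOp P (fun p ω => (Params.rowMat SigF (1 : Matrix (FIdx k₁ k₂) (FIdx k₁ k₂) ℝ)
        (j + 2) (j + 3) ((S p).params SigF (I p.2) p.1 p.2 ω)).mulVec
      ((S p).errMoment (I p.2) p.1 p.2 ω - ((S p).moment (I p.2) p.1 p.2 ω).mulVec
        ((S p).errCoefHat (P p) lam SigF A (I p.2) p.1 p.2 j ω)) l) fun p => 1 / √(p.1 : ℝ) := by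
  obtain ⟨-, -, h02, h03, h12, h13⟩ := cyclic_ne j
  have hrow := isBigOp_rowMat hA hI hM hF hFS hL hE hES
    (1 : Matrix (FIdx k₁ k₂) (FIdx k₁ k₂) ℝ) (j + 2) (j + 3) l
  refine isBigOp_mulVec_sub_mulVec hrow (isBigOp_errMoment hI hM hE hES.averages)
    fun k k' => ?_
  have hcoef := isBigOp_errCoef hA hI hM hF hFS hL hE hES (lam := lam) j k'
  by_cases hk : ∃ i b, k = Sum.inr (i, b) ∧ i ≠ j + 2 ∧ i ≠ j + 3
  · obtain ⟨i, b, rfl, hi, hi'⟩ := hk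
    simp only [Params.rowMat, stack_apply_inr_of_ne hi hi', zero_mul]
    exact isBigOp_zero
  refine (hrow k).one_mul ?_
  rcases k' with g | ⟨i', b'⟩
  · simp only [Sample.errCoefHat, Sample.errCoef, Sum.elim_inl, Pi.zero_apply, mul_zero]
    exact isBigOp_zero
  by_cases hi' : i' = j ∨ i' = j + 1
  · refine IsBigOp.mul_one ?_ hcoef
    rcases k with g | ⟨i, b⟩
    · exact isBigOp_moment_inl_inr hI hM hE g i' b'
    · refine isBigOp_moment_inr_inr hI hM hE (fun h => hk ⟨i, b, rfl, ?_⟩) b b'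
      rcases hi' with rfl | rfl <;> subst h <;> constructor <;> assumption
  · rw [not_or] at hi'
    simp only [Sample.errCoefHat, errCoef_apply_inr_of_ne hi'.1 hi'.2, mul_zero]
    exact isBigOp_zero

include hA hI hM hF hFS hL hE hES in
/-- The error of each instrumental variables estimator relative to the ex-post risk premia. -/
theorem isBigOp_lamHat_sub_lamTilde (j : Fin 4) (a : FIdx k₁ k₂) :
    IsBigOp P (fun p ω => (Sample.scale k₁ k₂ (Fin kv) p.2 (Sum.inl a))⁻¹ * √(p.2 : ℝ) *
      ((S p).lamHat (P p) lam A (I p.2) p.1 p.2 j ω a - (S p).lamTilde (P p) lam p.2 ω a))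
      fun p => 1 / √(p.1 : ℝ) := by
  have hgain : ∀ l, IsBigOp P (fun p ω => gain
      (Params.crossMat SigF A j ((S p).params SigF (I p.2) p.1 p.2 ω))
      (Params.instrMat SigF j ((S p).params SigF (I p.2) p.1 p.2 ω)) (Sum.inl a) l) fun _ => 1 :=
    fun l => isBigOp_params hA hI hM hF hFS hL hE hES (j := j)
      (h := fun u => gain (Params.crossMat SigF A j u) (Params.instrMat SigF j u) (Sum.inl a) l)
      (continuousOn_matrix_elem (Params.continuousOn_gain SigF A j) (Sum.inl a) l)
  refine (IsBigOp.sum Finset.univ fun l _ => (hgain l).one_mul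
    (isBigOp_instruments_error hA hI hM hF hFS hL hE hES (lam := lam) j l)).of_whp ?_
  have hsize : Whp P fun p _ => p.1 ≠ 0 ∧ p.2 ≠ 0 ∧ p.2 / 4 ≠ 0 := by
    refine whp_of_eventually ?_
    filter_upwards [eventually_ge_atTop ((1, 4) : ℕ × ℕ)] with p hp _
    have h1 : 1 ≤ p.1 := hp.1
    have h2 : 4 ≤ p.2 := hp.2
    omega
  have hSig : SigF.det ≠ 0 := hF.posDef_SigF.det_pos.ne'
  refine ((hsize.and (whp_det_cov_ne_zero hSig hFS)).and
    (whp_params_mem_regularSet hA hI hM hF hFS hL hE hES j)).mono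
    (Eventually.of_forall fun p ω hω => ?_)
  obtain ⟨⟨⟨hN, hT, hτ⟩, hG⟩, hW, hC, hB⟩ := hω
  refine le_of_eq (congrArg _ ?_)
  exact (S p).lamHat_error (P p) lam hSig A hN hT (hI.card p.2) hτ
    (fun i t ht => hF.integral_F_eq p (Finset.mem_range.1 (hI.subset p.2 i ht))) hG j rfl rfl rfl
    rfl rfl rfl rfl hB hW hC a

end Rate

/-! ### Measurability of the estimator -/

section Measurability

variable {Ω : Type*} [MeasurableSpace Ω] {l m n : Type*}

theorem measurable_matrix_mul_apply [Fintype m] {M : Ω → Matrix l m ℝ} {M' : Ω → Matrix m n ℝ}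
    (hM : ∀ a b, Measurable fun ω => M ω a b) (hM' : ∀ a b, Measurable fun ω => M' ω a b)
    (a : l) (b : n) : Measurable fun ω => (M ω * M' ω) a b := by
  simp only [Matrix.mul_apply]
  exact Finset.measurable_fun_sum _ fun c _ => (hM a c).mul (hM' c b)

theorem measurable_mulVec_apply [Fintype m] {M : Ω → Matrix l m ℝ} {x : Ω → m → ℝ}
    (hM : ∀ a b, Measurable fun ω => M ω a b) (hx : ∀ b, Measurable fun ω => x ω b)
    (a : l) : Measurable fun ω => ((M ω).mulVec (x ω)) a := by
  simp only [Matrix.mulVec, dotProduct]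
  exact Finset.measurable_fun_sum _ fun c _ => (hM a c).mul (hx c)

theorem measurable_matrix_det [Fintype n] [DecidableEq n] {M : Ω → Matrix n n ℝ}
    (hM : ∀ a b, Measurable fun ω => M ω a b) : Measurable fun ω => (M ω).det := by
  simp only [Matrix.det_apply]
  exact Finset.measurable_fun_sum _ fun σ _ =>
    (Finset.measurable_fun_prod _ fun i _ => hM _ _).const_smul _

theorem measurable_matrix_inv_apply [Fintype n] [DecidableEq n] {M : Ω → Matrix n n ℝ}
    (hM : ∀ a b, Measurable fun ω => M ω a b) (a b : n) : Measurable fun ω => (M ω)⁻¹ a b := by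
  simp only [Matrix.inv_def, Ring.inverse_eq_inv', Matrix.smul_apply, smul_eq_mul,
    Matrix.adjugate_apply]
  refine (measurable_matrix_det hM).inv.mul (measurable_matrix_det fun c d => ?_)
  by_cases hc : c = b
  · subst hc
    simp only [Matrix.updateRow_self]
    exact measurable_const
  · simp only [Matrix.updateRow_ne hc]
    exact hM c d

theorem measurable_tsls_apply [Fintype n] [Fintype m] [Fintype l] [DecidableEq m] [DecidableEq l]
    {X : Ω → Matrix n m ℝ} {Z : Ω → Matrix n l ℝ} {Y : Ω → n → ℝ}
    (hX : ∀ a b, Measurable fun ω => X ω a b) (hZ : ∀ a b, Measurable fun ω => Z ω a b)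
    (hY : ∀ a, Measurable fun ω => Y ω a) (a : m) :
    Measurable fun ω => tsls (X ω) (Z ω) (Y ω) a := by
  have hZt : ∀ a b, Measurable fun ω => (Z ω).transpose a b := fun a b => hZ b a
  have hXt : ∀ a b, Measurable fun ω => (X ω).transpose a b := fun a b => hX b a
  have hXP := measurable_matrix_mul_apply hXt (measurable_matrix_mul_apply
    (measurable_matrix_mul_apply hZ
      (measurable_matrix_inv_apply (measurable_matrix_mul_apply hZt hZ))) hZt)
  exact measurable_mulVec_apply (measurable_matrix_inv_apply (measurable_matrix_mul_apply hXP hX))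
    (measurable_mulVec_apply hXP hY) a

end Measurability

variable {k₁ k₂ kv : ℕ} {Ω : ℕ × ℕ → Type*} [∀ p, MeasurableSpace (Ω p)]
  {P : ∀ p, Measure (Ω p)} {S : ∀ p, Sample k₁ k₂ kv (Ω p)}
  {lam : EuclideanSpace ℝ (FIdx k₁ k₂)} {A : Fin 4 → Matrix (Fin kv) (FIdx k₁ k₂) ℝ}
  {I : ℕ → Fin 4 → Finset ℕ}

theorem PricingModel.measurable_ret (hM : PricingModel P S) (p : ℕ × ℕ) {i t : ℕ} (hi : i < p.1)
    (ht : t < p.2) : Measurable ((S p).ret (P p) lam i t) := by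
  have h1 := hM.measurable_F p t ht
  have h2 := hM.measurable_v p t ht
  have h3 := hM.measurable_e p i hi t ht
  unfold Sample.ret
  fun_prop

theorem PricingModel.measurable_Fdem (hM : PricingModel P S) (p : ℕ × ℕ) {J : Finset ℕ}
    (hJ : J ⊆ Finset.range p.2) {t : ℕ} (ht : t ∈ J) : Measurable ((S p).Fdem J t) := by
  have h1 := hM.measurable_F p t (Finset.mem_range.1 (hJ ht))
  have h2 : Measurable fun ω => ∑ s ∈ J, (S p).F s ω :=
    Finset.measurable_fun_sum _ fun s hs => hM.measurable_F p s (Finset.mem_range.1 (hJ hs))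
  unfold Sample.Fdem
  fun_prop

theorem PricingModel.measurable_betaHat (hM : PricingModel P S) (p : ℕ × ℕ) {J : Finset ℕ}
    (hJ : J ⊆ Finset.range p.2) {i : ℕ} (hi : i < p.1) (a : FIdx k₁ k₂) :
    Measurable fun ω => (S p).betaHat (P p) lam J i ω a := by
  have hF : ∀ t ∈ J, ∀ a, Measurable fun ω => (S p).Fdem J t ω a := fun t ht a =>
    (show Measurable fun x : EuclideanSpace ℝ (FIdx k₁ k₂) => x a by fun_prop).comp
      (hM.measurable_Fdem p hJ ht)
  refine measurable_mulVec_apply (measurable_matrix_inv_apply fun b c => ?_) (fun b => ?_) a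
  · exact Finset.measurable_fun_sum _ fun t ht => (hF t ht b).mul (hF t ht c)
  · exact Finset.measurable_fun_sum _ fun t ht =>
      (hF t ht b).mul (hM.measurable_ret p hi (Finset.mem_range.1 (hJ ht)))

theorem measurable_toLp_of_apply {Ω ι : Type*} [MeasurableSpace Ω] [Fintype ι]
    {X : Ω → EuclideanSpace ℝ ι} (h : ∀ a, Measurable fun ω => X ω a) : Measurable X :=
  (show Measurable (WithLp.toLp 2 : (ι → ℝ) → EuclideanSpace ℝ ι) by fun_prop).comp
    (measurable_pi_lambda _ h)

theorem PricingModel.measurable_lam4S (hM : PricingModel P S) (hI : IsFourSplit I) (p : ℕ × ℕ) :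
    Measurable fun ω => (S p).lam4S (P p) lam A (I p.2) p.1 p.2 ω := by
  suffices h : ∀ j, Measurable fun ω => (S p).lamHat (P p) lam A (I p.2) p.1 p.2 j ω by
    have h' : Measurable fun ω => ∑ j, (S p).lamHat (P p) lam A (I p.2) p.1 p.2 j ω :=
      Finset.measurable_fun_sum _ fun j _ => h j
    unfold Sample.lam4S
    fun_prop
  refine fun j => measurable_toLp_of_apply fun a => ?_
  have hb : ∀ j, ∀ i : Fin p.1, ∀ a,
      Measurable fun ω => (S p).betaHat (P p) lam (I p.2 j) i ω a :=
    fun j i a => hM.measurable_betaHat p (hI.subset p.2 j) i.2 a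
  refine measurable_tsls_apply (X := fun ω => (S p).regressors (P p) lam A (I p.2) p.1 j ω)
    (Z := fun ω => (S p).instruments (P p) lam (I p.2) p.1 j ω)
    (Y := fun ω => (S p).avgRet (P p) lam p.1 p.2 ω) (fun i c => ?_) (fun i c => ?_) (fun i => ?_)
    (Sum.inl a)
  · rcases c with c | c
    · exact hb j i c
    · exact measurable_mulVec_apply (M := fun _ => A j)
        (x := fun ω => (S p).betaHat (P p) lam (I p.2 j) i ω -
          (S p).betaHat (P p) lam (I p.2 (j + 1)) i ω)
        (fun _ _ => measurable_const) (fun b => (hb j i b).sub (hb (j + 1) i b)) c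
  · rcases c with c | c
    · exact hb (j + 2) i c
    · exact (hb (j + 2) i c).sub (hb (j + 3) i c)
  · exact (Finset.measurable_fun_sum _ fun t ht =>
      hM.measurable_ret p i.2 (Finset.mem_range.1 ht)).const_mul _

theorem PricingModel.measurable_lamTilde (hM : PricingModel P S) (p : ℕ × ℕ) :
    Measurable fun ω => (S p).lamTilde (P p) lam p.2 ω := by
  have h : Measurable fun ω => ∑ t ∈ Finset.range p.2, ((S p).F t ω - ∫ ω', (S p).F t ω' ∂(P p)) :=
    Finset.measurable_fun_sum _ fun t ht =>
      (hM.measurable_F p t (Finset.mem_range.1 ht)).sub_const _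
  unfold Sample.lamTilde
  fun_prop

/-! ### The four-split estimator -/

theorem IsBigOp.of_apply {ι : Type*} [Fintype ι] {X : ∀ p, Ω p → EuclideanSpace ℝ ι}
    {a : ℕ × ℕ → ℝ} (h : ∀ i, IsBigOp P (fun p ω => X p ω i) a) : IsBigOp P X a := by
  refine (IsBigOp.sum Finset.univ fun i _ => (?_ : IsBigOp P (fun p ω => ‖X p ω i‖) a)).of_le
    (Eventually.of_forall fun p ω => ?_)
  · exact (h i).of_le (Eventually.of_forall fun p ω => by simp)
  · rw [Real.norm_of_nonneg (Finset.sum_nonneg fun i _ => norm_nonneg _), EuclideanSpace.norm_eq]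
    refine Real.sqrt_le_iff.2 ⟨Finset.sum_nonneg fun i _ => norm_nonneg _, ?_⟩
    exact Finset.sum_sq_le_sq_sum_of_nonneg fun i _ => norm_nonneg _

theorem Sample.lam4S_sub_apply {Ω : Type*} [MeasurableSpace Ω] (S : Sample k₁ k₂ kv Ω)
    (P : Measure Ω) (I : Fin 4 → Finset ℕ) (N T : ℕ) (ω : Ω) (a : FIdx k₁ k₂) :
    S.lam4S P lam A I N T ω a - S.lamTilde P lam T ω a =
      (4 : ℝ)⁻¹ * ∑ j, (S.lamHat P lam A I N T j ω a - S.lamTilde P lam T ω a) := by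
  simp only [lam4S, PiLp.smul_apply, WithLp.ofLp_sum, Finset.sum_apply, smul_eq_mul,
    Finset.sum_sub_distrib, Finset.sum_const, Finset.card_univ, Fintype.card_fin, nsmul_eq_mul]
  push_cast
  ring

variable [∀ p, IsProbabilityMeasure (P p)] {SigF OmF SigSF : Matrix (FIdx k₁ k₂) (FIdx k₁ k₂) ℝ}
  {OmvF : Matrix (FIdx k₁ k₂ × Fin kv) (FIdx k₁ k₂ × Fin kv) ℝ}
  {Γ : Matrix (GIdx k₁ k₂ kv) (GIdx k₁ k₂ kv) ℝ}

section FourSplitRate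

variable (hA : ∀ j, (A j).rank = kv) (hI : IsFourSplit I) (hM : PricingModel P S)
  (hF : Factors P S SigF OmF OmvF) (hFS : FactorsOnSplit P S SigF OmvF I) (hL : Loadings S Γ)
  (hE : Errors P S SigSF) (hES : ErrorsOnSplit P S SigSF I)

include hA hI hM hF hFS hL hE hES in
theorem isBigOp_lam4S_sub_lamTilde (a : FIdx k₁ k₂) :
    IsBigOp P (fun p ω => (Sample.scale k₁ k₂ (Fin kv) p.2 (Sum.inl a))⁻¹ * √(p.2 : ℝ) *
      ((S p).lam4S (P p) lam A (I p.2) p.1 p.2 ω a - (S p).lamTilde (P p) lam p.2 ω a))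
      fun p => 1 / √(p.1 : ℝ) := by
  refine ((IsBigOp.sum Finset.univ fun j _ => isBigOp_lamHat_sub_lamTilde hA hI hM hF hFS hL hE hES
    (lam := lam) j a).smul_of_le (c := fun _ => (4 : ℝ)⁻¹) (C := (4 : ℝ)⁻¹)
      (b := fun p => 1 / √(p.1 : ℝ))
      (Eventually.of_forall fun p => by positivity) (Eventually.of_forall fun p => ?_)).of_le
      (Eventually.of_forall fun p ω => le_of_eq (congrArg _ ?_))
  · rw [abs_of_nonneg (by norm_num)]
  · rw [Sample.lam4S_sub_apply, smul_eq_mul, ← Finset.mul_sum]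
    ring

include hA hI hM hF hFS hL hE hES in
theorem isBigOp_strong :
    IsBigOp P (fun p ω =>
        √(p.2 : ℝ) • strong ((S p).lam4S (P p) lam A (I p.2) p.1 p.2 ω - lam)
          - √(p.2 : ℝ) • strong ((S p).lamTilde (P p) lam p.2 ω - lam))
      fun p => 1 / √(p.1 : ℝ) := by
  refine IsBigOp.of_apply fun a => ?_
  refine (isBigOp_lam4S_sub_lamTilde hA hI hM hF hFS hL hE hES (lam := lam) (Sum.inl a)).of_le
    (Eventually.of_forall fun p ω => le_of_eq (congrArg _ ?_))
  simp only [strong, Sample.scale, PiLp.sub_apply, PiLp.smul_apply, smul_eq_mul, Sum.elim_inl,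
    inv_one, one_mul]
  ring

include hA hI hM hF hFS hL hE hES in
theorem isBigOp_weak_sub_lamTilde (b : Fin k₂) :
    IsBigOp P (fun p ω => (S p).lam4S (P p) lam A (I p.2) p.1 p.2 ω (Sum.inr b) -
      (S p).lamTilde (P p) lam p.2 ω (Sum.inr b)) fun p => 1 / √(p.1 : ℝ) := by
  refine (isBigOp_lam4S_sub_lamTilde hA hI hM hF hFS hL hE hES (lam := lam) (Sum.inr b)).of_le ?_
  filter_upwards [eventually_split_size] with p hp ω
  have : √(p.2 : ℝ) ≠ 0 := (Real.sqrt_pos.2 hp.2.1).ne'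
  simp [Sample.scale, this]

include hA hI hM hF hFS hL hE hES in
theorem isBigOp_weak :
    IsBigOp P (fun p ω =>
        √(min p.1 p.2 : ℝ) • weak ((S p).lam4S (P p) lam A (I p.2) p.1 p.2 ω - lam))
      fun _ => 1 := by
  refine IsBigOp.of_apply fun b => ?_
  have h1 := (isBigOp_weak_sub_lamTilde hA hI hM hF hFS hL hE hES (lam := lam) b).smul_of_le
    (c := fun p => √(min p.1 p.2 : ℝ)) (b := fun _ => 1) (C := 1)
    (Eventually.of_forall fun p => by positivity) (by
      filter_upwards [eventually_split_size] with p hp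
      rw [abs_of_nonneg (Real.sqrt_nonneg _), mul_one_div, mul_one,
        div_le_one (Real.sqrt_pos.2 hp.1)]
      exact Real.sqrt_le_sqrt (min_le_left _ _))
  have h2 := (isBigOp_lamTilde_sub (lam := lam) hF (Sum.inr b)).smul_of_le
    (c := fun p => √(min p.1 p.2 : ℝ)) (b := fun _ => 1) (C := 1)
    (Eventually.of_forall fun p => by positivity) (by
      filter_upwards [eventually_split_size] with p hp
      rw [abs_of_nonneg (Real.sqrt_nonneg _), mul_one_div, mul_one,
        div_le_one (Real.sqrt_pos.2 hp.2.1)]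
      exact Real.sqrt_le_sqrt (min_le_right _ _))
  refine (h1.add h2).of_le (Eventually.of_forall fun p ω => le_of_eq (congrArg _ ?_))
  simp only [weak, PiLp.sub_apply, PiLp.smul_apply, smul_eq_mul]
  ring

theorem tendsto_inv_sqrt_min :
    Tendsto (fun p : ℕ × ℕ => (√(min p.1 p.2 : ℝ))⁻¹) atTop (𝓝 0) := by
  refine tendsto_inv_atTop_zero.comp (Real.tendsto_sqrt_atTop.comp ?_)
  have h2 : Tendsto (fun p : ℕ × ℕ => (p.2 : ℝ)) atTop atTop :=
    tendsto_natCast_atTop_atTop.comp tendsto_snd_atTop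
  refine tendsto_atTop.2 fun b => ?_
  filter_upwards [tendsto_fst_atTop_real.eventually_ge_atTop b, h2.eventually_ge_atTop b]
    with p h1 h2
  exact le_min h1 h2

include hA hI hM hF hFS hL hE hES in
theorem tendstoInProb_weak : TendstoInProb P
    (fun p ω => weak ((S p).lam4S (P p) lam A (I p.2) p.1 p.2 ω)) (weak lam) := by
  have h := (isBigOp_weak hA hI hM hF hFS hL hE hES (lam := lam)).smul_of_le
    (c := fun p => (√(min p.1 p.2 : ℝ))⁻¹) (b := fun p => (√(min p.1 p.2 : ℝ))⁻¹) (C := 1)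
    (Eventually.of_forall fun p => zero_le_one) (Eventually.of_forall fun p => by
      rw [abs_of_nonneg (by positivity), one_mul, mul_one])
  have h' : IsBigOp P (fun p ω => weak ((S p).lam4S (P p) lam A (I p.2) p.1 p.2 ω - lam))
      fun p => (√(min p.1 p.2 : ℝ))⁻¹ := by
    refine h.of_le ?_
    filter_upwards [eventually_split_size] with p hp ω
    have : √(min p.1 p.2 : ℝ) ≠ 0 := (Real.sqrt_pos.2 (lt_min hp.1 hp.2.1)).ne'
    rw [smul_smul, inv_mul_cancel₀ this, one_smul]
  intro ε hε
  refine (h'.tendstoInProb tendsto_inv_sqrt_min ε hε).congr fun p => ?_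
  simp only [sub_zero]
  rfl

omit [∀ p, IsProbabilityMeasure (P p)] in
theorem continuous_strong :
    Continuous (strong : EuclideanSpace ℝ (FIdx k₁ k₂) → EuclideanSpace ℝ (Fin k₁)) := by
  unfold strong; fun_prop

include hM hF in
theorem tendstoInDistribution_strong_lamTilde : TendstoInDistribution
    (fun p ω => √(p.2 : ℝ) • strong ((S p).lamTilde (P p) lam p.2 ω - lam))
      atTop id P (multivariateGaussian 0 (OmF.submatrix Sum.inl Sum.inl)) := by
  obtain ⟨ν, hν, -, -, hclt⟩ := hF.clt
  have hcont : Continuous fun x : EuclideanSpace ℝ (FIdx k₁ k₂) ×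
      EuclideanSpace ℝ (FIdx k₁ k₂ × Fin kv) × EuclideanSpace ℝ (Fin kv) => strong x.1 :=
    continuous_strong.comp continuous_fst
  have h := hclt.continuous_comp hcont
  have heq : ∀ᶠ p : ℕ × ℕ in atTop, ∀ ω, strong ((S p).normF (P p) p.2 ω) =
      √(p.2 : ℝ) • strong ((S p).lamTilde (P p) lam p.2 ω - lam) := by
    filter_upwards [eventually_split_size] with p hp ω
    have : √(p.2 : ℝ) ≠ 0 := (Real.sqrt_pos.2 hp.2.1).ne'
    rw [Sample.lamTilde_eq, add_sub_cancel_left]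
    ext a
    simp [strong, this]
  have hmeas : ∀ p, Measurable fun ω =>
      √(p.2 : ℝ) • strong ((S p).lamTilde (P p) lam p.2 ω - lam) := fun p =>
    (continuous_strong.measurable.comp ((hM.measurable_lamTilde p).sub_const lam)).const_smul
      (√(p.2 : ℝ))
  refine ⟨fun p => (hmeas p).aemeasurable, aemeasurable_id, ?_⟩
  refine (Tendsto.congr' ?_ h.tendsto).trans (le_of_eq (congrArg 𝓝 (Subtype.ext ?_)))
  · filter_upwards [heq] with p hp
    exact Subtype.ext (congrArg (fun f => (P p).map f) (funext hp))
  · change ν.toMeasure.map (fun x => strong x.1) = Measure.map id _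
    rw [Measure.map_id, ← map_strong_multivariateGaussian hF.posSemidef_OmF, ← hν,
      Measure.map_map continuous_strong.measurable measurable_fst]
    rfl

include hA hI hM hF hFS hL hE hES in
theorem tendstoInDistribution_strong_lam4S : TendstoInDistribution
    (fun p ω => √(p.2 : ℝ) • strong ((S p).lam4S (P p) lam A (I p.2) p.1 p.2 ω - lam))
      atTop id P (multivariateGaussian 0 (OmF.submatrix Sum.inl Sum.inl)) :=
  TendstoInDistribution.of_sub_tendstoInProb
    (tendstoInDistribution_strong_lamTilde hM hF (lam := lam))
    (fun p => (continuous_strong.measurable.comp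
      ((hM.measurable_lamTilde p).sub_const lam)).const_smul (√(p.2 : ℝ)))
    (fun p => (continuous_strong.measurable.comp
      ((hM.measurable_lam4S hI p).sub_const lam)).const_smul (√(p.2 : ℝ)))
    ((isBigOp_strong hA hI hM hF hFS hL hE hES (lam := lam)).tendstoInProb
      tendsto_one_div_sqrt_fst)

end FourSplitRate

end FourSplit

open FourSplit in
theorem theorem2 {k₁ k₂ kv : ℕ} {Ω : ℕ × ℕ → Type*} [∀ p, MeasurableSpace (Ω p)]
    (P : ∀ p, Measure (Ω p)) [∀ p, IsProbabilityMeasure (P p)]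
    (S : ∀ p, Sample k₁ k₂ kv (Ω p)) (lam : EuclideanSpace ℝ (FIdx k₁ k₂))
    (SigF OmF SigSF : Matrix (FIdx k₁ k₂) (FIdx k₁ k₂) ℝ)
    (OmvF : Matrix (FIdx k₁ k₂ × Fin kv) (FIdx k₁ k₂ × Fin kv) ℝ)
    (Γ : Matrix (GIdx k₁ k₂ kv) (GIdx k₁ k₂ kv) ℝ)
    (A : Fin 4 → Matrix (Fin kv) (FIdx k₁ k₂) ℝ) (hA : ∀ j, (A j).rank = kv)
    (I : ℕ → Fin 4 → Finset ℕ) (hI : IsFourSplit I)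
    (hModel : PricingModel P S)
    (hFactors : Factors P S SigF OmF OmvF) (hFactorsSplit : FactorsOnSplit P S SigF OmvF I)
    (hLoadings : Loadings S Γ)
    (hErrors : Errors P S SigSF) (hErrorsSplit : ErrorsOnSplit P S SigSF I) :
    -- strong factors: `√T(λ̂₁ - λ₁) = √T(λ̃₁ - λ₁) + O_p(1/√N)`
    IsBigOp P (fun p ω =>
        √(p.2 : ℝ) • strong ((S p).lam4S (P p) lam A (I p.2) p.1 p.2 ω - lam)
          - √(p.2 : ℝ) • strong ((S p).lamTilde (P p) lam p.2 ω - lam))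
      (fun p => 1 / √(p.1 : ℝ)) ∧
    -- and both sides converge weakly to `N(0, Ω_F)` (its strong block)
    TendstoInDistribution (fun p ω =>
        √(p.2 : ℝ) • strong ((S p).lamTilde (P p) lam p.2 ω - lam))
      atTop id P (multivariateGaussian 0 (OmF.submatrix Sum.inl Sum.inl)) ∧
    TendstoInDistribution (fun p ω =>
        √(p.2 : ℝ) • strong ((S p).lam4S (P p) lam A (I p.2) p.1 p.2 ω - lam))
      atTop id P (multivariateGaussian 0 (OmF.submatrix Sum.inl Sum.inl)) ∧
    -- weak factors: rate `√min{N,T}`, hence consistency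
    IsBigOp P (fun p ω =>
        √(min p.1 p.2 : ℝ) • weak ((S p).lam4S (P p) lam A (I p.2) p.1 p.2 ω - lam))
      (fun _ => 1) ∧
    TendstoInProb P (fun p ω => weak ((S p).lam4S (P p) lam A (I p.2) p.1 p.2 ω)) (weak lam) := by
  exact ⟨isBigOp_strong hA hI hModel hFactors hFactorsSplit hLoadings hErrors hErrorsSplit,
    tendstoInDistribution_strong_lamTilde hModel hFactors,
    tendstoInDistribution_strong_lam4S hA hI hModel hFactors hFactorsSplit hLoadings hErrors
      hErrorsSplit,
    isBigOp_weak hA hI hModel hFactors hFactorsSplit hLoadings hErrors hErrorsSplit,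
    tendstoInProb_weak hA hI hModel hFactors hFactorsSplit hLoadings hErrors hErrorsSplit⟩
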